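/- **Setting.** For each $n\in\mathbb N$ let $p=p_n\ge 1$, let $\tilde T\ge 0$ (failure time) and $U\ge 0$ (censoring time) be random variables, let $Z=\{Z(t)\}$ be a jointly measurable $\mathbb R^p$-valued covariate process, let $\beta^o\in\mathbb R^p$ and let $\lambda_0\ge 0$ be a measurable function; all of these may depend on $n$. Put $T=\min(\tilde T,U)$, $\delta=\mathbb 1\{\tilde T\le U\}$, $N(t)=\mathbb 1\{T\le t,\delta=1\}$, $Y(t)=\mathbb 1\{T\ge t\}$, $t_+=\inf\{t\ge 0:\mathbb P(T\le t)=1\}\in[0,\infty]$, and $\mathcal T=[0,t_+]$ if $t_+<\infty$, $\mathcal T=[0,\infty)$ otherwise. Assume that $\tilde T$ and $U$ are conditionally independent given $\{Z(t):t\in\mathcal T\}$, that $\lambda_0$ is integrable on $[0,t]$ for every $t<t_+$, and that the conditional hazard of $\tilde T$ given $\{Z(t):t\in\mathcal T\}$ is $\lambda_0(t)\exp(\beta^{o\top}Z(t))$ on $[0,t_+)$, that is, $\mathbb P(\tilde T>t\mid Z)=\exp(-\int_0^t\lambda_0(s)e^{\beta^{o\top}Z(s)}\,ds)$ almost surely for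 $0\le t<t_+$. Let $(\tilde T_i,U_i,Z_i)$, $i=1,\dots,n$, be independent copies of $(\tilde T,U,Z)$, with $T_i,\delta_i,Y_i$ formed as above. Define $$\ell(\beta)=\frac1n\sum_{i=1}^n\delta_i\,\beta^\top Z_i(T_i)-\frac1n\sum_{i=1}^n\delta_i\log\Bigl(\sum_{j=1}^nY_j(T_i)e^{\beta^\top Z_j(T_i)}\Bigr),\qquad \bar Z(s,\beta)=\frac{\sum_iZ_i(s)Y_i(s)e^{\beta^\top Z_i(s)}}{\sum_jY_j(s)e^{\beta^\top Z_j(s)}}\quad(0/0:=0),$$ $$\hat{\mathcal V}(\beta)=\frac1n\sum_{i=1}^n\delta_i\{Z_i(T_i)-\bar Z(T_i,\beta)\}\{Z_i(T_i)-\bar Z(T_i,\beta)\}^\top,\qquad \mu(t)=\frac{\mathbb E\{Z(t)Y(t)e^{\beta^{o\top}Z(t)}\}}{\mathbb E\{Y(t)e^{\beta^{o\top}Z(t)}\}},$$ $$\Sigma=\mathbb E\int_{\mathcal T}\{Z(s)-\mu(s)\}\{Z(s)-\mu(s)\}^\top dN(s).$$ Let $\hat\beta$ be any minimiser over $\beta\in\mathbb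 R^p$ of $-\ell(\beta)+\lambda\|\beta\|_1$, where $\lambda=\lambda_n>0$. For a matrix $A$, $\|A\|_\infty=\max_{j,k}|A_{jk}|$ and $\|A\|_{op,1}=\sup_{v\ne0}\|Av\|_1/\|v\|_1$. Let $\mathcal S=\{j:\beta^o_j\ne0\}$, let $\mathcal N$ be its complement, and let $d_o=|\mathcal S|$. **Assumptions.** As $n\to\infty$: * (A1) $\|Z(t)\|_\infty\le K_Z$ almost surely for each $t\in\mathcal T$, with a constant $K_Z>0$ not depending on $n$; and, for each $n$, there is a deterministic $L$ such that almost surely $\|Z(s)-Z(t)\|_\infty\le L|s-t|$ for all $s,t\in\mathcal T$. * (A2)(a) For each $n$, $T$ has a bounded density with respect to Lebesgue measure. * (A3)(b) $d_o=o\bigl(n^{1/2}/\log^{1/2}(np)\bigr)$. * (A4)(a) $1/\kappa=O_p(1)$, where $$\kappa=\inf_{v\in\mathbb R^p\setminus\{0\}:\ \|v_{\mathcal N}\|_1\le2\|v_{\mathcal S}\|_1}\frac{d_o^{1/2}\{-v^\top\ddot\ell(\beta^o)v\}^{1/2}}{\|v_{\mathcal S}\|_1}$$ (with $\kappa=\infty$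 if $\mathcal S=\emptyset$), $\ddot\ell$ being the Hessian of $\ell$. * $\|\beta^o\|_1=O(1)$, and $\Sigma$ is invertible for each $n$. **Lemma.** For every $K_Z>0$ there is a constant $A_0>0$, depending only on $K_Z$, such that the following holds. Under the assumptions above, let $\lambda\asymp n^{-1/2}\log^{1/2}(np)$ with $\lambda\ge A_0\,n^{-1/2}\log^{1/2}(np)$ for all large $n$. Then, for every $\eta\in(0,1/3)$, $$\|\hat{\mathcal V}(\hat\beta)\Sigma^{-1}-I\|_\infty=O_p\Bigl\{\max\Bigl(\|\Sigma^{-1}\|_{op,1}\frac{\max(d_o,1)\log^{1/2}(np)}{n^{1/2}},\ \|\Sigma^{-1}\|_{op,1}\,n^{-(1/3-\eta)}\Bigr)\Bigr\}.$$ -/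

import Mathlib

open MeasureTheory ProbabilityTheory Filter Asymptotics
open scoped ENNReal Topology Matrix

noncomputable section

/-- The data attached to one generic individual, as functions on a space `E` of individuals:
failure time, censoring time and `p`-variate covariate process (of which only the values at
times in `timeSet` matter), together with the baseline hazard and the true coefficient vector. -/
structure CoxData (E : Type*) (p : ℕ) where
  failTime : E → ℝ
  censTime : E → ℝ
  cov : ℝ → E → Fin p → ℝ
  baseHaz : ℝ → ℝ
  coef : Fin p → ℝ

namespace CoxData

variable {E : Type*} {p n : ℕ}

/-- Observed time `T = min (T̃, U)`. -/
def obsTime (D : CoxData E p) (e : E) : ℝ := min (D.failTime e) (D.censTime e)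

/-- Failure indicator `δ = 1{T̃ ≤ U}`.  The counting process `N(t) = 1{T ≤ t, δ = 1}` has a single
possible jump, of size `δ` at `T`, so that the integral of `g` against `dN` is `δ * g T`. -/
def event (D : CoxData E p) (e : E) : ℝ := if D.failTime e ≤ D.censTime e then 1 else 0

/-- At-risk indicator `Y(t) = 1{T ≥ t}`. -/
def atRisk (D : CoxData E p) (t : ℝ) (e : E) : ℝ := if t ≤ D.obsTime e then 1 else 0

/-- The weight `Y(t) exp (βᵀ Z(t))`. -/
def weight (D : CoxData E p) (t : ℝ) (b : Fin p → ℝ) (e : E) : ℝ :=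
  D.atRisk t e * Real.exp (b ⬝ᵥ D.cov t e)

/-! ### Population quantities -/

/-- Upper end `t₊ = inf {t ≥ 0 : F_T(t) = 1}` of the support of `T`, possibly infinite. -/
def tPlus [MeasurableSpace E] (D : CoxData E p) (μ : Measure E) : EReal :=
  sInf ((fun t : ℝ => (t : EReal)) '' {t : ℝ | 0 ≤ t ∧ μ {e | D.obsTime e ≤ t} = 1})

/-- The time index set: `[0, t₊]` if `t₊ < ∞`, and `[0, ∞)` otherwise. -/
def timeSet [MeasurableSpace E] (D : CoxData E p) (μ : Measure E) : Set ℝ :=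
  {t : ℝ | 0 ≤ t ∧ (t : EReal) ≤ D.tPlus μ}

/-- The sigma-algebra generated by the covariate process `{Z(t) : t ∈ timeSet}`. -/
abbrev covSigma [MeasurableSpace E] (D : CoxData E p) (μ : Measure E) : MeasurableSpace E :=
  ⨆ t ∈ D.timeSet μ, MeasurableSpace.comap (D.cov t) inferInstance

/-- The Cox proportional hazards model with independent censoring. -/
structure IsCoxModel [MeasurableSpace E] (D : CoxData E p) (μ : Measure E) : Prop where
  measurable_failTime : Measurable D.failTime
  measurable_censTime : Measurable D.censTime
  measurable_cov : Measurable fun x : ℝ × E => D.cov x.1 x.2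
  failTime_nonneg : ∀ e, 0 ≤ D.failTime e
  censTime_nonneg : ∀ e, 0 ≤ D.censTime e
  measurable_baseHaz : Measurable D.baseHaz
  baseHaz_nonneg : ∀ t, 0 ≤ D.baseHaz t
  integrable_baseHaz : ∀ t : ℝ, (t : EReal) < D.tPlus μ →
    IntegrableOn D.baseHaz (Set.Icc 0 t) volume
  /-- `T̃` and `U` are conditionally independent given the covariate process. -/
  condIndep : ∀ A B : Set ℝ, MeasurableSet A → MeasurableSet B →
    μ[(D.failTime ⁻¹' A ∩ D.censTime ⁻¹' B).indicator (fun _ => (1 : ℝ)) | D.covSigma μ]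
      =ᵐ[μ] fun e =>
        (μ[(D.failTime ⁻¹' A).indicator (fun _ => (1 : ℝ)) | D.covSigma μ]) e *
        (μ[(D.censTime ⁻¹' B).indicator (fun _ => (1 : ℝ)) | D.covSigma μ]) e
  /-- The conditional hazard of `T̃` given the covariate process is `λ₀(t) exp (βᵀ Z(t))`:
  the conditional survival function is the exponential of minus the integrated hazard. -/
  hazard : ∀ t : ℝ, 0 ≤ t → (t : EReal) < D.tPlus μ →
    μ[{e | t < D.failTime e}.indicator (fun _ => (1 : ℝ)) | D.covSigma μ]
      =ᵐ[μ] fun e =>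
        Real.exp (-∫ s in (0 : ℝ)..t, D.baseHaz s * Real.exp (D.coef ⬝ᵥ D.cov s e))

/-- The covariate process is bounded by `K` in sup norm, almost surely at each time. -/
def CovBounded [MeasurableSpace E] (D : CoxData E p) (μ : Measure E) (K : ℝ) : Prop :=
  ∀ t ∈ D.timeSet μ, ∀ᵐ e ∂μ, ∀ j, |D.cov t e j| ≤ K

/-- The covariate process is almost surely `L`-Lipschitz in sup norm. -/
def CovLipschitz [MeasurableSpace E] (D : CoxData E p) (μ : Measure E) (L : ℝ) : Prop :=
  ∀ᵐ e ∂μ, ∀ s ∈ D.timeSet μ, ∀ t ∈ D.timeSet μ, ∀ j,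
    |D.cov s e j - D.cov t e j| ≤ L * |s - t|

/-- The observed time `T` has a bounded density with respect to Lebesgue measure. -/
def HasBoundedDensity [MeasurableSpace E] (D : CoxData E p) (μ : Measure E) : Prop :=
  ∃ (f : ℝ → ℝ) (C : ℝ), Measurable f ∧ (∀ t, 0 ≤ f t ∧ f t ≤ C) ∧
    μ.map D.obsTime = volume.withDensity fun t => ENNReal.ofReal (f t)

/-- `μ(t, β) = E{Z(t) Y(t) exp(βᵀZ(t))} / E{Y(t) exp(βᵀZ(t))}`. -/
def popMean [MeasurableSpace E] (D : CoxData E p) (μ : Measure E) (t : ℝ) (b : Fin p → ℝ) :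
    Fin p → ℝ :=
  fun j => (∫ e, D.cov t e j * D.weight t b e ∂μ) / ∫ e, D.weight t b e ∂μ

/-- `Σ = E ∫ {Z(s) - μ(s, β°)}{Z(s) - μ(s, β°)}ᵀ dN(s)`. -/
def popSigma [MeasurableSpace E] (D : CoxData E p) (μ : Measure E) :
    Matrix (Fin p) (Fin p) ℝ :=
  Matrix.of fun j k => ∫ e, D.event e *
    ((D.cov (D.obsTime e) e j - D.popMean μ (D.obsTime e) D.coef j) *
     (D.cov (D.obsTime e) e k - D.popMean μ (D.obsTime e) D.coef k)) ∂μ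

/-- The support of the true coefficient vector. -/
def active (D : CoxData E p) : Finset (Fin p) := {j | D.coef j ≠ 0}

/-- The sparsity level: the number of non-zero true coefficients. -/
def sparsity (D : CoxData E p) : ℕ := D.active.card

/-! ### Sample quantities, for a sample `x 0, …, x (n - 1)` of individuals -/

/-- The log-partial likelihood divided by `n`. -/
def logPL (D : CoxData E p) (x : Fin n → E) (b : Fin p → ℝ) : ℝ :=
  (1 / (n : ℝ)) * ∑ i, D.event (x i) * (b ⬝ᵥ D.cov (D.obsTime (x i)) (x i)) -
  (1 / (n : ℝ)) * ∑ i, D.event (x i) *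
    Real.log (∑ j, D.weight (D.obsTime (x i)) b (x j))

/-- `b` minimises the `ℓ₁`-penalised negative log-partial likelihood. -/
def IsLasso (D : CoxData E p) (x : Fin n → E) (lam : ℝ) (b : Fin p → ℝ) : Prop :=
  ∀ b' : Fin p → ℝ, -D.logPL x b + lam * ∑ j, |b j| ≤ -D.logPL x b' + lam * ∑ j, |b' j|

/-- The weighted average of the covariate processes (with `0 / 0 = 0`). -/
def Zbar (D : CoxData E p) (x : Fin n → E) (t : ℝ) (b : Fin p → ℝ) : Fin p → ℝ :=
  fun k => ∑ i, D.cov t (x i) k * (D.weight t b (x i) / ∑ j, D.weight t b (x j))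

/-- `n⁻¹ ∑ᵢ δᵢ {Zᵢ(Tᵢ) - Z̄(Tᵢ, β)}{Zᵢ(Tᵢ) - Z̄(Tᵢ, β)}ᵀ`. -/
def Vhat (D : CoxData E p) (x : Fin n → E) (b : Fin p → ℝ) : Matrix (Fin p) (Fin p) ℝ :=
  Matrix.of fun j k => (1 / (n : ℝ)) * ∑ i, D.event (x i) *
    ((D.cov (D.obsTime (x i)) (x i) j - D.Zbar x (D.obsTime (x i)) b j) *
     (D.cov (D.obsTime (x i)) (x i) k - D.Zbar x (D.obsTime (x i)) b k))

/-- The Hessian matrix of the log-partial likelihood. -/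
def hessPL (D : CoxData E p) (x : Fin n → E) (b : Fin p → ℝ) : Matrix (Fin p) (Fin p) ℝ :=
  Matrix.of fun j k =>
    fderiv ℝ (fun c => fderiv ℝ (D.logPL x) c (Pi.single k 1)) b (Pi.single j 1)

/-- The compatibility factor of the negative Hessian at the true coefficient vector: the infimum
of `d^(1/2) {vᵀ(-H)v}^(1/2) / ‖v_S‖₁` over non-zero `v` with `‖v_N‖₁ ≤ 2 ‖v_S‖₁`
(so `∞` if `S` is empty). -/
def kappa (D : CoxData E p) (x : Fin n → E) : ℝ≥0∞ :=
  ⨅ v ∈ {v : Fin p → ℝ | v ≠ 0 ∧ ∑ j ∈ D.activeᶜ, |v j| ≤ 2 * ∑ j ∈ D.active, |v j|},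
    ENNReal.ofReal (√(D.sparsity : ℝ) * √(v ⬝ᵥ ((-D.hessPL x D.coef) *ᵥ v)) /
      ∑ j ∈ D.active, |v j|)

end CoxData

/-- Entrywise maximum absolute norm of a matrix. -/
def matMax {p : ℕ} (A : Matrix (Fin p) (Fin p) ℝ) : ℝ := ⨆ jk : Fin p × Fin p, |A jk.1 jk.2|

/-- Operator `ℓ₁` norm of a matrix: the supremum of `‖A v‖₁ / ‖v‖₁` over non-zero `v`. -/
def matOpOne {p : ℕ} (A : Matrix (Fin p) (Fin p) ℝ) : ℝ :=
  ⨆ v : {v : Fin p → ℝ // v ≠ 0}, (∑ i, |(A *ᵥ v.1) i|) / ∑ j, |v.1 j|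

/-- `X n = O_p(r n)` for non-negative, possibly infinite, `X n`. -/
def IsBigOp {Ω : ℕ → Type*} [∀ n, MeasurableSpace (Ω n)] (P : ∀ n, Measure (Ω n))
    (X : ∀ n, Ω n → ℝ≥0∞) (r : ℕ → ℝ) : Prop :=
  ∀ ε : ℝ, 0 < ε → ∃ M : ℝ, 0 < M ∧ ∀ᶠ n in atTop,
    P n {ω | ENNReal.ofReal (M * r n) < X n ω} ≤ ENNReal.ofReal ε

/-- The rate `n^(-1/2) log^(1/2) (n p)`. -/
def baseRate (p : ℕ → ℕ) (n : ℕ) : ℝ := √(Real.log ((n : ℝ) * (p n : ℝ))) / √(n : ℝ)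

end

/-! ### An exponential inequality for the score with fixed covariate paths -/

theorem Real.exp_le_add_exp_sq (x : ℝ) : Real.exp x ≤ x + Real.exp (x ^ 2) := by
  have h2 := Real.add_one_le_exp (x ^ 2)
  rcases le_or_gt |x| 1 with h | h
  · have := (abs_le.1 (Real.abs_exp_sub_one_sub_id_le h)).2
    linarith
  · rcases lt_abs.1 h with h | h
    · have : Real.exp x ≤ Real.exp (x ^ 2) := Real.exp_le_exp.2 (by nlinarith)
      linarith
    · have : Real.exp x ≤ 1 := Real.exp_le_one_iff.2 (by linarith)
      nlinarith

/-- Under a probability vector proportional to `r`, a centred variable bounded by `2K` is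
sub-Gaussian. -/
theorem sum_mul_exp_sub_mean_le {ι : Type*} [Fintype ι] {r z : ι → ℝ} (hr : ∀ i, 0 < r i) {K : ℝ}
    (hz : ∀ i, |z i| ≤ K) (s : ℝ) :
    ∑ i, r i * Real.exp (s * (z i - (∑ j, z j * r j) / ∑ j, r j) - 4 * K ^ 2 * s ^ 2)
      ≤ ∑ i, r i := by
  rcases isEmpty_or_nonempty ι with h | h
  · simp
  have hR : 0 < ∑ j, r j := Finset.sum_pos (fun i _ => hr i) Finset.univ_nonempty
  set m := (∑ j, z j * r j) / ∑ j, r j with hm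
  have hmb : |m| ≤ K := by
    rw [hm, abs_div, abs_of_pos hR, div_le_iff₀ hR, Finset.mul_sum]
    refine (Finset.abs_sum_le_sum_abs _ _).trans (Finset.sum_le_sum fun i _ => ?_)
    rw [abs_mul, abs_of_pos (hr i)]
    exact mul_le_mul_of_nonneg_right (hz i) (hr i).le
  have hzero : ∑ i, r i * (s * (z i - m)) = 0 := by
    have : ∑ i, r i * (s * (z i - m)) = s * (∑ j, z j * r j - m * ∑ j, r j) := by
      rw [mul_sub, Finset.mul_sum, Finset.mul_sum, Finset.mul_sum, ← Finset.sum_sub_distrib]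
      exact Finset.sum_congr rfl fun i _ => by ring
    rw [this, hm, div_mul_cancel₀ _ hR.ne']
    ring
  have key : ∀ i, r i * Real.exp (s * (z i - m)) ≤
      r i * (s * (z i - m)) + r i * Real.exp (4 * K ^ 2 * s ^ 2) := by
    intro i
    rw [← mul_add]
    refine mul_le_mul_of_nonneg_left ((Real.exp_le_add_exp_sq _).trans ?_) (hr i).le
    have hb : |z i - m| ≤ 2 * K := (abs_sub _ _).trans (by linarith [hz i])
    have : (z i - m) ^ 2 ≤ (2 * K) ^ 2 := sq_le_sq' (abs_le.1 hb).1 (abs_le.1 hb).2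
    have : (s * (z i - m)) ^ 2 ≤ 4 * K ^ 2 * s ^ 2 := by
      rw [mul_pow]; nlinarith [sq_nonneg s]
    gcongr
  have hsum := Finset.sum_le_sum fun i (_ : i ∈ Finset.univ) => key i
  rw [Finset.sum_add_distrib, hzero, zero_add, ← Finset.sum_mul] at hsum
  have : ∑ i, r i * Real.exp (s * (z i - m) - 4 * K ^ 2 * s ^ 2) =
      (∑ i, r i * Real.exp (s * (z i - m))) * Real.exp (-(4 * K ^ 2 * s ^ 2)) := by
    rw [Finset.sum_mul]
    exact Finset.sum_congr rfl fun i _ => by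
      rw [sub_eq_add_neg, Real.exp_add, mul_assoc (r i)]
  rw [this]
  calc _ ≤ ((∑ i, r i) * Real.exp (4 * K ^ 2 * s ^ 2)) * Real.exp (-(4 * K ^ 2 * s ^ 2)) := by
        gcongr
    _ = _ := by rw [mul_assoc, ← Real.exp_add, add_neg_cancel, Real.exp_zero, mul_one]

/-- The weighted average of `z · t` over the individuals still at risk at time `t`, where `y j`
is the pair of the failure and the censoring time of individual `j`. -/
noncomputable def riskMean {n : ℕ} (r z : Fin n → ℝ → ℝ) (y : Fin n → ℝ × ℝ) (t : ℝ) : ℝ :=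
  (∑ j, if t ≤ min (y j).1 (y j).2 then z j t * r j t else 0) /
    ∑ j, if t ≤ min (y j).1 (y j).2 then r j t else 0

/-- The logarithm of the exponential process attached to the score, at the final time. -/
noncomputable def scoreExponent {n : ℕ} (s c : ℝ) (r z : Fin n → ℝ → ℝ) (y : Fin n → ℝ × ℝ) : ℝ :=
  ∑ i, if (y i).1 ≤ (y i).2 then
    s * (z i (min (y i).1 (y i).2) - riskMean r z y (min (y i).1 (y i).2)) - c else 0

theorem measurable_scoreExponent {A : Type*} [MeasurableSpace A] {n : ℕ} (s c : ℝ)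
    {r z : Fin n → ℝ → A → ℝ} {y : A → Fin n → ℝ × ℝ}
    (hr : ∀ i, Measurable fun x : ℝ × A => r i x.1 x.2)
    (hz : ∀ i, Measurable fun x : ℝ × A => z i x.1 x.2) (hy : Measurable y) :
    Measurable fun a => scoreExponent s c (fun i t => r i t a) (fun i t => z i t a) (y a) := by
  have hyj : ∀ j, Measurable fun a => y a j := fun j => (measurable_pi_apply j).comp hy
  have hT : ∀ j, Measurable fun a => min (y a j).1 (y a j).2 := fun j =>
    (hyj j).fst.min (hyj j).snd
  unfold scoreExponent
  refine Finset.measurable_sum _ fun i _ => Measurable.ite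
    (measurableSet_le (hyj i).fst (hyj i).snd) ?_ measurable_const
  have hri : ∀ j, Measurable fun a => r j (min (y a i).1 (y a i).2) a := fun j =>
    (hr j).comp ((hT i).prodMk measurable_id)
  have hzi : ∀ j, Measurable fun a => z j (min (y a i).1 (y a i).2) a := fun j =>
    (hz j).comp ((hT i).prodMk measurable_id)
  refine (((hzi i).sub (Measurable.div ?_ ?_)).const_mul s).sub_const c
  · exact Finset.measurable_sum _ fun j _ => Measurable.ite (measurableSet_le (hT i) (hT j))
      ((hzi j).mul (hri j)) measurable_const
  · exact Finset.measurable_sum _ fun j _ => Measurable.ite (measurableSet_le (hT i) (hT j))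
      (hri j) measurable_const

/-- Splitting off the individual with the smallest observed time. -/
theorem scoreExponent_succ {n : ℕ} (s c : ℝ) (r z : Fin (n + 1) → ℝ → ℝ)
    (y : Fin (n + 1) → ℝ × ℝ) (i : Fin (n + 1))
    (hi : ∀ j, min (y i).1 (y i).2 < min (y (i.succAbove j)).1 (y (i.succAbove j)).2) :
    scoreExponent s c r z y =
      (if (y i).1 ≤ (y i).2 then s * (z i (min (y i).1 (y i).2) -
        (∑ j, z j (min (y i).1 (y i).2) * r j (min (y i).1 (y i).2)) /
          ∑ j, r j (min (y i).1 (y i).2)) - c else 0) +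
      scoreExponent s c (fun j => r (i.succAbove j)) (fun j => z (i.succAbove j))
        (fun j => y (i.succAbove j)) := by
  unfold scoreExponent
  rw [Fin.sum_univ_succAbove _ i]
  congr 1
  · congr 3
    have : ∀ j, min (y i).1 (y i).2 ≤ min (y j).1 (y j).2 := by
      intro j
      rcases Fin.eq_self_or_eq_succAbove i j with rfl | ⟨k, rfl⟩
      · exact le_rfl
      · exact (hi k).le
    unfold riskMean
    simp only [this, if_true]
  · refine Finset.sum_congr rfl fun j _ => ?_
    congr 4
    unfold riskMean
    rw [Fin.sum_univ_succAbove _ i, Fin.sum_univ_succAbove _ i, if_neg (not_le.2 (hi j)),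
      if_neg (not_le.2 (hi j)), zero_add, zero_add]

theorem lintegral_succAbove {n : ℕ} {α : Type*} [MeasurableSpace α] (ν : Fin (n + 1) → Measure α)
    [∀ i, IsProbabilityMeasure (ν i)] (i : Fin (n + 1)) {f : α × (Fin n → α) → ℝ≥0∞}
    (hf : Measurable f) :
    ∫⁻ y, f (y i, fun j => y (i.succAbove j)) ∂Measure.pi ν =
      ∫⁻ a, ∫⁻ b, f (a, b) ∂Measure.pi (fun j => ν (i.succAbove j)) ∂ν i := by
  rw [← lintegral_prod _ hf.aemeasurable,
    ← (measurePreserving_piFinSuccAbove ν i).lintegral_comp hf]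
  rfl

theorem map_pi_succAbove {n : ℕ} {α : Type*} [MeasurableSpace α] (ν : Fin (n + 1) → Measure α)
    [∀ i, IsProbabilityMeasure (ν i)] (i : Fin (n + 1)) :
    (Measure.pi ν).map (fun y j => y (i.succAbove j)) = Measure.pi fun j => ν (i.succAbove j) := by
  have h := (measurePreserving_piFinSuccAbove ν i)
  have h2 : (fun (y : Fin (n + 1) → α) j => y (i.succAbove j)) =
      Prod.snd ∘ (MeasurableEquiv.piFinSuccAbove (fun _ => α) i) := rfl
  rw [h2, ← Measure.map_map measurable_snd h.measurable, h.map_eq]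
  exact Measure.snd_prod

theorem lintegral_scoreExponent_le (Λ : Measure ℝ) [SFinite Λ] {K : ℝ} (s : ℝ) :
    ∀ {n : ℕ} (ν : Fin n → Measure (ℝ × ℝ)) [∀ i, IsProbabilityMeasure (ν i)]
      (r z : Fin n → ℝ → ℝ), (∀ i, Measurable (r i)) → (∀ i, Measurable (z i)) →
      (∀ i t, 0 < r i t) → (∀ i t, |z i t| ≤ K) →
      (∀ i (φ : ℝ → ℝ≥0∞), Measurable φ →
        ∫⁻ a in {a : ℝ × ℝ | a.1 ≤ a.2}, φ (min a.1 a.2) ∂ν i =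
          ∫⁻ u, φ u * (ENNReal.ofReal (r i u) * ν i {a | u < min a.1 a.2}) ∂Λ) →
      (∀ᵐ y ∂Measure.pi ν, ∀ i j, i ≠ j → min (y i).1 (y i).2 ≠ min (y j).1 (y j).2) →
      ∀ t : ℝ,
      ∫⁻ y in {y | ∀ i, t < min (y i).1 (y i).2},
        ENNReal.ofReal (Real.exp (scoreExponent s (4 * K ^ 2 * s ^ 2) r z y)) ∂Measure.pi ν ≤
      ∏ i, ν i {a | t < min a.1 a.2} := by
  intro n
  induction n with
  | zero =>
    intro ν _ r z _ _ _ _ _ _ t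
    simp [scoreExponent]
  | succ n ih =>
    intro ν _ r z hr hz hrpos hzb hden hties t
    set c := 4 * K ^ 2 * s ^ 2 with hc
    set τ : ℝ × ℝ → ℝ := fun a => min a.1 a.2 with hτdef
    have hτ : Measurable τ := by fun_prop
    set S : Fin (n + 1) → ℝ → ℝ≥0∞ := fun i u => ν i {a | u < τ a} with hS
    have hSm : ∀ i, Measurable (S i) := fun i =>
      Antitone.measurable fun u v huv => measure_mono fun a (ha : v < τ a) => huv.trans_lt ha
    have htm : MeasurableSet {y : Fin (n + 1) → ℝ × ℝ | ∀ i, t < τ (y i)} := by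
      rw [Set.ofPred_forall]
      exact MeasurableSet.iInter fun i => measurableSet_lt measurable_const (by fun_prop)
    -- contribution of the individual with the smallest observed time
    set g : Fin (n + 1) → ℝ → ℝ := fun i u =>
      s * (z i u - (∑ j, z j u * r j u) / ∑ j, r j u) - c with hg
    have hgm : ∀ i, Measurable (g i) := fun i => by
      refine (((hz i).sub (Measurable.div ?_ ?_)).const_mul s).sub_const c
      · exact Finset.measurable_sum _ fun j _ => (hz j).mul (hr j)
      · exact Finset.measurable_sum _ fun j _ => hr j
    set first : Fin (n + 1) → ℝ × ℝ → ℝ := fun i a =>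
      if a.1 ≤ a.2 then g i (τ a) else 0 with hfirst
    have hfirstm : ∀ i, Measurable (first i) := fun i =>
      Measurable.ite (measurableSet_le measurable_fst measurable_snd)
        ((hgm i).comp hτ) measurable_const
    set A : Fin (n + 1) → Set ((ℝ × ℝ) × (Fin n → ℝ × ℝ)) := fun i =>
      {x | t < τ x.1 ∧ ∀ j, τ x.1 < τ (x.2 j)} with hA
    have hAm : ∀ i, MeasurableSet (A i) := by
      intro i
      simp only [hA, Set.ofPred_and, Set.ofPred_forall]
      refine (measurableSet_lt measurable_const (hτ.comp measurable_fst)).inter ?_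
      exact MeasurableSet.iInter fun j => measurableSet_lt (hτ.comp measurable_fst)
        (hτ.comp ((measurable_pi_apply j).comp measurable_snd))
    set F : Fin (n + 1) → (ℝ × ℝ) × (Fin n → ℝ × ℝ) → ℝ≥0∞ := fun i => (A i).indicator fun x =>
      ENNReal.ofReal (Real.exp (first i x.1)) * ENNReal.ofReal (Real.exp (scoreExponent s c
        (fun j => r (i.succAbove j)) (fun j => z (i.succAbove j)) x.2)) with hF
    have hsm : ∀ i : Fin (n + 1), Measurable fun b : Fin n → ℝ × ℝ => scoreExponent s c
        (fun j => r (i.succAbove j)) (fun j => z (i.succAbove j)) b := fun i =>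
      measurable_scoreExponent s c (r := fun j t _ => r (i.succAbove j) t)
        (z := fun j t _ => z (i.succAbove j) t) (fun j => (hr _).comp measurable_fst)
        (fun j => (hz _).comp measurable_fst) measurable_id
    have hFm : ∀ i, Measurable (F i) := by
      intro i
      refine Measurable.indicator (Measurable.mul (f := fun x : (ℝ × ℝ) × (Fin n → ℝ × ℝ) =>
        ENNReal.ofReal (Real.exp (first i x.1))) ?_ ?_) (hAm i)
      · exact ((Real.measurable_exp.comp ((hfirstm i).comp measurable_fst))).ennreal_ofReal
      · exact (Real.measurable_exp.comp ((hsm i).comp measurable_snd)).ennreal_ofReal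
    have hrem : ∀ i : Fin (n + 1), Measurable fun (y : Fin (n + 1) → ℝ × ℝ) (j : Fin n) =>
        y (i.succAbove j) := fun i => measurable_pi_lambda _ fun j => measurable_pi_apply _
    have step1 : ∫⁻ y in {y | ∀ i, t < τ (y i)},
        ENNReal.ofReal (Real.exp (scoreExponent s c r z y)) ∂Measure.pi ν ≤
        ∑ i, ∫⁻ y, F i (y i, fun j => y (i.succAbove j)) ∂Measure.pi ν := by
      have hFm' : ∀ i ∈ (Finset.univ : Finset (Fin (n + 1))), Measurable
          fun y : Fin (n + 1) → ℝ × ℝ => F i (y i, fun j => y (i.succAbove j)) :=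
        fun i _ => (hFm i).comp ((measurable_pi_apply i).prodMk (hrem i))
      rw [← lintegral_finsetSum _ hFm', ← lintegral_indicator htm]
      refine lintegral_mono_ae ?_
      filter_upwards [hties] with y hy
      by_cases hty : y ∈ {y : Fin (n + 1) → ℝ × ℝ | ∀ i, t < τ (y i)}
      swap
      · rw [Set.indicator_of_notMem hty]
        exact bot_le
      rw [Set.indicator_of_mem hty]
      obtain ⟨i, -, hi⟩ := Finset.exists_min_image Finset.univ (fun i => τ (y i))
        Finset.univ_nonempty
      have hi' : ∀ j, τ (y i) < τ (y (i.succAbove j)) := fun j =>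
        lt_of_le_of_ne (hi _ (Finset.mem_univ _)) (hy _ _ (Fin.succAbove_ne i j).symm)
      refine le_trans ?_ (Finset.single_le_sum (f := fun i => F i (y i, fun j => y (i.succAbove j)))
        (fun _ _ => bot_le) (Finset.mem_univ i))
      have hmem : (y i, fun j => y (i.succAbove j)) ∈ A i := ⟨hty i, hi'⟩
      simp only [hF, Set.indicator_of_mem hmem]
      rw [← ENNReal.ofReal_mul (Real.exp_pos _).le, ← Real.exp_add,
        scoreExponent_succ s c r z y i hi']
    have step2 : ∀ i, ∫⁻ y, F i (y i, fun j => y (i.succAbove j)) ∂Measure.pi ν ≤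
        ∫⁻ a in {a | t < τ a}, ENNReal.ofReal (Real.exp (first i a)) *
          ∏ j, S (i.succAbove j) (τ a) ∂ν i := by
      intro i
      rw [lintegral_succAbove ν i (hFm i), ← lintegral_indicator
        (measurableSet_lt measurable_const hτ)]
      refine lintegral_mono fun a => ?_
      by_cases ha : t < τ a
      · rw [Set.indicator_of_mem (show a ∈ {a | t < τ a} from ha)]
        have hties' : ∀ᵐ b ∂Measure.pi (fun j => ν (i.succAbove j)), ∀ k l, k ≠ l →
            τ (b k) ≠ τ (b l) := by
          rw [← map_pi_succAbove ν i, ae_map_iff (hrem i).aemeasurable]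
          · filter_upwards [hties] with y hy k l hkl
            exact hy _ _ fun h => hkl (Fin.succAbove_right_injective h)
          · simp only [Set.ofPred_forall]
            refine MeasurableSet.iInter fun k => MeasurableSet.iInter fun l =>
              MeasurableSet.iInter fun _ => ?_
            exact (measurableSet_eq_fun (f := fun b : Fin n → ℝ × ℝ => τ (b k))
              (g := fun b => τ (b l)) (by fun_prop) (by fun_prop)).compl
        have hb := ih (fun j => ν (i.succAbove j)) (fun j => r (i.succAbove j))
          (fun j => z (i.succAbove j)) (fun _ => hr _) (fun _ => hz _) (fun _ => hrpos _)
          (fun _ => hzb _) (fun _ => hden _) hties' (τ a)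
        refine le_trans (le_of_eq ?_) (mul_le_mul_right hb _)
        have hm : Measurable fun b : Fin n → ℝ × ℝ => ENNReal.ofReal (Real.exp (scoreExponent s c
            (fun j => r (i.succAbove j)) (fun j => z (i.succAbove j)) b)) :=
          (Real.measurable_exp.comp (hsm i)).ennreal_ofReal
        rw [← lintegral_const_mul _ hm, ← lintegral_indicator]
        · refine lintegral_congr fun b => ?_
          simp only [hF]
          by_cases hb : ∀ j, τ a < τ (b j)
          · rw [Set.indicator_of_mem (show (a, b) ∈ A i from ⟨ha, hb⟩),
              Set.indicator_of_mem (show b ∈ {y : Fin n → ℝ × ℝ | ∀ j, τ a < τ (y j)} from hb)]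
          · rw [Set.indicator_of_notMem (show (a, b) ∉ A i from fun h => hb h.2),
              Set.indicator_of_notMem (show b ∉ {y : Fin n → ℝ × ℝ | ∀ j, τ a < τ (y j)} from hb)]
        · simp only [Set.ofPred_forall]
          exact MeasurableSet.iInter fun k => measurableSet_lt measurable_const (by fun_prop)
      · have : ∀ b, F i (a, b) = 0 := fun b =>
          Set.indicator_of_notMem (fun h : (a, b) ∈ A i => ha h.1) _
        simp [this]
    have step3 : ∑ i, ∫⁻ a in {a | t < τ a}, ENNReal.ofReal (Real.exp (first i a)) *
          ∏ j, S (i.succAbove j) (τ a) ∂ν i ≤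
        ∑ i, ∫⁻ a in {a | t < τ a}, ∏ j, S (i.succAbove j) (τ a) ∂ν i := by
      have hEm : MeasurableSet {a : ℝ × ℝ | a.1 ≤ a.2} :=
        measurableSet_le measurable_fst measurable_snd
      have htm' : MeasurableSet {a | t < τ a} := measurableSet_lt measurable_const hτ
      have hgs : ∀ i : Fin (n + 1), Measurable fun u => ∏ j : Fin n, S (i.succAbove j) u := fun i =>
        Finset.measurable_prod _ fun j _ => hSm _
      have hden' : ∀ (i : Fin (n + 1)) (φ : ℝ → ℝ≥0∞), Measurable φ →
          ∫⁻ a in {a | t < τ a} ∩ {a | a.1 ≤ a.2}, φ (τ a) * ∏ j, S (i.succAbove j) (τ a) ∂ν i =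
          ∫⁻ u in Set.Ioi t, φ u * ENNReal.ofReal (r i u) * ∏ j, S j u ∂Λ := by
        intro i φ hφ
        have h := hden i ((Set.Ioi t).indicator fun u => φ u * ∏ j : Fin n, S (i.succAbove j) u)
          ((hφ.mul (hgs i)).indicator measurableSet_Ioi)
        rw [← setLIntegral_indicator htm', ← lintegral_indicator measurableSet_Ioi]
        refine Eq.trans (lintegral_congr fun a => ?_) (h.trans (lintegral_congr fun u => ?_))
        · rfl
        · by_cases hu : u ∈ Set.Ioi t
          · rw [Set.indicator_of_mem hu, Set.indicator_of_mem hu,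
              Fin.prod_univ_succAbove (fun j => S j u) i]
            simp only [hS, hτdef]
            ring
          · rw [Set.indicator_of_notMem hu, Set.indicator_of_notMem hu, zero_mul]
      have hsplit : ∀ i (f : ℝ × ℝ → ℝ≥0∞), ∫⁻ a in {a | t < τ a}, f a ∂ν i =
          ∫⁻ a in {a | t < τ a} ∩ {a | a.1 ≤ a.2}, f a ∂ν i +
          ∫⁻ a in {a | t < τ a} \ {a | a.1 ≤ a.2}, f a ∂ν i := fun i f =>
        (lintegral_inter_add_sdiff f _ hEm).symm
      simp_rw [hsplit, Finset.sum_add_distrib]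
      refine add_le_add ?_ (le_of_eq ?_)
      · have h1 : ∀ i, ∫⁻ a in {a | t < τ a} ∩ {a | a.1 ≤ a.2}, ENNReal.ofReal
            (Real.exp (first i a)) * ∏ j, S (i.succAbove j) (τ a) ∂ν i =
            ∫⁻ u in Set.Ioi t, ENNReal.ofReal (Real.exp (g i u)) * ENNReal.ofReal (r i u) *
              ∏ j, S j u ∂Λ := by
          intro i
          refine Eq.trans ?_ (hden' i _ (Real.measurable_exp.comp (hgm i)).ennreal_ofReal)
          refine setLIntegral_congr_fun (htm'.inter hEm) fun a ha => ?_
          simp only [hfirst, if_pos (show a.1 ≤ a.2 from ha.2)]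
        have h2 : ∀ i, ∫⁻ a in {a | t < τ a} ∩ {a | a.1 ≤ a.2},
            ∏ j, S (i.succAbove j) (τ a) ∂ν i =
            ∫⁻ u in Set.Ioi t, ENNReal.ofReal (r i u) * ∏ j, S j u ∂Λ := by
          intro i
          simpa using hden' i (fun _ => 1) measurable_const
        simp_rw [h1, h2]
        have hSp : Measurable fun u => ∏ j, S j u := Finset.measurable_prod _ fun j _ => hSm j
        rw [← lintegral_finsetSum, ← lintegral_finsetSum]
        · refine lintegral_mono fun u => ?_
          simp only
          rw [← Finset.sum_mul, ← Finset.sum_mul]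
          refine mul_le_mul_left ?_ _
          have := sum_mul_exp_sub_mean_le (r := fun i => r i u) (z := fun i => z i u)
            (fun i => hrpos i u) (fun i => hzb i u) s
          simp_rw [← ENNReal.ofReal_mul (Real.exp_pos _).le]
          rw [← ENNReal.ofReal_sum_of_nonneg, ← ENNReal.ofReal_sum_of_nonneg]
          · refine ENNReal.ofReal_le_ofReal (le_trans (le_of_eq ?_) this)
            exact Finset.sum_congr rfl fun i _ => mul_comm _ _
          · exact fun i _ => (hrpos i u).le
          · exact fun i _ => mul_nonneg (Real.exp_pos _).le (hrpos i u).le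
        · exact fun i _ => (hr i).ennreal_ofReal.mul hSp
        · exact fun i _ => ((Real.measurable_exp.comp (hgm i)).ennreal_ofReal.mul
            (hr i).ennreal_ofReal).mul hSp
      · refine Finset.sum_congr rfl fun i _ => ?_
        refine setLIntegral_congr_fun (htm'.diff hEm) fun a ha => ?_
        simp only [hfirst, if_neg (show ¬ a.1 ≤ a.2 from ha.2), Real.exp_zero,
          ENNReal.ofReal_one, one_mul]
    have step4 : ∑ i, ∫⁻ a in {a | t < τ a}, ∏ j, S (i.succAbove j) (τ a) ∂ν i ≤
        ∏ i, S i t := by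
      have hpre : ∀ i, MeasurableSet ((fun y : Fin (n + 1) → ℝ × ℝ =>
          (y i, fun j : Fin n => y (i.succAbove j))) ⁻¹' A i) := fun i =>
        ((measurable_pi_apply i).prodMk (hrem i)) (hAm i)
      have h1 : ∀ i, ∫⁻ a in {a | t < τ a}, ∏ j, S (i.succAbove j) (τ a) ∂ν i =
          Measure.pi ν ((fun y : Fin (n + 1) → ℝ × ℝ =>
            (y i, fun j : Fin n => y (i.succAbove j))) ⁻¹' A i) := by
        intro i
        rw [← lintegral_indicator_one (hpre i)]
        refine Eq.trans ?_ (lintegral_succAbove ν i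
          (measurable_one.indicator (hAm i) : Measurable ((A i).indicator 1))).symm
        rw [← lintegral_indicator (measurableSet_lt measurable_const hτ)]
        refine lintegral_congr fun a => ?_
        by_cases ha : t < τ a
        · rw [Set.indicator_of_mem (show a ∈ {a | t < τ a} from ha)]
          have hset : (fun b => (A i).indicator (1 : (ℝ × ℝ) × (Fin n → ℝ × ℝ) → ℝ≥0∞) (a, b)) =
              (Set.univ.pi fun _ : Fin n => {b | τ a < τ b}).indicator 1 := by
            ext b
            by_cases hb : ∀ j, τ a < τ (b j)
            · rw [Set.indicator_of_mem (show (a, b) ∈ A i from ⟨ha, hb⟩),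
                Set.indicator_of_mem (by simpa using hb)]
              rfl
            · rw [Set.indicator_of_notMem (show (a, b) ∉ A i from fun h => hb h.2),
                Set.indicator_of_notMem (by simpa using hb)]
          rw [hset, lintegral_indicator_one, Measure.pi_pi]
          exact MeasurableSet.univ_pi fun j => measurableSet_lt measurable_const hτ
        · have : ∀ b, (A i).indicator (1 : (ℝ × ℝ) × (Fin n → ℝ × ℝ) → ℝ≥0∞) (a, b) = 0 := fun b =>
            Set.indicator_of_notMem (fun h : (a, b) ∈ A i => ha h.1) _
          rw [Set.indicator_of_notMem (show a ∉ {a | t < τ a} from ha)]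
          simp [this]
      simp_rw [h1]
      rw [← measure_biUnion_finset (fun i _ j _ hij => ?_) fun i _ => hpre i]
      · refine le_trans (measure_mono (t := Set.univ.pi fun _ => {a | t < τ a}) ?_)
          (le_of_eq (Measure.pi_pi _ _))
        intro y hy
        simp only [Finset.mem_univ, Set.iUnion_true, Set.mem_iUnion] at hy
        obtain ⟨i, hi⟩ := hy
        intro j _
        rcases Fin.eq_self_or_eq_succAbove i j with rfl | ⟨k, rfl⟩
        · exact hi.1
        · exact lt_trans hi.1 (hi.2 k)
      · refine Set.disjoint_left.2 fun y hi hj => ?_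
        obtain ⟨k, rfl⟩ := (Fin.eq_self_or_eq_succAbove i j).resolve_left (Ne.symm hij)
        obtain ⟨l, hl⟩ := (Fin.eq_self_or_eq_succAbove (i.succAbove k) i).resolve_left hij
        have h1 := hi.2 k
        have h2 := hj.2 l
        simp only [← hl] at h1 h2
        exact lt_asymm h1 h2
    exact step1.trans ((Finset.sum_le_sum fun i _ => step2 i).trans (step3.trans step4))

/-! ### Survival functions given by an integrated hazard -/

theorem AbsolutelyContinuousOnInterval.exp_neg {f : ℝ → ℝ} {a b : ℝ}
    (hf : AbsolutelyContinuousOnInterval f a b) (hpos : ∀ x ∈ Set.uIcc a b, 0 ≤ f x) :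
    AbsolutelyContinuousOnInterval (fun x => Real.exp (-f x)) a b := by
  rw [absolutelyContinuousOnInterval_iff] at hf ⊢
  intro ε hε
  obtain ⟨δ, hδ, h⟩ := hf ε hε
  refine ⟨δ, hδ, fun E hE hlen => lt_of_le_of_lt (Finset.sum_le_sum fun i hi => ?_) (h E hE hlen)⟩
  have hmem := hE.1 i hi
  have key : ∀ x y : ℝ, 0 ≤ x → x ≤ y → |Real.exp (-x) - Real.exp (-y)| ≤ |x - y| := by
    intro x y hx hxy
    have h1 : Real.exp (-y) ≤ Real.exp (-x) := Real.exp_le_exp.2 (by linarith)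
    rw [abs_of_nonneg (by linarith), abs_of_nonpos (by linarith)]
    have h2 : Real.exp (-y) = Real.exp (-x) * Real.exp (x - y) := by
      rw [← Real.exp_add]; ring_nf
    have h3 := Real.add_one_le_exp (x - y)
    have h4 : Real.exp (-x) ≤ 1 := Real.exp_le_one_iff.2 (by linarith)
    have h5 := Real.exp_pos (-x)
    rw [h2]
    nlinarith
  rw [Real.dist_eq, Real.dist_eq]
  rcases le_total (f (E.2 i).1) (f (E.2 i).2) with hle | hle
  · exact key _ _ (hpos _ hmem.1) hle
  · rw [abs_sub_comm, abs_sub_comm (f _)]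
    exact key _ _ (hpos _ hmem.2) hle

theorem integral_hazard_mul_exp_neg {h : ℝ → ℝ} (hpos : ∀ t, 0 ≤ h t) {c : ℝ} (hc : 0 ≤ c)
    (hint : IntervalIntegrable h volume 0 c) :
    ∫ u in (0 : ℝ)..c, h u * Real.exp (-∫ s in (0 : ℝ)..u, h s) =
      1 - Real.exp (-∫ s in (0 : ℝ)..c, h s) := by
  have hac : AbsolutelyContinuousOnInterval (fun u => Real.exp (-∫ s in (0 : ℝ)..u, h s)) 0 c := by
    refine (hint.absolutelyContinuousOnInterval_intervalIntegral (c := 0) (by simp)).exp_neg ?_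
    intro x hx
    rw [Set.uIcc_of_le hc] at hx
    exact intervalIntegral.integral_nonneg hx.1 fun u _ => hpos u
  have h1 := hac.integral_deriv_eq_sub
  have h2 : ∫ u in (0 : ℝ)..c, deriv (fun u => Real.exp (-∫ s in (0 : ℝ)..u, h s)) u =
      ∫ u in (0 : ℝ)..c, -(h u * Real.exp (-∫ s in (0 : ℝ)..u, h s)) := by
    refine intervalIntegral.integral_congr_ae ?_
    filter_upwards [hint.ae_hasDerivAt_integral] with x hx hmem
    have := (hx (Set.uIoc_subset_uIcc hmem) 0 (by simp)).neg.exp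
    refine this.deriv.trans ?_
    simp only [Pi.neg_apply]
    ring
  rw [h2, intervalIntegral.integral_neg] at h1
  simp only [intervalIntegral.integral_same, neg_zero, Real.exp_zero] at h1
  linarith

/-- The times in `[0, b)`. -/
def timesBelow (b : EReal) : Set ℝ := {u : ℝ | 0 ≤ u ∧ (u : EReal) < b}

theorem measurableSet_timesBelow (b : EReal) : MeasurableSet (timesBelow b) := by
  simp only [timesBelow, Set.ofPred_and]
  exact (measurableSet_le measurable_const measurable_id).inter
    (measurableSet_lt measurable_coe_real_ereal measurable_const)

theorem restrict_eq_withDensity_hazard (α : Measure ℝ) [IsProbabilityMeasure α] (b : EReal)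
    {h : ℝ → ℝ} (hm : Measurable h) (hpos : ∀ t, 0 ≤ h t)
    (hint : ∀ t ∈ timesBelow b, IntervalIntegrable h volume 0 t)
    (hsurv : ∀ t ∈ timesBelow b, α (Set.Ioi t) = ENNReal.ofReal (Real.exp (-∫ s in (0 : ℝ)..t,
      h s))) :
    α.restrict (timesBelow b) = (volume.withDensity fun u => ENNReal.ofReal
      (h u * Real.exp (-∫ s in (0 : ℝ)..u, h s))).restrict (timesBelow b) := by
  set m := volume.withDensity fun u => ENNReal.ofReal (h u * Real.exp (-∫ s in (0 : ℝ)..u, h s))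
  have hcover : timesBelow b = ⋃ q ∈ {q : ℚ | (q : ℝ) ∈ timesBelow b}, Set.Icc (0 : ℝ) q := by
    ext u
    simp only [Set.mem_iUnion, Set.mem_Icc, exists_prop]
    constructor
    · intro hu
      by_cases hex : ∃ v : ℝ, u < v ∧ (v : EReal) < b
      · obtain ⟨v, huv, hv⟩ := hex
        obtain ⟨q, hq1, hq2⟩ := exists_rat_btwn huv
        refine ⟨q, ⟨hu.1.trans hq1.le, lt_trans (by exact_mod_cast hq2) hv⟩, hu.1, hq1.le⟩
      · exfalso
        obtain ⟨v, hv1, hv2⟩ := EReal.lt_iff_exists_real_btwn.1 hu.2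
        exact hex ⟨v, by exact_mod_cast hv1, hv2⟩
    · rintro ⟨q, hq, hu⟩
      exact ⟨hu.1, lt_of_le_of_lt (by exact_mod_cast hu.2) hq.2⟩
  rw [hcover, Measure.restrict_biUnion_congr (Set.to_countable _)]
  intro q hq
  have hq0 : (0 : ℝ) ∈ timesBelow b :=
    ⟨le_rfl, lt_of_le_of_lt (by exact_mod_cast hq.1) hq.2⟩
  have hzero : α (Set.Iio 0) = 0 := by
    have := hsurv 0 hq0
    simp only [intervalIntegral.integral_same, neg_zero, Real.exp_zero, ENNReal.ofReal_one] at this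
    rw [← prob_compl_eq_zero_iff measurableSet_Ioi] at this
    refine measure_mono_null (fun x (hx : x < 0) => ?_) this
    simpa using hx.le
  have hIcc : ∀ c : ℝ, 0 ≤ c → c ≤ q → α (Set.Icc 0 c) = m (Set.Icc 0 c) := by
    intro c hc hcq
    have hcb : c ∈ timesBelow b := ⟨hc, lt_of_le_of_lt (by exact_mod_cast hcq) hq.2⟩
    have h1 : α (Set.Icc 0 c) = 1 - α (Set.Ioi c) := by
      have h2 : α (Set.Iic c) = α (Set.Icc 0 c) := by
        refine le_antisymm ?_ (measure_mono fun x hx => hx.2)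
        calc α (Set.Iic c) ≤ α (Set.Iio 0 ∪ Set.Icc 0 c) := measure_mono fun x hx => by
              rcases lt_or_ge x 0 with h | h
              · exact Or.inl h
              · exact Or.inr ⟨h, hx⟩
          _ ≤ α (Set.Iio 0) + α (Set.Icc 0 c) := measure_union_le _ _
          _ = _ := by rw [hzero, zero_add]
      rw [← h2, ← Set.compl_Ioi, prob_compl_eq_one_sub measurableSet_Ioi]
    rw [h1, hsurv c hcb, withDensity_apply _ measurableSet_Icc,
      ← ofReal_integral_eq_lintegral_ofReal, ← ENNReal.ofReal_one, ← ENNReal.ofReal_sub _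
      (Real.exp_pos _).le, ← integral_hazard_mul_exp_neg hpos hc (hint c hcb),
      intervalIntegral.integral_of_le hc, integral_Icc_eq_integral_Ioc]
    · have hi := hint c hcb
      rw [intervalIntegrable_iff_integrableOn_Icc_of_le hc] at hi
      refine Integrable.mono' hi ?_ ?_
      · refine hm.aestronglyMeasurable.mul ?_
        have hcont : ContinuousOn (fun u => ∫ s in (0 : ℝ)..u, h s) (Set.Icc 0 c) :=
          intervalIntegral.continuousOn_primitive_interval (by rwa [Set.uIcc_of_le hc]) |>.mono
            (by rw [Set.uIcc_of_le hc])
        exact hcont.neg.rexp.aestronglyMeasurable measurableSet_Icc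
      · refine (ae_restrict_mem measurableSet_Icc).mono fun x hx => ?_
        rw [Real.norm_of_nonneg (mul_nonneg (hpos x) (Real.exp_pos _).le)]
        refine mul_le_of_le_one_right (hpos x) (Real.exp_le_one_iff.2 ?_)
        have := intervalIntegral.integral_nonneg (μ := volume) hx.1 fun u _ => hpos u
        linarith
    · exact Eventually.of_forall fun x => mul_nonneg (hpos x) (Real.exp_pos _).le
  have : IsFiniteMeasure (m.restrict (Set.Icc 0 (q : ℝ))) := by
    constructor
    rw [Measure.restrict_apply_univ, ← hIcc q hq.1 le_rfl]
    exact measure_lt_top _ _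
  refine Measure.ext_of_Iic _ _ fun a => ?_
  rw [Measure.restrict_apply measurableSet_Iic, Measure.restrict_apply measurableSet_Iic]
  have : Set.Iic a ∩ Set.Icc 0 (q : ℝ) = Set.Icc 0 (min a q) := by
    ext x; simp only [Set.mem_inter_iff, Set.mem_Iic, Set.mem_Icc, le_min_iff]; tauto
  rw [this]
  rcases le_or_gt 0 (min a q) with h0 | h0
  · exact hIcc _ h0 (min_le_right _ _)
  · rw [Set.Icc_eq_empty (not_le.2 h0)]; simp

/-- Given the covariate path, observed failures have intensity `λ₀ r` with respect to the
probability of being at risk. -/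
theorem setLIntegral_failure_eq (α γ : Measure ℝ) [IsProbabilityMeasure α] [IsProbabilityMeasure γ]
    (b : EReal) {l r : ℝ → ℝ} (hl : Measurable l) (hr : Measurable r) (hl0 : ∀ t, 0 ≤ l t)
    (hr0 : ∀ t, 0 ≤ r t)
    (hint : ∀ t ∈ timesBelow b, IntervalIntegrable (fun s => l s * r s) volume 0 t)
    (hsurv : ∀ t ∈ timesBelow b,
      α (Set.Ioi t) = ENNReal.ofReal (Real.exp (-∫ s in (0 : ℝ)..t, l s * r s)))
    (hmin : ∀ᵐ a ∂α.prod γ, min a.1 a.2 ∈ timesBelow b) {φ : ℝ → ℝ≥0∞} (hφ : Measurable φ) :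
    ∫⁻ a in {a : ℝ × ℝ | a.1 ≤ a.2}, φ (min a.1 a.2) ∂α.prod γ =
      ∫⁻ u, φ u * (ENNReal.ofReal (r u) * α.prod γ {a | u < min a.1 a.2})
        ∂((volume.restrict (timesBelow b)).withDensity fun u => ENNReal.ofReal (l u)) := by
  have hJ := measurableSet_timesBelow b
  have hE : MeasurableSet {a : ℝ × ℝ | a.1 ≤ a.2} := measurableSet_le measurable_fst measurable_snd
  have hanti : Measurable fun u => γ (Set.Ici u) :=
    Antitone.measurable fun u v huv => measure_mono (Set.Ici_subset_Ici.2 huv)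
  have hSm : Measurable fun u => α.prod γ {a | u < min a.1 a.2} :=
    Antitone.measurable fun u v huv => measure_mono
      fun a (ha : v < min a.1 a.2) => huv.trans_lt ha
  have h1 : ∫⁻ a in {a : ℝ × ℝ | a.1 ≤ a.2}, φ (min a.1 a.2) ∂α.prod γ =
      ∫⁻ u in timesBelow b, φ u * γ (Set.Ici u) ∂α := by
    rw [← lintegral_indicator hE, ← lintegral_indicator hJ]
    have h2 : ∀ᵐ a ∂α.prod γ, ({a : ℝ × ℝ | a.1 ≤ a.2}.indicator (fun a => φ (min a.1 a.2))) a =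
        (timesBelow b).indicator φ a.1 * (Set.Ici a.1).indicator 1 a.2 := by
      filter_upwards [hmin] with a ha
      by_cases hle : a.1 ≤ a.2
      · rw [min_eq_left hle] at ha
        rw [Set.indicator_of_mem (show a ∈ {a : ℝ × ℝ | a.1 ≤ a.2} from hle),
          Set.indicator_of_mem ha, Set.indicator_of_mem (show a.2 ∈ Set.Ici a.1 from hle),
          min_eq_left hle, Pi.one_apply, mul_one]
      · rw [Set.indicator_of_notMem (show a ∉ {a : ℝ × ℝ | a.1 ≤ a.2} from hle),
          Set.indicator_of_notMem (show a.2 ∉ Set.Ici a.1 from hle), mul_zero]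
    rw [lintegral_congr_ae h2, lintegral_prod]
    · refine lintegral_congr fun u => ?_
      simp only
      rw [lintegral_const_mul _ (measurable_one.indicator measurableSet_Ici),
        lintegral_indicator_one measurableSet_Ici]
      by_cases hu : u ∈ timesBelow b
      · rw [Set.indicator_of_mem hu, Set.indicator_of_mem hu]
      · rw [Set.indicator_of_notMem hu, Set.indicator_of_notMem hu, zero_mul]
    · refine (((hφ.indicator hJ).comp measurable_fst).mul ?_).aemeasurable
      have : (fun a : ℝ × ℝ => (Set.Ici a.1).indicator (1 : ℝ → ℝ≥0∞) a.2) =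
          {a : ℝ × ℝ | a.1 ≤ a.2}.indicator 1 := rfl
      rw [this]
      exact measurable_one.indicator hE
  rw [h1, restrict_eq_withDensity_hazard α b (h := fun s => l s * r s) (hl.mul hr)
    (fun t => mul_nonneg (hl0 t) (hr0 t)) hint hsurv]
  have hprim : AEMeasurable (fun u => ∫ s in (0 : ℝ)..u, l s * r s)
      (volume.restrict (timesBelow b)) := by
    refine aemeasurable_restrict_of_monotoneOn hJ fun u hu v hv huv => ?_
    rw [← intervalIntegral.integral_add_adjacent_intervals (hint u hu)
      ((hint u hu).symm.trans (hint v hv))]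
    have := intervalIntegral.integral_nonneg (μ := volume) huv
      fun s _ => mul_nonneg (hl0 s) (hr0 s)
    linarith
  have hdens : AEMeasurable (fun u => ENNReal.ofReal (l u * r u *
      Real.exp (-∫ s in (0 : ℝ)..u, l s * r s))) (volume.restrict (timesBelow b)) :=
    ((hl.mul hr).aemeasurable.mul (Real.measurable_exp.comp_aemeasurable hprim.neg)).ennreal_ofReal
  rw [restrict_withDensity hJ, lintegral_withDensity_eq_lintegral_mul₀ hdens
      (g := fun u => φ u * γ (Set.Ici u)) (hφ.mul hanti).aemeasurable,
    lintegral_withDensity_eq_lintegral_mul₀ hl.ennreal_ofReal.aemeasurable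
      (g := fun u => φ u * (ENNReal.ofReal (r u) * α.prod γ {a | u < min a.1 a.2}))
      (hφ.mul (hr.ennreal_ofReal.mul hSm)).aemeasurable]
  refine lintegral_congr_ae ?_
  have hatoms : ∀ᵐ u ∂(volume : Measure ℝ), γ {u} = 0 := by
    have hc := Measure.countable_meas_level_set_pos (μ := γ) (measurable_id (α := ℝ))
    refine (Set.Countable.ae_notMem hc volume).mono fun u hu => ?_
    simpa [Set.ofPred_eq_eq_singleton] using hu
  filter_upwards [ae_restrict_mem hJ, ae_restrict_of_ae hatoms] with u hu hγ
  have h3 : α.prod γ {a | u < min a.1 a.2} = α (Set.Ioi u) * γ (Set.Ioi u) := by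
    rw [← Measure.prod_prod]
    congr 1
    ext a; simp
  have h4 : γ (Set.Ici u) = γ (Set.Ioi u) := by
    refine le_antisymm ?_ (measure_mono Set.Ioi_subset_Ici_self)
    rw [← Set.Ioi_union_left]
    refine (measure_union_le _ _).trans ?_
    rw [hγ, add_zero]
  simp only [Pi.mul_apply]
  rw [h3, h4, hsurv u hu, ENNReal.ofReal_mul (mul_nonneg (hl0 u) (hr0 u)),
    ENNReal.ofReal_mul (hl0 u)]
  ring

/-! ### Almost sure properties of one individual -/

/-- The largest multiple of `1 / (m + 1)` below `t`. -/
noncomputable def gridTime (m : ℕ) (t : ℝ) : ℝ := (⌊t * (m + 1)⌋₊ : ℝ) / (m + 1)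

theorem gridTime_nonneg (m : ℕ) (t : ℝ) : 0 ≤ gridTime m t := by
  unfold gridTime; positivity

theorem gridTime_le {t : ℝ} (ht : 0 ≤ t) (m : ℕ) : gridTime m t ≤ t := by
  unfold gridTime
  rw [div_le_iff₀ (by positivity)]
  exact Nat.floor_le (by positivity)

theorem tendsto_gridTime {t : ℝ} (ht : 0 ≤ t) :
    Tendsto (fun m => gridTime m t) atTop (𝓝 t) := by
  have h1 : Tendsto (fun m : ℕ => t - 1 / ((m : ℝ) + 1)) atTop (𝓝 t) := by
    simpa using tendsto_const_nhds.sub (tendsto_one_div_add_atTop_nhds_zero_nat (𝕜 := ℝ))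
  refine tendsto_of_tendsto_of_tendsto_of_le_of_le h1 tendsto_const_nhds (fun m => ?_)
    fun m => gridTime_le ht m
  have hm : (0 : ℝ) < m + 1 := by positivity
  have := Nat.lt_floor_add_one (t * ((m : ℝ) + 1))
  simp only [gridTime]
  rw [sub_le_iff_le_add, ← add_div, le_div_iff₀ hm]
  exact this.le

namespace CoxData

variable {E : Type*} [MeasurableSpace E] {p : ℕ} {D : CoxData E p} {μ : Measure E}

theorem tPlus_nonneg : 0 ≤ D.tPlus μ := by
  refine le_sInf ?_
  rintro _ ⟨t, ht, rfl⟩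
  simpa using ht.1

theorem timesBelow_subset_timeSet : timesBelow (D.tPlus μ) ⊆ D.timeSet μ := fun _ ht => ⟨ht.1,
    ht.2.le⟩

theorem mem_timeSet_of_le {s t : ℝ} (ht : t ∈ D.timeSet μ) (hs : 0 ≤ s) (hst : s ≤ t) :
    s ∈ D.timeSet μ := ⟨hs, le_trans (by exact_mod_cast hst) ht.2⟩

theorem IsCoxModel.measurable_obsTime (h : D.IsCoxModel μ) : Measurable D.obsTime :=
  h.measurable_failTime.min h.measurable_censTime

theorem IsCoxModel.obsTime_nonneg (h : D.IsCoxModel μ) (e : E) : 0 ≤ D.obsTime e :=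
  le_min (h.failTime_nonneg e) (h.censTime_nonneg e)

theorem IsCoxModel.measurable_event (h : D.IsCoxModel μ) : Measurable D.event :=
  Measurable.ite (measurableSet_le h.measurable_failTime h.measurable_censTime)
    measurable_const measurable_const

theorem measure_obsTime_eq (h : D.IsCoxModel μ) (hd : D.HasBoundedDensity μ) (t : ℝ) :
    μ {e | D.obsTime e = t} = 0 := by
  obtain ⟨f, C, hf, -, hmap⟩ := hd
  have : μ {e | D.obsTime e = t} = μ.map D.obsTime {t} :=
    (Measure.map_apply h.measurable_obsTime (measurableSet_singleton t)).symm
  rw [this, hmap]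
  exact withDensity_absolutelyContinuous _ _ (by simp)

theorem ae_obsTime_mem [IsProbabilityMeasure μ] (h : D.IsCoxModel μ) (hd : D.HasBoundedDensity μ) :
    ∀ᵐ e ∂μ, D.obsTime e ∈ timesBelow (D.tPlus μ) := by
  have h0 : ∀ e, 0 ≤ D.obsTime e := h.obsTime_nonneg
  rcases eq_or_ne (D.tPlus μ) ⊤ with htop | htop
  · exact Eventually.of_forall fun e => ⟨h0 e, by rw [htop]; exact EReal.coe_lt_top _⟩
  have hbot : D.tPlus μ ≠ ⊥ := fun hb => by
    have := tPlus_nonneg (D := D) (μ := μ); rw [hb] at this; simp at this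
  lift D.tPlus μ to ℝ using ⟨htop, hbot⟩ with b hb
  have h1 : ∀ m : ℕ, ∀ᵐ e ∂μ, D.obsTime e ≤ b + 1 / ((m : ℝ) + 1) := by
    intro m
    have hlt : D.tPlus μ < ((b + 1 / ((m : ℝ) + 1) : ℝ) : EReal) := by
      rw [← hb]; exact_mod_cast lt_add_of_pos_right b (by positivity)
    obtain ⟨_, ⟨t, ⟨-, ht⟩, rfl⟩, htb⟩ := sInf_lt_iff.1 hlt
    have ht' : ∀ᵐ e ∂μ, D.obsTime e ≤ t := by
      rw [ae_iff, ← prob_compl_eq_one_iff] 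
      · convert ht using 2
        ext e; simp
      · exact (measurableSet_le h.measurable_obsTime measurable_const).compl
    filter_upwards [ht'] with e he
    exact he.trans (EReal.coe_le_coe_iff.1 htb.le)
  have h2 : ∀ᵐ e ∂μ, D.obsTime e ≠ b := by
    rw [ae_iff]; simpa using measure_obsTime_eq h hd b
  filter_upwards [ae_all_iff.2 h1, h2] with e he1 he2
  refine ⟨h0 e, ?_⟩
  have h3 : Tendsto (fun m : ℕ => b + 1 / ((m : ℝ) + 1)) atTop (𝓝 b) := by
    simpa using tendsto_const_nhds.add (tendsto_one_div_add_atTop_nhds_zero_nat (𝕜 := ℝ))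
  have h4 := ge_of_tendsto' h3 he1
  exact_mod_cast lt_of_le_of_ne h4 he2

theorem tendsto_cov_gridTime {L : ℝ} {e : E}
    (he : ∀ s ∈ D.timeSet μ, ∀ t ∈ D.timeSet μ, ∀ j, |D.cov s e j - D.cov t e j| ≤ L * |s - t|)
    {t : ℝ} (ht : t ∈ D.timeSet μ) (j : Fin p) :
    Tendsto (fun m => D.cov (gridTime m t) e j) atTop (𝓝 (D.cov t e j)) := by
  rw [tendsto_iff_dist_tendsto_zero]
  have h1 : Tendsto (fun m => L * |gridTime m t - t|) atTop (𝓝 0) := by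
    have := ((tendsto_gridTime ht.1).sub_const t).abs.const_mul L
    simpa using this
  refine squeeze_zero (fun _ => dist_nonneg) (fun m => ?_) h1
  exact he _ (mem_timeSet_of_le ht (gridTime_nonneg m t) (gridTime_le ht.1 m)) _ ht j

theorem ae_cov_le {K : ℝ} (hK : D.CovBounded μ K) (hL : ∃ L, D.CovLipschitz μ L) :
    ∀ᵐ e ∂μ, ∀ t ∈ D.timeSet μ, ∀ j, |D.cov t e j| ≤ K := by
  obtain ⟨L, hL⟩ := hL
  have h1 : ∀ᵐ e ∂μ, ∀ l m : ℕ, (l : ℝ) / (m + 1) ∈ D.timeSet μ →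
      ∀ j, |D.cov ((l : ℝ) / (m + 1)) e j| ≤ K := by
    rw [ae_all_iff]; intro l
    rw [ae_all_iff]; intro m
    by_cases hmem : (l : ℝ) / (m + 1) ∈ D.timeSet μ
    · filter_upwards [hK _ hmem] with e he _ using he
    · exact Eventually.of_forall fun e h => absurd h hmem
  filter_upwards [h1, hL] with e he1 he2 t ht j
  refine le_of_tendsto (tendsto_cov_gridTime he2 ht j).abs (Eventually.of_forall fun m => ?_)
  exact he1 _ m (mem_timeSet_of_le ht (gridTime_nonneg m t) (gridTime_le ht.1 m)) j

/-! ### The covariate path and the conditional law of the failure and censoring times -/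

/-- The covariate path on the time index set. -/
def path (D : CoxData E p) (μ : Measure E) (e : E) : D.timeSet μ → Fin p → ℝ := fun t => D.cov t e

/-- The pair of the failure time and the censoring time. -/
def times (D : CoxData E p) (e : E) : ℝ × ℝ := (D.failTime e, D.censTime e)

theorem IsCoxModel.measurable_cov_at (h : D.IsCoxModel μ) (t : ℝ) : Measurable (D.cov t) :=
  h.measurable_cov.comp (measurable_const.prodMk measurable_id)

theorem IsCoxModel.measurable_path (h : D.IsCoxModel μ) : Measurable (D.path μ) :=
  measurable_pi_lambda _ fun t => h.measurable_cov_at t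

theorem IsCoxModel.measurable_times (h : D.IsCoxModel μ) : Measurable D.times :=
  h.measurable_failTime.prodMk h.measurable_censTime

theorem comap_path : MeasurableSpace.comap (D.path μ) inferInstance = D.covSigma μ := by
  rw [covSigma, iSup_subtype']
  change MeasurableSpace.comap (D.path μ) (MeasurableSpace.pi) = _
  rw [MeasurableSpace.pi, MeasurableSpace.comap_iSup]
  refine iSup_congr fun t => ?_
  rw [MeasurableSpace.comap_comp]
  rfl

theorem ae_condDistrib_real [IsProbabilityMeasure μ] (h : D.IsCoxModel μ) {s : Set (ℝ × ℝ)}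
    (hs : MeasurableSet s) :
    (fun e => (condDistrib D.times (D.path μ) μ (D.path μ e)).real s) =ᵐ[μ]
      μ[(D.times ⁻¹' s).indicator fun _ => (1 : ℝ) | D.covSigma μ] := by
  have := condDistrib_ae_eq_condExp h.measurable_path h.measurable_times hs (μ := μ)
  rwa [comap_path] at this

theorem ae_condDistrib_eq_prod [IsProbabilityMeasure μ] (h : D.IsCoxModel μ) :
    ∀ᵐ e ∂μ, (condDistrib D.times (D.path μ) μ (D.path μ e)).fst.prod
      (condDistrib D.times (D.path μ) μ (D.path μ e)).snd =
      condDistrib D.times (D.path μ) μ (D.path μ e) := by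
  set κ := condDistrib D.times (D.path μ) μ
  have h1 : ∀ᵐ e ∂μ, ∀ a b c d : ℚ, (κ (D.path μ e)).real (Set.Ioo (a : ℝ) b ×ˢ Set.Ioo (c : ℝ) d) =
      (κ (D.path μ e)).real (Set.Ioo (a : ℝ) b ×ˢ Set.univ) *
      (κ (D.path μ e)).real (Set.univ ×ˢ Set.Ioo (c : ℝ) d) := by
    simp_rw [ae_all_iff]
    intro a b c d
    have e1 := ae_condDistrib_real h (measurableSet_Ioo.prod measurableSet_Ioo :
      MeasurableSet (Set.Ioo (a : ℝ) b ×ˢ Set.Ioo (c : ℝ) d))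
    have e2 := ae_condDistrib_real h (measurableSet_Ioo.prod MeasurableSet.univ :
      MeasurableSet (Set.Ioo (a : ℝ) b ×ˢ (Set.univ : Set ℝ)))
    have e3 := ae_condDistrib_real h (MeasurableSet.univ.prod measurableSet_Ioo :
      MeasurableSet ((Set.univ : Set ℝ) ×ˢ Set.Ioo (c : ℝ) d))
    have e4 := h.condIndep (Set.Ioo (a : ℝ) b) (Set.Ioo (c : ℝ) d) measurableSet_Ioo
      measurableSet_Ioo
    have s1 : D.times ⁻¹' (Set.Ioo (a : ℝ) b ×ˢ Set.Ioo (c : ℝ) d) =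
      D.failTime ⁻¹' Set.Ioo (a : ℝ) b ∩ D.censTime ⁻¹' Set.Ioo (c : ℝ) d := rfl
    have s2 : D.times ⁻¹' (Set.Ioo (a : ℝ) b ×ˢ (Set.univ : Set ℝ)) =
      D.failTime ⁻¹' Set.Ioo (a : ℝ) b := by ext; simp [times]
    have s3 : D.times ⁻¹' ((Set.univ : Set ℝ) ×ˢ Set.Ioo (c : ℝ) d) =
      D.censTime ⁻¹' Set.Ioo (c : ℝ) d := by ext; simp [times]
    rw [s1] at e1
    rw [s2] at e2
    rw [s3] at e3
    filter_upwards [e1, e2, e3, e4] with e h1 h2 h3 h4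
    rw [h1, h2, h3, h4]
  filter_upwards [h1] with e he
  refine Measure.prod_eq_generateFrom (Real.borel_eq_generateFrom_Ioo_rat.symm.trans
      BorelSpace.measurable_eq.symm) (Real.borel_eq_generateFrom_Ioo_rat.symm.trans
      BorelSpace.measurable_eq.symm) Real.isPiSystem_Ioo_rat Real.isPiSystem_Ioo_rat
    (Real.finiteSpanningSetsInIooRat _) (Real.finiteSpanningSetsInIooRat _) ?_
  intro s hs t ht
  simp only [Set.mem_iUnion, Set.mem_singleton_iff] at hs ht
  obtain ⟨a, b, -, rfl⟩ := hs
  obtain ⟨c, d, -, rfl⟩ := ht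
  have := he a b c d
  rw [Measure.fst_apply measurableSet_Ioo, Measure.snd_apply measurableSet_Ioo, ← Set.prod_univ,
    ← Set.univ_prod]
  rw [measureReal_def, measureReal_def, measureReal_def, ← ENNReal.toReal_mul] at this
  exact (ENNReal.toReal_eq_toReal_iff' (measure_ne_top _ _)
    (ENNReal.mul_ne_top (measure_ne_top _ _) (measure_ne_top _ _))).1 this

theorem ae_condDistrib_min_mem [IsProbabilityMeasure μ] (h : D.IsCoxModel μ)
    (hd : D.HasBoundedDensity μ) :
    ∀ᵐ e ∂μ, ∀ᵐ a ∂condDistrib D.times (D.path μ) μ (D.path μ e),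
      min a.1 a.2 ∈ timesBelow (D.tPlus μ) := by
  have h1 : ∀ᵐ x ∂(μ.map (D.path μ)) ⊗ₘ condDistrib D.times (D.path μ) μ,
      min x.2.1 x.2.2 ∈ timesBelow (D.tPlus μ) := by
    rw [compProd_map_condDistrib h.measurable_times.aemeasurable, ae_map_iff]
    · exact ae_obsTime_mem h hd
    · exact (h.measurable_path.prodMk h.measurable_times).aemeasurable
    · exact (measurable_snd.fst.min measurable_snd.snd) (measurableSet_timesBelow _)
  exact ae_of_ae_map h.measurable_path.aemeasurable (Measure.ae_ae_of_ae_compProd h1)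

theorem intervalIntegrable_hazard (h : D.IsCoxModel μ) {r : ℝ → ℝ} (hr : Measurable r)
    {C : ℝ} (hC : ∀ t ∈ D.timeSet μ, |r t| ≤ C) {t : ℝ} (ht : t ∈ timesBelow (D.tPlus μ)) :
    IntervalIntegrable (fun s => D.baseHaz s * r s) volume 0 t := by
  rw [intervalIntegrable_iff_integrableOn_Icc_of_le ht.1]
  refine (h.integrable_baseHaz t ht.2).mul_bdd (c := C) hr.aestronglyMeasurable ?_
  refine (ae_restrict_mem measurableSet_Icc).mono fun s hs => ?_
  exact hC s (mem_timeSet_of_le (timesBelow_subset_timeSet ht) hs.1 hs.2)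

theorem abs_dotProduct_le {a b : Fin p → ℝ} {K : ℝ} (hb : ∀ j, |b j| ≤ K) :
    |a ⬝ᵥ b| ≤ (∑ j, |a j|) * K := by
  rw [dotProduct, Finset.sum_mul]
  refine (Finset.abs_sum_le_sum_abs _ _).trans (Finset.sum_le_sum fun j _ => ?_)
  rw [abs_mul]
  exact mul_le_mul_of_nonneg_left (hb j) (abs_nonneg _)

theorem ae_condDistrib_survival [IsProbabilityMeasure μ] (h : D.IsCoxModel μ) {K : ℝ}
    (hK : D.CovBounded μ K)
    (hL : ∃ L, D.CovLipschitz μ L) :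
    ∀ᵐ e ∂μ, ∀ t ∈ timesBelow (D.tPlus μ),
      (condDistrib D.times (D.path μ) μ (D.path μ e)).fst (Set.Ioi t) = ENNReal.ofReal
        (Real.exp (-∫ s in (0 : ℝ)..t, D.baseHaz s * Real.exp (D.coef ⬝ᵥ D.cov s e))) := by
  set κ := condDistrib D.times (D.path μ) μ
  have h1 : ∀ᵐ e ∂μ, ∀ q : ℚ, (q : ℝ) ∈ timesBelow (D.tPlus μ) →
      (κ (D.path μ e)).fst (Set.Ioi (q : ℝ)) = ENNReal.ofReal
        (Real.exp (-∫ s in (0 : ℝ)..q, D.baseHaz s * Real.exp (D.coef ⬝ᵥ D.cov s e))) := by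
    rw [ae_all_iff]
    intro q
    by_cases hq : (q : ℝ) ∈ timesBelow (D.tPlus μ)
    swap
    · exact Eventually.of_forall fun e h => absurd h hq
    have e1 := ae_condDistrib_real h (measurableSet_Ioi.prod MeasurableSet.univ :
      MeasurableSet (Set.Ioi (q : ℝ) ×ˢ (Set.univ : Set ℝ)))
    have s1 : D.times ⁻¹' (Set.Ioi (q : ℝ) ×ˢ (Set.univ : Set ℝ)) = {e | (q : ℝ)
      < D.failTime e} := by
      ext; simp [times]
    rw [s1] at e1
    filter_upwards [e1, h.hazard q hq.1 hq.2] with e h1 h2 _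
    rw [Measure.fst_apply measurableSet_Ioi, ← Set.prod_univ, ← h2, ← h1, measureReal_def,
      ENNReal.ofReal_toReal (measure_ne_top _ _)]
  filter_upwards [h1, ae_cov_le hK hL] with e he1 he2 t ht
  set H : ℝ → ℝ := fun u => ∫ s in (0 : ℝ)..u, D.baseHaz s * Real.exp (D.coef ⬝ᵥ D.cov s e) with hH
  have hint : ∀ u ∈ timesBelow (D.tPlus μ), IntervalIntegrable
      (fun s => D.baseHaz s * Real.exp (D.coef ⬝ᵥ D.cov s e)) volume 0 u := by
    intro u hu
    refine intervalIntegrable_hazard h (C := Real.exp ((∑ j, |D.coef j|) * K)) ?_ ?_ hu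
    · have : Measurable fun s => D.cov s e :=
        h.measurable_cov.comp (measurable_id.prodMk measurable_const)
      refine Real.measurable_exp.comp ?_
      simp only [dotProduct]
      exact Finset.measurable_sum _ fun j _ => ((measurable_pi_apply j).comp this).const_mul _
    · intro s hs
      rw [abs_of_pos (Real.exp_pos _)]
      exact Real.exp_le_exp.2 ((le_abs_self _).trans (abs_dotProduct_le (he2 s hs)))
  obtain ⟨u, hanti, hlt, hlim⟩ := Real.exists_seq_rat_strictAnti_tendsto t
  obtain ⟨v, htv, hv⟩ := EReal.lt_iff_exists_real_btwn.1 ht.2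
  have htv' : t < v := by exact_mod_cast htv
  have hvmem : v ∈ timesBelow (D.tPlus μ) := ⟨ht.1.trans htv'.le, hv⟩
  have hu : ∀ᶠ m in atTop, (u m : ℝ) ∈ Set.Ioo t v := by
    filter_upwards [hlim.eventually (eventually_lt_nhds htv')] with m hm
    exact ⟨hlt m, hm⟩
  have hmono : Monotone fun m => Set.Ioi (u m : ℝ) := fun a b hab =>
    Set.Ioi_subset_Ioi (by exact_mod_cast hanti.antitone hab)
  have hU : ⋃ m, Set.Ioi (u m : ℝ) = Set.Ioi t := by
    ext x
    simp only [Set.mem_iUnion, Set.mem_Ioi]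
    constructor
    · rintro ⟨m, hm⟩; exact (hlt m).trans hm
    · intro hx; exact (hlim.eventually (eventually_lt_nhds hx)).exists
  have lim1 := tendsto_measure_iUnion_atTop (μ := (κ (D.path μ e)).fst) hmono
  rw [hU] at lim1
  have hcont : Tendsto (fun m => H (u m)) atTop (𝓝 (H t)) := by
    have hi := hint v hvmem
    rw [intervalIntegrable_iff_integrableOn_Icc_of_le hvmem.1, ← Set.uIcc_of_le hvmem.1] at hi
    have hc := intervalIntegral.continuousOn_primitive_interval hi
    rw [Set.uIcc_of_le hvmem.1] at hc
    refine (hc t ⟨ht.1, htv'.le⟩).tendsto.comp (tendsto_nhdsWithin_iff.2 ⟨hlim, ?_⟩)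
    filter_upwards [hu] with m hm
    exact ⟨ht.1.trans hm.1.le, hm.2.le⟩
  have lim2 : Tendsto (fun m => ENNReal.ofReal (Real.exp (-H (u m)))) atTop
      (𝓝 (ENNReal.ofReal (Real.exp (-H t)))) :=
    ENNReal.tendsto_ofReal ((Real.continuous_exp.tendsto _).comp hcont.neg)
  refine tendsto_nhds_unique lim1 (lim2.congr' ?_)
  filter_upwards [hu] with m hm
  refine (he1 (u m) ⟨ht.1.trans hm.1.le, lt_trans ?_ hv⟩).symm
  exact_mod_cast hm.2

end CoxData

/-! ### Disintegration of a sample along the covariate paths -/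

theorem lintegral_pi_condDistrib {E A B : Type*} [MeasurableSpace E] [MeasurableSpace A]
    [MeasurableSpace B] [StandardBorelSpace B] [Nonempty B] {μ : Measure E}
    [IsProbabilityMeasure μ] {X : E → A} {Y : E → B} (hX : Measurable X) (hY : Measurable Y)
    {n : ℕ} {Φ : (Fin n → A × B) → ℝ≥0∞} (hΦ : Measurable Φ) :
    (Measurable fun x : Fin n → E => ∫⁻ y, Φ (fun i => (X (x i), y i))
      ∂Measure.pi (fun i => condDistrib Y X μ (X (x i)))) ∧
    ∫⁻ x, Φ (fun i => (X (x i), Y (x i))) ∂Measure.pi (fun _ : Fin n => μ) =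
      ∫⁻ x, ∫⁻ y, Φ (fun i => (X (x i), y i)) ∂Measure.pi (fun i => condDistrib Y X μ (X (x i)))
        ∂Measure.pi (fun _ : Fin n => μ) := by
  obtain ⟨f, hf, hfκ⟩ := (condDistrib Y X μ).exists_measurable_map_eq_unitInterval
  have hf' : ∀ a, Measurable (f a) := fun a => hf.comp (measurable_const.prodMk measurable_id)
  set ρ : Measure unitInterval := volume
  have hg : Measurable fun q : E × unitInterval => (X q.1, f (X q.1) q.2) :=
    (hX.comp measurable_fst).prodMk (hf.comp ((hX.comp measurable_fst).prodMk measurable_snd))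
  have hlaw : μ.map (fun e => (X e, Y e)) =
      (μ.prod ρ).map fun q => (X q.1, f (X q.1) q.2) := by
    rw [← compProd_map_condDistrib hY.aemeasurable]
    refine Measure.ext_of_lintegral _ fun φ hφ => ?_
    rw [Measure.lintegral_compProd hφ, lintegral_map (Measurable.lintegral_kernel_prod_right' hφ)
      hX,
      lintegral_map hφ hg,
      lintegral_prod (fun q : E × unitInterval => φ (X q.1, f (X q.1) q.2))
        (hφ.comp hg).aemeasurable]
    refine lintegral_congr fun e => ?_
    rw [← hfκ, lintegral_map (f := fun b => φ (X e, b))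
      (hφ.comp (measurable_const.prodMk measurable_id)) (hf' _)]
  have hm1 : Measurable fun (x : Fin n → E) i => (X (x i), Y (x i)) :=
    measurable_pi_lambda _ fun i => (hX.prodMk hY).comp (measurable_pi_apply i)
  have hm2 : Measurable fun (q : Fin n → E × unitInterval) i => (X (q i).1, f (X (q i).1) (q i).2)
    :=
    measurable_pi_lambda _ fun i => hg.comp (measurable_pi_apply i)
  have h1 : (Measure.pi fun _ : Fin n => μ).map (fun x i => (X (x i), Y (x i))) =
      Measure.pi fun _ : Fin n => μ.map fun e => (X e, Y e) :=
    Measure.pi_map_pi (f := fun _ e => (X e, Y e)) fun i => (hX.prodMk hY).aemeasurable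
  have h2 : (Measure.pi fun _ : Fin n => μ.prod ρ).map
      (fun (q : Fin n → E × unitInterval) i => (X (q i).1, f (X (q i).1) (q i).2)) =
      Measure.pi fun _ : Fin n => (μ.prod ρ).map fun q => (X q.1, f (X q.1) q.2) :=
    Measure.pi_map_pi (f := fun _ (q : E × unitInterval) => (X q.1, f (X q.1) q.2))
      fun i => hg.aemeasurable
  have hsplit := measurePreserving_arrowProdEquivProdArrow E unitInterval (Fin n)
    (fun _ => μ) (fun _ => ρ)
  have hΨ : Measurable fun q : (Fin n → E) × (Fin n → unitInterval) =>
      Φ fun i => (X (q.1 i), f (X (q.1 i)) (q.2 i)) := by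
    refine hΦ.comp (measurable_pi_lambda _ fun i => hg.comp (f := fun q : (Fin n → E) ×
      (Fin n → unitInterval) => (q.1 i, q.2 i)) ?_)
    exact ((measurable_pi_apply i).comp measurable_fst).prodMk
      ((measurable_pi_apply i).comp measurable_snd)
  have hinner : ∀ x : Fin n → E, ∫⁻ y, Φ (fun i => (X (x i), y i))
      ∂Measure.pi (fun i => condDistrib Y X μ (X (x i))) =
      ∫⁻ u, Φ (fun i => (X (x i), f (X (x i)) (u i))) ∂Measure.pi fun _ => ρ := by
    intro x
    have h3 : (Measure.pi fun _ : Fin n => ρ).map (fun u i => f (X (x i)) (u i)) =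
        Measure.pi fun i => condDistrib Y X μ (X (x i)) := by
      simp_rw [← hfκ]
      exact Measure.pi_map_pi (f := fun i => f (X (x i))) fun i => (hf' _).aemeasurable
    rw [← h3, lintegral_map]
    · exact hΦ.comp (measurable_pi_lambda _ fun i =>
        measurable_const.prodMk (measurable_pi_apply i))
    · exact measurable_pi_lambda _ fun i => (hf' _).comp (measurable_pi_apply i)
  simp_rw [hinner]
  refine ⟨hΨ.lintegral_prod_right', ?_⟩
  rw [← lintegral_map hΦ hm1, h1, hlaw, ← h2, lintegral_map hΦ hm2]
  exact (hsplit.lintegral_comp hΨ).trans (lintegral_prod _ hΨ.aemeasurable)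

theorem ae_pi_all {n : ℕ} {A : Type*} [MeasurableSpace A] {ν : Fin n → Measure A}
    [∀ i, IsProbabilityMeasure (ν i)] {q : Fin n → A → Prop} (h : ∀ i, ∀ᵐ a ∂ν i, q i a) :
    ∀ᵐ y ∂Measure.pi ν, ∀ i, q i (y i) :=
  ae_all_iff.2 fun i => (Measure.tendsto_eval_ae_ae (i := i)).eventually (h i)

namespace CoxData

variable {E : Type*} [MeasurableSpace E] {p : ℕ} {D : CoxData E p} {μ : Measure E}

/-- A version of the covariate process, jointly measurable as a function of the time and
the path. -/
noncomputable def covLim (D : CoxData E p) (μ : Measure E) (t : ℝ) (w : D.timeSet μ → Fin p → ℝ)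
    (j : Fin p) : ℝ :=
  open Classical in
  limsup (fun m : ℕ => if h : (⌊t * (m + 1)⌋₊ : ℝ) / (m + 1) ∈ D.timeSet μ then w ⟨_, h⟩ j else 0)
    atTop

theorem measurable_covLim (j : Fin p) :
    Measurable fun x : ℝ × (D.timeSet μ → Fin p → ℝ) => D.covLim μ x.1 x.2 j := by
  classical
  refine Measurable.limsup fun m => ?_
  set G : ℕ × (D.timeSet μ → Fin p → ℝ) → ℝ := fun y =>
    if h : (y.1 : ℝ) / (m + 1) ∈ D.timeSet μ then y.2 ⟨_, h⟩ j else 0 with hG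
  have hGm : Measurable G := by
    refine measurable_from_prod_countable_right fun l => ?_
    by_cases h : (l : ℝ) / (m + 1) ∈ D.timeSet μ
    · simp only [hG, h, dif_pos]
      exact (measurable_pi_apply j).comp (measurable_pi_apply _)
    · simp only [hG, h, dif_neg, not_false_iff]
      exact measurable_const
  exact hGm.comp (((Nat.measurable_floor).comp (measurable_fst.mul_const _)).prodMk measurable_snd)

theorem covLim_path {L : ℝ} {e : E}
    (he : ∀ s ∈ D.timeSet μ, ∀ t ∈ D.timeSet μ, ∀ j, |D.cov s e j - D.cov t e j| ≤ L * |s - t|)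
    {t : ℝ} (ht : t ∈ D.timeSet μ) : D.covLim μ t (D.path μ e) = D.cov t e := by
  ext j
  refine (Tendsto.congr (fun m => ?_) (tendsto_cov_gridTime he ht j)).limsup_eq
  have : (⌊t * (m + 1)⌋₊ : ℝ) / (m + 1) ∈ D.timeSet μ :=
    mem_timeSet_of_le ht (gridTime_nonneg m t) (gridTime_le ht.1 m)
  rw [dif_pos this]
  rfl

attribute [irreducible] covLim

/-- The score (gradient of the log-partial likelihood) at the true coefficient vector. -/
noncomputable def score {n : ℕ} (D : CoxData E p) (x : Fin n → E) (k : Fin p) : ℝ :=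
  (1 / (n : ℝ)) * ∑ i, D.event (x i) *
    (D.cov (D.obsTime (x i)) (x i) k - D.Zbar x (D.obsTime (x i)) D.coef k)

theorem ae_no_ties [IsProbabilityMeasure μ] (h : D.IsCoxModel μ) (hd : D.HasBoundedDensity μ)
    (n : ℕ) : ∀ᵐ x ∂Measure.pi (fun _ : Fin n => μ), ∀ i j, i ≠ j →
      D.obsTime (x i) ≠ D.obsTime (x j) := by
  rw [ae_all_iff]; intro i
  rw [ae_all_iff]; intro j
  by_cases hij : i = j
  · exact Eventually.of_forall fun x h => absurd hij h
  have hT := h.measurable_obsTime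
  have hind : iIndepFun (fun (i : Fin n) (x : Fin n → E) => D.obsTime (x i))
      (Measure.pi fun _ : Fin n => μ) :=
    iIndepFun_pi (X := fun _ => D.obsTime) fun _ => hT.aemeasurable
  have hTi : ∀ i : Fin n, Measurable fun x : Fin n → E => D.obsTime (x i) := fun i =>
    hT.comp (measurable_pi_apply i)
  have hmap : ∀ i : Fin n, (Measure.pi fun _ : Fin n => μ).map (fun x => D.obsTime (x i)) =
      μ.map D.obsTime := by
    intro i
    rw [show (fun x : Fin n → E => D.obsTime (x i)) = D.obsTime ∘ Function.eval i from rfl,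
      ← Measure.map_map hT (measurable_pi_apply i), (measurePreserving_eval (fun _ => μ) i).map_eq]
  have hprod := (indepFun_iff_map_prod_eq_prod_map_map (hTi i).aemeasurable
    (hTi j).aemeasurable).1 (hind.indepFun hij)
  rw [hmap, hmap] at hprod
  have hD : MeasurableSet {a : ℝ × ℝ | a.1 = a.2} :=
    measurableSet_eq_fun measurable_fst measurable_snd
  have : IsProbabilityMeasure (μ.map D.obsTime) := Measure.isProbabilityMeasure_map hT.aemeasurable
  have h0 : (μ.map D.obsTime).prod (μ.map D.obsTime) {a : ℝ × ℝ | a.1 = a.2} = 0 := by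
    rw [Measure.measure_prod_null hD]
    refine Eventually.of_forall fun a => ?_
    refine (Measure.map_apply hT (measurable_prodMk_left hD)).trans ?_
    have := measure_obsTime_eq h hd a
    refine Eq.trans ?_ this
    congr 1
    ext e
    exact eq_comm
  rw [← hprod, Measure.map_apply ((hTi i).prodMk (hTi j)) hD] at h0
  filter_upwards [measure_eq_zero_iff_ae_notMem.1 h0] with x hx _
  exact hx

theorem ae_condDistrib_no_ties [IsProbabilityMeasure μ] (h : D.IsCoxModel μ)
    (hd : D.HasBoundedDensity μ) (n : ℕ) : ∀ᵐ x ∂Measure.pi (fun _ : Fin n => μ),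
      ∀ᵐ y ∂Measure.pi fun i => condDistrib D.times (D.path μ) μ (D.path μ (x i)),
      ∀ i j, i ≠ j → min (y i).1 (y i).2 ≠ min (y j).1 (y j).2 := by
  set A : Set (Fin n → (D.timeSet μ → Fin p → ℝ) × (ℝ × ℝ)) :=
    {a | ∀ i j, i ≠ j → min (a i).2.1 (a i).2.2 ≠ min (a j).2.1 (a j).2.2} with hA
  have hAm : MeasurableSet A := by
    simp only [hA, Set.ofPred_forall]
    refine MeasurableSet.iInter fun i => MeasurableSet.iInter fun j => MeasurableSet.iInter fun _
      => ?_
    have hm : ∀ i : Fin n, Measurable fun a : Fin n → (D.timeSet μ → Fin p → ℝ) × (ℝ × ℝ) =>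
        min (a i).2.1 (a i).2.2 := fun i =>
      (measurable_pi_apply i).snd.fst.min (measurable_pi_apply i).snd.snd
    exact (measurableSet_eq_fun (hm i) (hm j)).compl
  have hm : Measurable ((Aᶜ).indicator (1 : (Fin n → (D.timeSet μ → Fin p → ℝ) × (ℝ × ℝ)) → ℝ≥0∞))
    := measurable_one.indicator hAm.compl
  have hz : ∫⁻ x, (Aᶜ).indicator 1 (fun i => (D.path μ (x i), D.times (x i)))
      ∂Measure.pi (fun _ : Fin n => μ) = 0 := by
    refine (lintegral_congr_ae ?_).trans lintegral_zero
    filter_upwards [ae_no_ties h hd n] with x hx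
    have : (fun i => (D.path μ (x i), D.times (x i))) ∈ A := hx
    exact Set.indicator_of_notMem (not_not_intro this) _
  obtain ⟨hout, hdis⟩ := lintegral_pi_condDistrib (μ := μ) h.measurable_path h.measurable_times hm
  rw [hdis, lintegral_eq_zero_iff hout] at hz
  filter_upwards [hz] with x hx
  have hin : Measurable fun y : Fin n → ℝ × ℝ => (Aᶜ).indicator 1
      (fun i => (D.path μ (x i), y i)) :=
    hm.comp (measurable_pi_lambda _ fun i => measurable_const.prodMk (measurable_pi_apply i))
  rw [Pi.zero_apply, lintegral_eq_zero_iff hin] at hx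
  filter_upwards [hx] with y hy
  by_contra hc
  have : (fun i => (D.path μ (x i), y i)) ∈ Aᶜ := hc
  rw [Set.indicator_of_mem this] at hy
  simp at hy

/-- The score exponent with fixed covariate paths. -/
noncomputable def pathExponent (D : CoxData E p) (μ : Measure E) (K s : ℝ) (k : Fin p) {n : ℕ}
    (w : Fin n → D.timeSet μ → Fin p → ℝ) (y : Fin n → ℝ × ℝ) : ℝ :=
  scoreExponent s (4 * K ^ 2 * s ^ 2) (fun i t => Real.exp (D.coef ⬝ᵥ D.covLim μ t (w i)))
    (fun i t => max (-K) (min K (D.covLim μ t (w i) k))) y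

theorem measurable_exp_covLim : Measurable fun a : ℝ × (D.timeSet μ → Fin p → ℝ) =>
    Real.exp (D.coef ⬝ᵥ D.covLim μ a.1 a.2) := by
  refine Real.measurable_exp.comp ?_
  simp only [dotProduct]
  exact Finset.measurable_sum _ fun j _ => (measurable_covLim j).const_mul _

theorem measurable_clip_covLim (K : ℝ) (k : Fin p) :
    Measurable fun a : ℝ × (D.timeSet μ → Fin p → ℝ) => max (-K) (min K (D.covLim μ a.1 a.2 k)) :=
  measurable_const.max (measurable_const.min (measurable_covLim k))

theorem measurable_pathExponent (K s : ℝ) (k : Fin p) (n : ℕ) :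
    Measurable fun a : Fin n → (D.timeSet μ → Fin p → ℝ) × (ℝ × ℝ) =>
      D.pathExponent μ K s k (fun i => (a i).1) fun i => (a i).2 := by
  have hpr : ∀ i : Fin n, Measurable fun a : ℝ × (Fin n → (D.timeSet μ → Fin p → ℝ) × (ℝ × ℝ)) =>
      (a.1, (a.2 i).1) :=
    fun i => measurable_fst.prodMk ((measurable_pi_apply i).comp measurable_snd).fst
  refine measurable_scoreExponent s _
    (r := fun i t (a : Fin n → (D.timeSet μ → Fin p → ℝ) × (ℝ × ℝ)) =>
      Real.exp (D.coef ⬝ᵥ D.covLim μ t (a i).1))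
    (z := fun i t (a : Fin n → (D.timeSet μ → Fin p → ℝ) × (ℝ × ℝ)) =>
      max (-K) (min K (D.covLim μ t (a i).1 k)))
    (y := fun a i => (a i).2) (fun i => ?_) (fun i => ?_) ?_
  · exact Measurable.comp (g := fun a : ℝ × (D.timeSet μ → Fin p → ℝ) =>
      Real.exp (D.coef ⬝ᵥ D.covLim μ a.1 a.2)) measurable_exp_covLim (hpr i)
  · exact Measurable.comp (g := fun a : ℝ × (D.timeSet μ → Fin p → ℝ) =>
      max (-K) (min K (D.covLim μ a.1 a.2 k))) (measurable_clip_covLim K k) (hpr i)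
  · exact measurable_pi_lambda _ fun i => (measurable_pi_apply i).snd

theorem ae_lintegral_pathExponent_le_one [IsProbabilityMeasure μ] (h : D.IsCoxModel μ)
    (hd : D.HasBoundedDensity μ) {K : ℝ} (hK0 : 0 < K) (hK : D.CovBounded μ K)
    (hL : ∃ L, D.CovLipschitz μ L) (n : ℕ) (k : Fin p) (s : ℝ) :
    ∀ᵐ x ∂Measure.pi (fun _ : Fin n => μ),
      ∫⁻ y, ENNReal.ofReal (Real.exp (D.pathExponent μ K s k (fun i => D.path μ (x i)) y))
        ∂Measure.pi (fun i => condDistrib D.times (D.path μ) μ (D.path μ (x i))) ≤ 1 := by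
  have hgood := ae_pi_all (n := n) (ν := fun _ => μ) fun _ => (ae_condDistrib_eq_prod h).and
    ((ae_condDistrib_min_mem h hd).and ((ae_condDistrib_survival h hK hL).and
      ((ae_cov_le hK hL).and hL.choose_spec)))
  filter_upwards [ae_condDistrib_no_ties h hd n, hgood] with x hx1 hx2
  have hmem : ∀ᵐ y ∂Measure.pi fun i => condDistrib D.times (D.path μ) μ (D.path μ (x i)), ∀ i,
      min (y i).1 (y i).2 ∈ timesBelow (D.tPlus μ) := ae_pi_all fun i => (hx2 i).2.1
  have hcov : ∀ i, ∀ t ∈ D.timeSet μ, D.covLim μ t (D.path μ (x i)) = D.cov t (x i) :=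
    fun i t ht => covLim_path (hx2 i).2.2.2.2 ht
  have hrm : ∀ i, Measurable fun t => Real.exp (D.coef ⬝ᵥ D.covLim μ t (D.path μ (x i))) :=
    fun i => measurable_exp_covLim.comp (measurable_id.prodMk measurable_const)
  have hl := lintegral_scoreExponent_le ((volume.restrict (timesBelow (D.tPlus μ))).withDensity
      fun u => ENNReal.ofReal (D.baseHaz u)) (K := K) s
    (fun i => condDistrib D.times (D.path μ) μ (D.path μ (x i)))
    (fun i t => Real.exp (D.coef ⬝ᵥ D.covLim μ t (D.path μ (x i))))
    (fun i t => max (-K) (min K (D.covLim μ t (D.path μ (x i)) k))) hrm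
    (fun i => (measurable_clip_covLim K k).comp (measurable_id.prodMk measurable_const))
    (fun _ _ => Real.exp_pos _)
    (fun i t => abs_le.2 ⟨le_max_left _ _, max_le (by linarith) (min_le_left _ _)⟩)
    ?_ hx1 (-1)
  · refine le_trans (le_of_eq ?_) (hl.trans (Finset.prod_le_one' fun i _ => prob_le_one))
    rw [Measure.restrict_eq_self_of_ae_mem]
    · rfl
    · filter_upwards [hmem] with y hy i
      exact lt_of_lt_of_le (by norm_num) (hy i).1
  · intro i φ hφ
    obtain ⟨hprod, hmin, hsurv, hbd, -⟩ := hx2 i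
    have := setLIntegral_failure_eq (condDistrib D.times (D.path μ) μ (D.path μ (x i))).fst
      (condDistrib D.times (D.path μ) μ (D.path μ (x i))).snd
      (D.tPlus μ) (l := D.baseHaz)
      (r := fun t => Real.exp (D.coef ⬝ᵥ D.covLim μ t (D.path μ (x i))))
      h.measurable_baseHaz (hrm i) h.baseHaz_nonneg (fun _ => (Real.exp_pos _).le)
      (fun t ht => intervalIntegrable_hazard h (hrm i)
        (C := Real.exp ((∑ j, |D.coef j|) * K)) (fun u hu => ?_) ht) ?_ ?_ hφ
    · rwa [hprod] at this
    · rw [hcov i u hu, abs_of_pos (Real.exp_pos _)]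
      exact Real.exp_le_exp.2 ((le_abs_self _).trans (abs_dotProduct_le (hbd u hu)))
    · intro t ht
      rw [hsurv t ht]
      congr 3
      refine intervalIntegral.integral_congr fun u hu => ?_
      rw [Set.uIcc_of_le ht.1] at hu
      rw [hcov i u (mem_timeSet_of_le (timesBelow_subset_timeSet ht) hu.1 hu.2)]
    · rw [hprod]; exact hmin

theorem lintegral_exp_pathExponent_le_one [IsProbabilityMeasure μ] (h : D.IsCoxModel μ)
    (hd : D.HasBoundedDensity μ) {K : ℝ} (hK0 : 0 < K) (hK : D.CovBounded μ K)
    (hL : ∃ L, D.CovLipschitz μ L) (n : ℕ) (k : Fin p) (s : ℝ) :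
    ∫⁻ x, ENNReal.ofReal (Real.exp (D.pathExponent μ K s k (fun i => D.path μ (x i))
      fun i => D.times (x i))) ∂Measure.pi (fun _ : Fin n => μ) ≤ 1 := by
  have hm := (Real.measurable_exp.comp
    (measurable_pathExponent (D := D) (μ := μ) K s k n)).ennreal_ofReal
  refine (lintegral_pi_condDistrib h.measurable_path h.measurable_times hm (μ := μ)).2.le.trans ?_
  refine (lintegral_mono_ae (ae_lintegral_pathExponent_le_one h hd hK0 hK hL n k s)).trans ?_
  rw [lintegral_one, measure_univ]

end CoxData

/-! ### Concentration of the score -/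

namespace CoxData

section

variable {E : Type*} {p : ℕ} {D : CoxData E p}

theorem Zbar_eq_div {n : ℕ} (x : Fin n → E) (t : ℝ) (b : Fin p → ℝ) (k : Fin p) :
    D.Zbar x t b k = (∑ i, D.cov t (x i) k * D.weight t b (x i)) / ∑ j, D.weight t b (x j) := by
  simp only [Zbar, Finset.sum_div, mul_div_assoc]

theorem event_nonneg (e : E) : 0 ≤ D.event e := by unfold event; split_ifs <;> norm_num

theorem event_le_one (e : E) : D.event e ≤ 1 := by unfold event; split_ifs <;> norm_num

end

variable {E : Type*} [MeasurableSpace E] {p : ℕ} {D : CoxData E p} {μ : Measure E}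

/-- Observed times lie in the time set, and the covariates are bounded by `K` there. -/
def IsGoodSample (D : CoxData E p) (μ : Measure E) (K : ℝ) {n : ℕ} (x : Fin n → E) : Prop :=
  (∀ i, D.obsTime (x i) ∈ D.timeSet μ) ∧ ∀ i, ∀ t ∈ D.timeSet μ, ∀ j, |D.cov t (x i) j| ≤ K

theorem ae_isGoodSample [IsProbabilityMeasure μ] (h : D.IsCoxModel μ)
    (hd : D.HasBoundedDensity μ) {K : ℝ} (hK : D.CovBounded μ K)
    (hL : ∃ L, D.CovLipschitz μ L) (n : ℕ) :
    ∀ᵐ x ∂Measure.pi (fun _ : Fin n => μ), D.IsGoodSample μ K x := by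
  filter_upwards [ae_pi_all (n := n) (ν := fun _ => μ) fun _ => (ae_obsTime_mem h hd).and
    (ae_cov_le hK hL)] with x hx
  exact ⟨fun i => timesBelow_subset_timeSet (hx i).1, fun i => (hx i).2⟩

theorem ae_pathExponent_eq [IsProbabilityMeasure μ] (h : D.IsCoxModel μ)
    (hd : D.HasBoundedDensity μ) {K : ℝ} (hK : D.CovBounded μ K)
    (hL : ∃ L, D.CovLipschitz μ L) (n : ℕ) (k : Fin p) (s : ℝ) :
    ∀ᵐ x ∂Measure.pi (fun _ : Fin n => μ),
      D.pathExponent μ K s k (fun i => D.path μ (x i)) (fun i => D.times (x i)) =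
        s * (n * D.score x k) - 4 * K ^ 2 * s ^ 2 * ∑ i, D.event (x i) := by
  filter_upwards [ae_isGoodSample h hd hK hL n,
    ae_pi_all (n := n) (ν := fun _ => μ) fun _ => hL.choose_spec] with x hx hlip
  rcases Nat.eq_zero_or_pos n with rfl | hn
  · simp [pathExponent, scoreExponent]
  have hn' : (n : ℝ) ≠ 0 := by positivity
  have hcov : ∀ i, ∀ t ∈ D.timeSet μ, D.covLim μ t (D.path μ (x i)) = D.cov t (x i) :=
    fun i t ht => covLim_path (hlip i) ht
  have hclip : ∀ i, ∀ t ∈ D.timeSet μ, max (-K) (min K (D.covLim μ t (D.path μ (x i)) k)) =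
      D.cov t (x i) k := by
    intro i t ht
    have := abs_le.1 (hx.2 i t ht k)
    rw [hcov i t ht, min_eq_right this.2, max_eq_right this.1]
  rw [score, ← mul_assoc (n : ℝ), mul_one_div_cancel hn', one_mul, Finset.mul_sum, Finset.mul_sum,
    ← Finset.sum_sub_distrib]
  unfold pathExponent scoreExponent
  refine Finset.sum_congr rfl fun i _ => ?_
  set t := D.obsTime (x i) with ht
  have htm : t ∈ D.timeSet μ := hx.1 i
  change (if D.failTime (x i) ≤ D.censTime (x i) then s * (max (-K) (min K
    (D.covLim μ t (D.path μ (x i)) k)) - riskMean _ _ _ t) - 4 * K ^ 2 * s ^ 2 else 0) = _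
  have hrisk : riskMean (fun i t => Real.exp (D.coef ⬝ᵥ D.covLim μ t (D.path μ (x i))))
      (fun i t => max (-K) (min K (D.covLim μ t (D.path μ (x i)) k)))
      (fun i => D.times (x i)) t = D.Zbar x t D.coef k := by
    rw [Zbar_eq_div, riskMean]
    simp only [hclip _ t htm]
    simp only [hcov _ t htm]
    congr 1
    · refine Finset.sum_congr rfl fun j _ => ?_
      simp only [weight, atRisk, obsTime, times]
      split_ifs <;> simp
    · refine Finset.sum_congr rfl fun j _ => ?_
      simp only [weight, atRisk, obsTime, times]
      split_ifs <;> simp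
  rw [hrisk, hclip i t htm, event]
  split_ifs <;> ring

theorem measure_mul_score_ge_le [IsProbabilityMeasure μ] (h : D.IsCoxModel μ)
    (hd : D.HasBoundedDensity μ) {K : ℝ} (hK0 : 0 < K) (hK : D.CovBounded μ K)
    (hL : ∃ L, D.CovLipschitz μ L) (n : ℕ) (k : Fin p) (s a : ℝ) :
    Measure.pi (fun _ : Fin n => μ) {x | a ≤ s * (n * D.score x k)} ≤
      ENNReal.ofReal (Real.exp (4 * K ^ 2 * s ^ 2 * n - a)) := by
  set F : (Fin n → E) → ℝ≥0∞ := fun x => ENNReal.ofReal (Real.exp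
    (D.pathExponent μ K s k (fun i => D.path μ (x i)) fun i => D.times (x i))) with hF
  have hFm : Measurable F := by
    have h1 : Measurable fun (x : Fin n → E) i => (D.path μ (x i), D.times (x i)) :=
      measurable_pi_lambda _ fun i =>
        (h.measurable_path.prodMk h.measurable_times).comp (measurable_pi_apply i)
    exact (Real.measurable_exp.comp
      ((measurable_pathExponent (D := D) (μ := μ) K s k n).comp h1)).ennreal_ofReal
  set c := 4 * K ^ 2 * s ^ 2 with hc
  have hc0 : 0 ≤ c := by positivity
  have hpos : ENNReal.ofReal (Real.exp (a - c * n)) ≠ 0 :=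
    (ENNReal.ofReal_pos.2 (Real.exp_pos _)).ne'
  calc _ ≤ Measure.pi (fun _ : Fin n => μ) {x | ENNReal.ofReal (Real.exp (a - c * n)) ≤ F x} := by
        refine measure_mono_ae ?_
        filter_upwards [ae_pathExponent_eq h hd hK hL n k s] with x hx hax
        refine ENNReal.ofReal_le_ofReal (Real.exp_le_exp.2 ?_)
        rw [hx]
        have h1 : ∑ i, D.event (x i) ≤ n := by
          simpa using Finset.sum_le_sum fun (i : Fin n) (_ : i ∈ Finset.univ) =>
            D.event_le_one (x i)
        have h2 := mul_le_mul_of_nonneg_left h1 hc0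
        have h3 : a ≤ s * (n * D.score x k) := hax
        linarith
    _ ≤ (∫⁻ x, F x ∂Measure.pi (fun _ : Fin n => μ)) / ENNReal.ofReal (Real.exp (a - c * n)) :=
        meas_ge_le_lintegral_div hFm.aemeasurable hpos ENNReal.ofReal_ne_top
    _ ≤ 1 / ENNReal.ofReal (Real.exp (a - c * n)) :=
        ENNReal.div_le_div_right (lintegral_exp_pathExponent_le_one h hd hK0 hK hL n k s) _
    _ = _ := by
        rw [← ENNReal.ofReal_one, ← ENNReal.ofReal_div_of_pos (Real.exp_pos _), one_div,
          ← Real.exp_neg, neg_sub]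

theorem measure_exists_abs_score_ge_le [IsProbabilityMeasure μ] (h : D.IsCoxModel μ)
    (hd : D.HasBoundedDensity μ) {K : ℝ} (hK0 : 0 < K) (hK : D.CovBounded μ K)
    (hL : ∃ L, D.CovLipschitz μ L) (n : ℕ) {u : ℝ} (hu : 0 ≤ u) :
    Measure.pi (fun _ : Fin n => μ) {x | ∃ k, u ≤ |D.score x k|} ≤
      ENNReal.ofReal (2 * p * Real.exp (-(n * u ^ 2 / (16 * K ^ 2)))) := by
  have key : ∀ k, Measure.pi (fun _ : Fin n => μ) {x | u ≤ |D.score x k|} ≤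
      ENNReal.ofReal (2 * Real.exp (-(n * u ^ 2 / (16 * K ^ 2)))) := by
    intro k
    have hs : ∀ σ : ℝ, σ ^ 2 = 1 → Measure.pi (fun _ : Fin n => μ)
        {x | u ≤ σ * D.score x k} ≤ ENNReal.ofReal (Real.exp (-(n * u ^ 2 / (16 * K ^ 2)))) := by
      intro σ hσ
      refine le_trans (measure_mono fun x hx => ?_) ((measure_mul_score_ge_le h hd hK0 hK hL n k
        (σ * (u / (8 * K ^ 2))) (n * u ^ 2 / (8 * K ^ 2))).trans (le_of_eq ?_))
      · have hx' : u ≤ σ * D.score x k := hx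
        have : n * u ^ 2 / (8 * K ^ 2) ≤ σ * (u / (8 * K ^ 2)) * (n * D.score x k) := by
          have := mul_le_mul_of_nonneg_left hx' (show 0 ≤ n * (u / (8 * K ^ 2)) by positivity)
          calc _ = n * (u / (8 * K ^ 2)) * u := by ring
            _ ≤ _ := this
            _ = _ := by ring
        exact this
      · congr 2
        rw [mul_pow, hσ]
        field_simp
        ring
    refine (measure_mono (t := {x | u ≤ 1 * D.score x k} ∪ {x | u ≤ (-1) * D.score x k})
      fun x hx => ?_).trans ((measure_union_le _ _).trans ((add_le_add (hs 1 (by norm_num))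
        (hs (-1) (by norm_num))).trans (le_of_eq ?_)))
    · rcases le_abs.1 (show u ≤ |D.score x k| from hx) with h | h
      · exact Or.inl (by simpa using h)
      · exact Or.inr (by simpa using h)
    · rw [← ENNReal.ofReal_add (Real.exp_pos _).le (Real.exp_pos _).le, two_mul]
  have hset : {x : Fin n → E | ∃ k, u ≤ |D.score x k|} = ⋃ k, {x | u ≤ |D.score x k|} := by
    ext; simp
  rw [hset]
  refine (measure_iUnion_fintype_le _ _).trans ((Finset.sum_le_sum fun k _ => key k).trans ?_)
  rw [Finset.sum_const, Finset.card_univ, Fintype.card_fin, nsmul_eq_mul,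
    ← ENNReal.ofReal_natCast, ← ENNReal.ofReal_mul (by positivity)]
  exact le_of_eq (by congr 1; ring)

end CoxData

/-! ### Exponentially tilted averages -/

section Tilt

variable {ι : Type*} [Fintype ι] (w c : ι → ℝ)

/-- The total mass of the weights `w` tilted by `exp (u c)`. -/
noncomputable def tiltMass (u : ℝ) : ℝ := ∑ j, w j * Real.exp (u * c j)

/-- The mean of `c` under the weights `w` tilted by `exp (u c)`. -/
noncomputable def tiltMean (u : ℝ) : ℝ := (∑ j, w j * Real.exp (u * c j) * c j) / tiltMass w c u

/-- The variance of `c` under the weights `w` tilted by `exp (u c)`. -/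
noncomputable def tiltVar (u : ℝ) : ℝ :=
  (∑ j, w j * Real.exp (u * c j) * (c j - tiltMean w c u) ^ 2) / tiltMass w c u

variable {w c}

theorem tiltMass_pos (hw : ∀ j, 0 ≤ w j) (hpos : ∃ j, 0 < w j) (u : ℝ) : 0 < tiltMass w c u := by
  obtain ⟨j, hj⟩ := hpos
  exact Finset.sum_pos' (fun i _ => mul_nonneg (hw i) (Real.exp_pos _).le)
    ⟨j, Finset.mem_univ j, mul_pos hj (Real.exp_pos _)⟩

theorem tiltVar_nonneg (hw : ∀ j, 0 ≤ w j) (u : ℝ) : 0 ≤ tiltVar w c u :=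
  div_nonneg (Finset.sum_nonneg fun j _ =>
      mul_nonneg (mul_nonneg (hw j) (Real.exp_pos _).le) (sq_nonneg _))
    (Finset.sum_nonneg fun j _ => mul_nonneg (hw j) (Real.exp_pos _).le)

theorem hasDerivAt_tiltMass (u : ℝ) :
    HasDerivAt (tiltMass w c) (∑ j, w j * Real.exp (u * c j) * c j) u := by
  refine HasDerivAt.fun_sum fun j _ => ?_
  have := (((hasDerivAt_id u).mul_const (c j)).exp).const_mul (w j)
  simpa [mul_assoc] using this

theorem hasDerivAt_log_tiltMass (hw : ∀ j, 0 ≤ w j) (hpos : ∃ j, 0 < w j) (u : ℝ) :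
    HasDerivAt (fun u => Real.log (tiltMass w c u)) (tiltMean w c u) u :=
  (hasDerivAt_tiltMass u).log (tiltMass_pos hw hpos u).ne'

theorem hasDerivAt_tiltMean (hw : ∀ j, 0 ≤ w j) (hpos : ∃ j, 0 < w j) (u : ℝ) :
    HasDerivAt (tiltMean w c) (tiltVar w c u) u := by
  have hW := (tiltMass_pos (c := c) hw hpos u).ne'
  have h1 : HasDerivAt (fun u => ∑ j, w j * Real.exp (u * c j) * c j)
      (∑ j, w j * Real.exp (u * c j) * c j ^ 2) u := by
    refine HasDerivAt.fun_sum fun j _ => ?_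
    have := ((((hasDerivAt_id u).mul_const (c j)).exp).const_mul (w j)).mul_const (c j)
    simpa [mul_assoc, sq] using this
  refine (h1.div (hasDerivAt_tiltMass u) hW).congr_deriv ?_
  have hm : ∑ j, w j * Real.exp (u * c j) * c j = tiltMean w c u * tiltMass w c u := by
    rw [tiltMean, div_mul_cancel₀ _ hW]
  have h2 : ∑ j, w j * Real.exp (u * c j) * (c j - tiltMean w c u) ^ 2 =
      ∑ j, w j * Real.exp (u * c j) * c j ^ 2 - tiltMean w c u ^ 2 * tiltMass w c u := by
    have h3 : ∀ j, w j * Real.exp (u * c j) * (c j - tiltMean w c u) ^ 2 =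
        w j * Real.exp (u * c j) * c j ^ 2 - 2 * tiltMean w c u * (w j * Real.exp (u * c j) * c j) +
          tiltMean w c u ^ 2 * (w j * Real.exp (u * c j)) := fun j => by ring
    simp_rw [h3, Finset.sum_add_distrib, Finset.sum_sub_distrib, ← Finset.mul_sum, hm]
    rw [show ∑ j, w j * Real.exp (u * c j) = tiltMass w c u from rfl]
    ring
  rw [tiltVar, h2, hm]
  field_simp

theorem exp_mul_tiltVar_zero_le (hw : ∀ j, 0 ≤ w j) (hpos : ∃ j, 0 < w j) {η u : ℝ} (hu : 0 ≤ u)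
    (hc : ∀ j k, |c j - c k| ≤ η) : Real.exp (-(u * η)) * tiltVar w c 0 ≤ tiltVar w c u := by
  have hW := tiltMass_pos (c := c) hw hpos u
  have hW0 := tiltMass_pos (c := c) hw hpos 0
  have hm0 : ∑ j, w j * c j = tiltMean w c 0 * tiltMass w c 0 := by
    rw [tiltMean, div_mul_cancel₀ _ hW0.ne']; simp
  have hmass0 : tiltMass w c 0 = ∑ j, w j := by simp [tiltMass]
  -- the variance at zero is at most the second moment about any other point
  have h1 : tiltVar w c 0 ≤ (∑ j, w j * (c j - tiltMean w c u) ^ 2) / tiltMass w c 0 := by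
    rw [tiltVar]
    refine div_le_div_of_nonneg_right ?_ hW0.le
    have h3 : ∀ j, w j * (c j - tiltMean w c u) ^ 2 =
        w j * Real.exp (0 * c j) * (c j - tiltMean w c 0) ^ 2 +
        2 * (tiltMean w c 0 - tiltMean w c u) * (w j * c j - tiltMean w c 0 * w j) +
        (tiltMean w c 0 - tiltMean w c u) ^ 2 * w j := fun j => by
      rw [zero_mul, Real.exp_zero]; ring
    simp_rw [h3, Finset.sum_add_distrib, ← Finset.mul_sum, Finset.sum_sub_distrib, ← Finset.mul_sum,
      hm0, ← hmass0]
    have := mul_nonneg (sq_nonneg (tiltMean w c 0 - tiltMean w c u)) hW0.le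
    linarith
  have h2 : ∀ j, Real.exp (-(u * η)) * tiltMass w c u ≤ Real.exp (u * c j) * tiltMass w c 0 := by
    intro j
    rw [hmass0, tiltMass, Finset.mul_sum, Finset.mul_sum]
    refine Finset.sum_le_sum fun k _ => ?_
    have : Real.exp (-(u * η)) * Real.exp (u * c k) ≤ Real.exp (u * c j) := by
      rw [← Real.exp_add]
      refine Real.exp_le_exp.2 ?_
      have := mul_le_mul_of_nonneg_left ((le_abs_self _).trans (hc k j)) hu
      linarith
    calc _ = w k * (Real.exp (-(u * η)) * Real.exp (u * c k)) := by ring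
      _ ≤ w k * Real.exp (u * c j) := mul_le_mul_of_nonneg_left this (hw k)
      _ = _ := mul_comm _ _
  refine (mul_le_mul_of_nonneg_left h1 (Real.exp_pos _).le).trans ?_
  rw [tiltVar, ← mul_div_assoc, div_le_div_iff₀ hW0 hW, Finset.mul_sum, Finset.sum_mul,
    Finset.sum_mul]
  refine Finset.sum_le_sum fun j _ => ?_
  have := mul_le_mul_of_nonneg_left (h2 j) (mul_nonneg (hw j) (sq_nonneg (c j - tiltMean w c u)))
  calc _ = w j * (c j - tiltMean w c u) ^ 2 * (Real.exp (-(u * η)) * tiltMass w c u) := by ring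
    _ ≤ _ := this
    _ = _ := by ring

end Tilt

/-! ### The log-partial likelihood along a line -/

theorem fderiv_fderiv_apply_eq_of_hasDerivAt {V : Type*} [NormedAddCommGroup V] [NormedSpace ℝ V]
    {f : V → ℝ} (hf : ContDiff ℝ 2 f) {b v : V} {g : ℝ → ℝ} {q : ℝ}
    (hg : ∀ u : ℝ, HasDerivAt (fun u : ℝ => f (b + u • v)) (g u) u) (hq : HasDerivAt g q 0) :
    fderiv ℝ (fderiv ℝ f) b v v = q := by
  have hd1 : Differentiable ℝ f := hf.differentiable (by norm_num)
  have hd2 : Differentiable ℝ (fderiv ℝ f) :=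
    (hf.fderiv_right (m := 1) (by norm_num)).differentiable (by norm_num)
  have hline : ∀ u : ℝ, HasDerivAt (fun u : ℝ => b + u • v) v u := fun u => by
    have := ((hasDerivAt_id u).smul_const v).const_add b
    simpa using this
  have h1 : ∀ u : ℝ, fderiv ℝ f (b + u • v) v = g u := fun u =>
    (HasFDerivAt.comp_hasDerivAt (f := fun u : ℝ => b + u • v) (l := f) u
      (hd1 (b + u • v)).hasFDerivAt (hline u)).unique (hg u)
  have e0 : HasFDerivAt (fderiv ℝ f) (fderiv ℝ (fderiv ℝ f) b) (b + (0 : ℝ) • v) := by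
    rw [zero_smul, add_zero]
    exact (hd2 b).hasFDerivAt
  have e1 := (HasFDerivAt.comp_hasDerivAt (f := fun u : ℝ => b + u • v) (l := fderiv ℝ f) 0 e0
    (hline 0)).clm_apply (hasDerivAt_const (0 : ℝ) v)
  simp only [Function.comp_apply, h1, map_zero, add_zero] at e1
  exact e1.unique hq

namespace CoxData

section

variable {E : Type*} {p n : ℕ} {D : CoxData E p} (x : Fin n → E)

theorem weight_nonneg (t : ℝ) (b : Fin p → ℝ) (e : E) : 0 ≤ D.weight t b e := by
  unfold weight atRisk
  split_ifs
  · rw [one_mul]; exact (Real.exp_pos _).le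
  · simp

theorem weight_self_pos (e : E) (b : Fin p → ℝ) : 0 < D.weight (D.obsTime e) b e := by
  simp only [weight, atRisk, le_refl, if_true, one_mul]
  exact Real.exp_pos _

theorem exists_weight_pos (i : Fin n) (b : Fin p → ℝ) :
    ∃ j, 0 < D.weight (D.obsTime (x i)) b (x j) := ⟨i, weight_self_pos _ _⟩

theorem weight_line (t u : ℝ) (b v : Fin p → ℝ) (e : E) :
    D.weight t (b + u • v) e = D.weight t b e * Real.exp (u * (v ⬝ᵥ D.cov t e)) := by
  simp only [weight, add_dotProduct, smul_dotProduct, smul_eq_mul, Real.exp_add]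
  ring

/-- The negative log-partial likelihood along the line `b + u v`. -/
theorem neg_logPL_line (b v : Fin p → ℝ) (u : ℝ) :
    -D.logPL x (b + u • v) = (1 / (n : ℝ)) * ∑ i, D.event (x i) *
      (Real.log (tiltMass (fun j => D.weight (D.obsTime (x i)) b (x j))
        (fun j => v ⬝ᵥ D.cov (D.obsTime (x i)) (x j)) u) -
      (b ⬝ᵥ D.cov (D.obsTime (x i)) (x i) + u * (v ⬝ᵥ D.cov (D.obsTime (x i)) (x i)))) := by
  rw [logPL, neg_sub, ← mul_sub, ← Finset.sum_sub_distrib]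
  congr 1
  refine Finset.sum_congr rfl fun i _ => ?_
  simp only [weight_line, add_dotProduct, smul_dotProduct, smul_eq_mul, tiltMass]
  ring

/-- The derivative of the negative log-partial likelihood along a line. -/
noncomputable def lineDeriv1 (D : CoxData E p) (x : Fin n → E) (b v : Fin p → ℝ) (u : ℝ) : ℝ :=
  (1 / (n : ℝ)) * ∑ i, D.event (x i) *
    (tiltMean (fun j => D.weight (D.obsTime (x i)) b (x j))
      (fun j => v ⬝ᵥ D.cov (D.obsTime (x i)) (x j)) u - v ⬝ᵥ D.cov (D.obsTime (x i)) (x i))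

/-- The second derivative of the negative log-partial likelihood along a line. -/
noncomputable def lineDeriv2 (D : CoxData E p) (x : Fin n → E) (b v : Fin p → ℝ) (u : ℝ) : ℝ :=
  (1 / (n : ℝ)) * ∑ i, D.event (x i) *
    tiltVar (fun j => D.weight (D.obsTime (x i)) b (x j))
      (fun j => v ⬝ᵥ D.cov (D.obsTime (x i)) (x j)) u

theorem hasDerivAt_neg_logPL_line (b v : Fin p → ℝ) (u : ℝ) :
    HasDerivAt (fun u : ℝ => -D.logPL x (b + u • v)) (D.lineDeriv1 x b v u) u := by
  simp_rw [neg_logPL_line]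
  unfold lineDeriv1
  refine HasDerivAt.const_mul _ (HasDerivAt.fun_sum fun i _ => HasDerivAt.const_mul _ ?_)
  refine HasDerivAt.sub (hasDerivAt_log_tiltMass (fun j => weight_nonneg _ _ _)
    (exists_weight_pos x i b) u) ?_
  simpa using ((hasDerivAt_id u).mul_const (v ⬝ᵥ D.cov (D.obsTime (x i)) (x i))).const_add
    (b ⬝ᵥ D.cov (D.obsTime (x i)) (x i))

theorem hasDerivAt_lineDeriv1 (b v : Fin p → ℝ) (u : ℝ) :
    HasDerivAt (D.lineDeriv1 x b v) (D.lineDeriv2 x b v u) u := by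
  unfold lineDeriv1 lineDeriv2
  refine HasDerivAt.const_mul _ (HasDerivAt.fun_sum fun i _ => HasDerivAt.const_mul _ ?_)
  exact (hasDerivAt_tiltMean (fun j => weight_nonneg _ _ _) (exists_weight_pos x i b) u).sub_const _

theorem lineDeriv2_nonneg (b v : Fin p → ℝ) (u : ℝ) : 0 ≤ D.lineDeriv2 x b v u :=
  mul_nonneg (by positivity) (Finset.sum_nonneg fun i _ => mul_nonneg (event_nonneg _)
    (tiltVar_nonneg (fun j => weight_nonneg _ _ _) u))

theorem exp_mul_lineDeriv2_zero_le {K : ℝ}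
    (hK : ∀ i j k, |D.cov (D.obsTime (x i)) (x j) k| ≤ K) (b v : Fin p → ℝ) {u : ℝ} (hu : 0 ≤ u) :
    Real.exp (-(u * (2 * ((∑ j, |v j|) * K)))) * D.lineDeriv2 x b v 0 ≤ D.lineDeriv2 x b v u := by
  rw [lineDeriv2, lineDeriv2, mul_left_comm, Finset.mul_sum]
  refine mul_le_mul_of_nonneg_left (Finset.sum_le_sum fun i _ => ?_) (by positivity)
  rw [mul_left_comm]
  refine mul_le_mul_of_nonneg_left (exp_mul_tiltVar_zero_le (fun j => weight_nonneg _ _ _)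
    (exists_weight_pos x i b) hu fun j k => ?_) (event_nonneg _)
  refine (abs_sub _ _).trans ?_
  rw [two_mul]
  exact add_le_add (abs_dotProduct_le (hK i j)) (abs_dotProduct_le (hK i k))

theorem lineDeriv1_coef_zero (v : Fin p → ℝ) :
    D.lineDeriv1 x D.coef v 0 = -(v ⬝ᵥ D.score x) := by
  have h1 : v ⬝ᵥ D.score x = (1 / (n : ℝ)) * ∑ i, D.event (x i) *
      (v ⬝ᵥ D.cov (D.obsTime (x i)) (x i) - v ⬝ᵥ D.Zbar x (D.obsTime (x i)) D.coef) := by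
    simp only [dotProduct, score, Finset.mul_sum, ← Finset.sum_sub_distrib]
    rw [Finset.sum_comm]
    refine Finset.sum_congr rfl fun i _ => Finset.sum_congr rfl fun k _ => ?_
    ring
  rw [h1, lineDeriv1, ← mul_neg, ← Finset.sum_neg_distrib]
  congr 1
  refine Finset.sum_congr rfl fun i _ => ?_
  rw [← mul_neg, neg_sub]
  congr 2
  simp only [tiltMean, tiltMass, zero_mul, Real.exp_zero, mul_one]
  simp only [dotProduct, Zbar_eq_div, Finset.sum_div, Finset.mul_sum]
  rw [Finset.sum_comm]
  refine Finset.sum_congr rfl fun k _ => Finset.sum_congr rfl fun j _ => ?_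
  ring

theorem contDiff_logPL : ContDiff ℝ 2 (D.logPL x) := by
  unfold logPL
  have hdot : ∀ a : Fin p → ℝ, ContDiff ℝ 2 fun b : Fin p → ℝ => b ⬝ᵥ a := fun a => by
    simp only [dotProduct]
    fun_prop
  refine ContDiff.sub ?_ ?_
  · exact contDiff_const.mul (ContDiff.sum fun i _ => contDiff_const.mul (hdot _))
  · refine contDiff_const.mul (ContDiff.sum fun i _ => contDiff_const.mul (ContDiff.log ?_ ?_))
    · exact ContDiff.sum fun j _ => contDiff_const.mul (hdot _).exp
    · intro b
      obtain ⟨j, hj⟩ := exists_weight_pos (D := D) x i b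
      exact (Finset.sum_pos' (fun j _ => weight_nonneg _ _ _) ⟨j, Finset.mem_univ j, hj⟩).ne'

theorem dotProduct_neg_hessPL_mulVec (b v : Fin p → ℝ) :
    v ⬝ᵥ ((-D.hessPL x b) *ᵥ v) = D.lineDeriv2 x b v 0 := by
  set f := D.logPL x with hf
  have hf2 : ContDiff ℝ 2 f := contDiff_logPL x
  have hd2 : Differentiable ℝ (fderiv ℝ f) :=
    (hf2.fderiv_right (m := 1) (by norm_num)).differentiable (by norm_num)
  have h2 : fderiv ℝ (fderiv ℝ f) b v v = -D.lineDeriv2 x b v 0 := by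
    refine fderiv_fderiv_apply_eq_of_hasDerivAt hf2 (g := fun u => -D.lineDeriv1 x b v u)
      (fun u => ?_) (hasDerivAt_lineDeriv1 x b v 0).fun_neg
    have := (hasDerivAt_neg_logPL_line (D := D) x b v u).fun_neg
    simp only [neg_neg] at this
    exact this
  have h3 : ∀ j k, D.hessPL x b j k =
      fderiv ℝ (fderiv ℝ f) b (Pi.single j 1) (Pi.single k 1) := by
    intro j k
    have e1 := (hd2 b).hasFDerivAt.clm_apply (hasFDerivAt_const (Pi.single k (1 : ℝ)) b)
    change fderiv ℝ (fun c => fderiv ℝ f c (Pi.single k 1)) b (Pi.single j 1) = _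
    rw [e1.fderiv]
    simp
  have hv : v = ∑ j, v j • (Pi.single j (1 : ℝ) : Fin p → ℝ) := by
    ext k
    simp [Finset.sum_apply, Pi.single_apply]
  have h4 : fderiv ℝ (fderiv ℝ f) b v v = ∑ j, ∑ k, v j * (v k * D.hessPL x b j k) := by
    conv_lhs => rw [hv]
    simp only [map_sum, map_smul, sum_apply, smul_apply,
      smul_eq_mul, h3]
    simp only [Finset.mul_sum]
    rw [Finset.sum_comm]
    exact Finset.sum_congr rfl fun j _ => Finset.sum_congr rfl fun k _ => by ring
  rw [← neg_eq_iff_eq_neg.2 h2, h4]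
  simp only [dotProduct, Matrix.mulVec, Matrix.neg_apply, Finset.mul_sum, ← Finset.sum_neg_distrib]
  exact Finset.sum_congr rfl fun j _ => Finset.sum_congr rfl fun k _ => by ring

end

end CoxData

/-! ### The oracle inequality for the Lasso -/

theorem HasDerivAt.nonpos_of_le_left {G : ℝ → ℝ} {G' : ℝ} (h : HasDerivAt G G' 1)
    (hmin : ∀ u ∈ Set.Icc (0 : ℝ) 1, G 1 ≤ G u) : G' ≤ 0 := by
  have h1 : Tendsto (slope G 1) (𝓝[<] 1) (𝓝 G') :=
    (hasDerivAt_iff_tendsto_slope.1 h).mono_left (nhdsWithin_mono _ fun x hx => ne_of_lt hx)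
  refine le_of_tendsto h1 ?_
  filter_upwards [Ioo_mem_nhdsLT (show (0 : ℝ) < 1 by norm_num)] with u hu
  rw [slope_def_field]
  exact div_nonpos_of_nonneg_of_nonpos (sub_nonneg.2 (hmin u ⟨hu.1.le, hu.2.le⟩))
    (by linarith [hu.2])

namespace CoxData

section

variable {E : Type*} {p n : ℕ} {D : CoxData E p} (x : Fin n → E)

theorem lineDeriv1_one_le_of_isLasso {lam : ℝ} (hlam : 0 < lam) {b b₀ : Fin p → ℝ}
    (hb : D.IsLasso x lam b) :
    D.lineDeriv1 x b₀ (b - b₀) 1 ≤ lam * (∑ j, |b₀ j| - ∑ j, |b j|) := by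
  have hder : HasDerivAt (fun u : ℝ => -D.logPL x (b₀ + u • (b - b₀)) +
      lam * (u * ∑ j, |b j| + (1 - u) * ∑ j, |b₀ j|))
      (D.lineDeriv1 x b₀ (b - b₀) 1 + lam * (∑ j, |b j| - ∑ j, |b₀ j|)) 1 := by
    refine (hasDerivAt_neg_logPL_line x b₀ (b - b₀) 1).fun_add (HasDerivAt.const_mul lam ?_)
    have := ((hasDerivAt_id (1 : ℝ)).mul_const (∑ j, |b j|)).add
      (((hasDerivAt_id (1 : ℝ)).const_sub 1).mul_const (∑ j, |b₀ j|))
    refine this.congr_deriv ?_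
    ring
  have := hder.nonpos_of_le_left fun u hu => ?_
  · linarith
  · have h1 : b₀ + (1 : ℝ) • (b - b₀) = b := by rw [one_smul]; abel
    simp only [h1, one_mul, sub_self, zero_mul, add_zero]
    refine (hb (b₀ + u • (b - b₀))).trans (add_le_add_right (mul_le_mul_of_nonneg_left ?_ hlam.le)
      _)
    rw [Finset.mul_sum, Finset.mul_sum, ← Finset.sum_add_distrib]
    refine Finset.sum_le_sum fun j _ => ?_
    have h2 : (b₀ + u • (b - b₀)) j = u * b j + (1 - u) * b₀ j := by
      simp only [Pi.add_apply, Pi.smul_apply, Pi.sub_apply, smul_eq_mul]; ring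
    rw [h2]
    refine (abs_add_le _ _).trans (le_of_eq ?_)
    rw [abs_mul, abs_mul, abs_of_nonneg hu.1, abs_of_nonneg (sub_nonneg.2 hu.2)]

theorem sum_abs_coef_sub_le (b : Fin p → ℝ) :
    ∑ j, |D.coef j| - ∑ j, |b j| ≤
      ∑ j ∈ D.active, |(b - D.coef) j| - ∑ j ∈ D.activeᶜ, |(b - D.coef) j| := by
  rw [← Finset.sum_add_sum_compl D.active, ← Finset.sum_add_sum_compl D.active fun j => |b j|]
  have h1 : ∑ j ∈ D.active, |D.coef j| - ∑ j ∈ D.active, |b j| ≤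
      ∑ j ∈ D.active, |(b - D.coef) j| := by
    rw [← Finset.sum_sub_distrib]
    refine Finset.sum_le_sum fun j _ => ?_
    rw [Pi.sub_apply, abs_sub_comm]
    exact abs_sub_abs_le_abs_sub _ _
  have h0 : ∀ j ∈ D.activeᶜ, D.coef j = 0 := fun j hj => by
    simpa [active] using hj
  have h2 : ∑ j ∈ D.activeᶜ, |D.coef j| = 0 :=
    Finset.sum_eq_zero fun j hj => by rw [h0 j hj, abs_zero]
  have h3 : ∑ j ∈ D.activeᶜ, |(b - D.coef) j| = ∑ j ∈ D.activeᶜ, |b j| :=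
    Finset.sum_congr rfl fun j hj => by rw [Pi.sub_apply, h0 j hj, sub_zero]
  linarith

theorem sq_sum_active_le_of_kappa {M : ℝ} (hM : 0 < M)
    (hk : (D.kappa x)⁻¹ ≤ ENNReal.ofReal M) {v : Fin p → ℝ} (hv : v ≠ 0)
    (hcone : ∑ j ∈ D.activeᶜ, |v j| ≤ 2 * ∑ j ∈ D.active, |v j|)
    (hs : 0 < ∑ j ∈ D.active, |v j|) :
    (∑ j ∈ D.active, |v j|) ^ 2 ≤ M ^ 2 * D.sparsity * D.lineDeriv2 x D.coef v 0 := by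
  set s := ∑ j ∈ D.active, |v j|
  have h1 : D.kappa x ≤ ENNReal.ofReal (√(D.sparsity : ℝ) *
      √(v ⬝ᵥ ((-D.hessPL x D.coef) *ᵥ v)) / s) := iInf₂_le v ⟨hv, hcone⟩
  rw [dotProduct_neg_hessPL_mulVec] at h1
  have h2 : ENNReal.ofReal M⁻¹ ≤ D.kappa x := by
    rw [ENNReal.ofReal_inv_of_pos hM]
    exact ENNReal.inv_le_iff_inv_le.1 hk
  have h3 := h2.trans h1
  have h4 : M⁻¹ ≤ √(D.sparsity : ℝ) * √(D.lineDeriv2 x D.coef v 0) / s := by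
    have hpos : 0 < √(D.sparsity : ℝ) * √(D.lineDeriv2 x D.coef v 0) / s := by
      by_contra hneg
      rw [ENNReal.ofReal_of_nonpos (not_lt.1 hneg)] at h3
      exact absurd h3 (not_le.2 (ENNReal.ofReal_pos.2 (inv_pos.2 hM)))
    exact (ENNReal.ofReal_le_ofReal_iff hpos.le).1 h3
  rw [le_div_iff₀ hs, inv_mul_le_iff₀ hM] at h4
  have h5 := pow_le_pow_left₀ hs.le h4 2
  rw [mul_pow, mul_pow, Real.sq_sqrt (Nat.cast_nonneg _), Real.sq_sqrt (lineDeriv2_nonneg x _ _ _)]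
    at h5
  linarith

theorem sum_abs_lasso_sub_coef_le {K : ℝ} (hK0 : 0 < K)
    (hK : ∀ i j k, |D.cov (D.obsTime (x i)) (x j) k| ≤ K) {lam M : ℝ} (hlam : 0 < lam) (hM : 0 < M)
    {b : Fin p → ℝ} (hb : D.IsLasso x lam b) (hscore : ∀ k, |D.score x k| ≤ lam / 3)
    (hk : (D.kappa x)⁻¹ ≤ ENNReal.ofReal M)
    (hsmall : 4 * lam * D.sparsity * M ^ 2 < 1 / (6 * K)) :
    ∑ j, |b j - D.coef j| ≤ 12 * M ^ 2 * (D.sparsity * lam) := by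
  set v := b - D.coef with hv
  set s := ∑ j ∈ D.active, |v j| with hs
  set r := ∑ j ∈ D.activeᶜ, |v j| with hr
  have hsr : ∑ j, |v j| = s + r := (Finset.sum_add_sum_compl _ _).symm
  have hs0 : 0 ≤ s := Finset.sum_nonneg fun _ _ => abs_nonneg _
  have hr0 : 0 ≤ r := Finset.sum_nonneg fun _ _ => abs_nonneg _
  change ∑ j, |v j| ≤ _
  have h1 : D.lineDeriv1 x D.coef v 1 ≤ lam * (s - r) :=
    (lineDeriv1_one_le_of_isLasso x hlam hb).trans
      (mul_le_mul_of_nonneg_left (sum_abs_coef_sub_le b) hlam.le)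
  have h0 : -(lam / 3 * (s + r)) ≤ D.lineDeriv1 x D.coef v 0 := by
    rw [lineDeriv1_coef_zero, ← hsr, mul_comm]
    exact neg_le_neg ((le_abs_self _).trans (abs_dotProduct_le hscore))
  have hderiv : deriv (D.lineDeriv1 x D.coef v) = D.lineDeriv2 x D.coef v :=
    funext fun u => (hasDerivAt_lineDeriv1 x D.coef v u).deriv
  have hdiff : Differentiable ℝ (D.lineDeriv1 x D.coef v) :=
    fun u => (hasDerivAt_lineDeriv1 x D.coef v u).differentiableAt
  have hmono : Monotone (D.lineDeriv1 x D.coef v) :=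
    monotone_of_deriv_nonneg hdiff fun u => by rw [hderiv]; exact lineDeriv2_nonneg x _ _ _
  have h01 := hmono (zero_le_one (α := ℝ))
  have hcone : r ≤ 2 * s := by
    have : 0 ≤ lam * (4 / 3 * s - 2 / 3 * r) := by nlinarith
    have := nonneg_of_mul_nonneg_right this hlam
    linarith
  rw [hsr]
  rcases hs0.eq_or_lt with hs00 | hspos
  · have : r = 0 := by linarith
    rw [← hs00, this, add_zero]
    positivity
  have hvne : v ≠ 0 := by
    intro h
    rw [hs, h] at hspos
    simp at hspos
  have hkap := sq_sum_active_le_of_kappa x hM hk hvne hcone hspos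
  set u₀ : ℝ := min 1 (1 / (6 * K * s)) with hu₀
  have hu0 : 0 < u₀ := lt_min one_pos (by positivity)
  have hu1 : u₀ ≤ 1 := min_le_left _ _
  have hu2 : u₀ * (6 * K * s) ≤ 1 := by
    have := min_le_right 1 (1 / (6 * K * s))
    rwa [← hu₀, le_div_iff₀ (by positivity)] at this
  have hlow : ∀ u ∈ interior (Set.Icc 0 u₀),
      Real.exp (-1) * D.lineDeriv2 x D.coef v 0 ≤ deriv (D.lineDeriv1 x D.coef v) u := by
    intro u hu
    rw [interior_Icc] at hu
    rw [hderiv]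
    refine le_trans (mul_le_mul_of_nonneg_right (Real.exp_le_exp.2 (neg_le_neg ?_))
      (lineDeriv2_nonneg x _ _ _)) (exp_mul_lineDeriv2_zero_le x hK D.coef v hu.1.le)
    rw [hsr]
    calc u * (2 * ((s + r) * K)) ≤ u₀ * (2 * ((s + 2 * s) * K)) := by
          have := hu.2.le
          gcongr
      _ = u₀ * (6 * K * s) := by ring
      _ ≤ 1 := hu2
  have hmvt := (convex_Icc 0 u₀).mul_sub_le_image_sub_of_le_deriv hdiff.continuous.continuousOn
    hdiff.differentiableOn hlow 0 ⟨le_rfl, hu0.le⟩ u₀ ⟨hu0.le, le_rfl⟩ hu0.le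
  have hu01 := hmono hu1
  set Q := D.lineDeriv2 x D.coef v 0
  have hQ : 0 ≤ Q := lineDeriv2_nonneg x _ _ _
  have h5 : Real.exp (-1) * Q * u₀ ≤ 4 / 3 * lam * s := by nlinarith
  have he : (1 / 3 : ℝ) ≤ Real.exp (-1) := by
    rw [Real.exp_neg, one_div]
    exact inv_anti₀ (Real.exp_pos _) (by linarith [Real.exp_one_lt_d9])
  have h6 : Q * u₀ ≤ 4 * lam * s := by
    have := mul_le_mul_of_nonneg_right he (mul_nonneg hQ hu0.le)
    linarith
  have h7 : s * (u₀ * s) ≤ s * (4 * lam * D.sparsity * M ^ 2) := by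
    have hc : 0 ≤ M ^ 2 * (D.sparsity : ℝ) := by positivity
    have a1 := mul_le_mul_of_nonneg_right hkap hu0.le
    have a2 := mul_le_mul_of_nonneg_left h6 hc
    nlinarith
  have h8 : u₀ * s ≤ 4 * lam * D.sparsity * M ^ 2 := le_of_mul_le_mul_left h7 hspos
  have h9 : u₀ = 1 := by
    by_contra hne
    have h10 : u₀ = 1 / (6 * K * s) := by
      rcases min_choice 1 (1 / (6 * K * s)) with h | h
      · exact absurd h hne
      · exact h
    rw [h10] at h8
    have : 1 / (6 * K * s) * s = 1 / (6 * K) := by field_simp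
    linarith
  rw [h9, one_mul] at h8
  linarith

/-! ### Lipschitz dependence of `Vhat` on the coefficient vector -/

theorem abs_Zbar_le {K : ℝ} (hK0 : 0 ≤ K) {t : ℝ} {k : Fin p} (hK : ∀ j, |D.cov t (x j) k| ≤ K)
    (b : Fin p → ℝ) : |D.Zbar x t b k| ≤ K := by
  set W := ∑ j, D.weight t b (x j) with hW
  have hW0 : 0 ≤ W := Finset.sum_nonneg fun j _ => weight_nonneg _ _ _
  have h1 : ∑ i, D.weight t b (x i) / W ≤ 1 := by
    rw [← Finset.sum_div]
    exact div_self_le_one W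
  calc |D.Zbar x t b k| ≤ ∑ i, K * (D.weight t b (x i) / W) := by
        refine (Finset.abs_sum_le_sum_abs _ _).trans (Finset.sum_le_sum fun i _ => ?_)
        rw [abs_mul, abs_of_nonneg (div_nonneg (weight_nonneg _ _ _) hW0)]
        exact mul_le_mul_of_nonneg_right (hK i) (div_nonneg (weight_nonneg _ _ _) hW0)
    _ = K * ∑ i, D.weight t b (x i) / W := (Finset.mul_sum _ _ _).symm
    _ ≤ K := mul_le_of_le_one_right hK0 h1

theorem abs_Zbar_sub_le {K : ℝ} (hK0 : 0 ≤ K) {t : ℝ} (hK : ∀ j k, |D.cov t (x j) k| ≤ K)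
    (hpos : ∃ j, t ≤ D.obsTime (x j)) (b b' : Fin p → ℝ) (k : Fin p) :
    |D.Zbar x t b k - D.Zbar x t b' k| ≤ 4 * K ^ 2 * ∑ j, |b j - b' j| := by
  set η := 2 * ((∑ j, |b j - b' j|) * K) with hη
  have hη0 : 0 ≤ η := by positivity
  rcases lt_or_ge 1 η with hη1 | hη1
  · have h1 := abs_Zbar_le x hK0 (fun j => hK j k) b
    have h2 := abs_Zbar_le x hK0 (fun j => hK j k) b'
    have h3 := (abs_sub (D.Zbar x t b k) (D.Zbar x t b' k)).trans (add_le_add h1 h2)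
    nlinarith
  set w := fun j => D.weight t b (x j)
  set w' := fun j => D.weight t b' (x j)
  have hposw : ∀ c : Fin p → ℝ, 0 < ∑ j, D.weight t c (x j) := fun c => by
    obtain ⟨j, hj⟩ := hpos
    refine Finset.sum_pos' (fun j _ => weight_nonneg _ _ _) ⟨j, Finset.mem_univ j, ?_⟩
    simp only [weight, atRisk, if_pos hj, one_mul]
    exact Real.exp_pos _
  have hW := hposw b
  have hW' := hposw b'
  have hw0 : ∀ j, 0 ≤ w j := fun j => weight_nonneg _ _ _
  have hw0' : ∀ j, 0 ≤ w' j := fun j => weight_nonneg _ _ _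
  -- comparison of the normalised weights
  have hratio : ∀ (c c' : Fin p → ℝ), (∑ j, |c j - c' j|) = ∑ j, |b j - b' j| → ∀ j k,
      D.weight t c (x j) * D.weight t c' (x k) ≤
        Real.exp η * (D.weight t c' (x j) * D.weight t c (x k)) := by
    intro c c' hcc j k
    simp only [weight, atRisk]
    have h1 : ∀ l, |(c - c') ⬝ᵥ D.cov t (x l)| ≤ (∑ j, |b j - b' j|) * K := fun l => by
      rw [← hcc]; exact abs_dotProduct_le (a := c - c') (hK l)
    have h2 : Real.exp (c ⬝ᵥ D.cov t (x j)) * Real.exp (c' ⬝ᵥ D.cov t (x k)) ≤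
        Real.exp η * (Real.exp (c' ⬝ᵥ D.cov t (x j)) * Real.exp (c ⬝ᵥ D.cov t (x k))) := by
      rw [← Real.exp_add, ← Real.exp_add, ← Real.exp_add]
      refine Real.exp_le_exp.2 ?_
      have a1 := (abs_le.1 (h1 j)).2
      have a2 := (abs_le.1 (h1 k)).1
      rw [sub_dotProduct] at a1 a2
      linarith
    split_ifs
    · simpa using h2
    · simp
    · simp
    · simp
  have hnorm : ∀ j, |w j / ∑ j, w j - w' j / ∑ j, w' j| ≤ (Real.exp η - 1) * (w' j / ∑ j, w' j) :=
    by
    intro j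
    have a1 : w j * ∑ k, w' k ≤ Real.exp η * (w' j * ∑ k, w k) := by
      rw [Finset.mul_sum, Finset.mul_sum, Finset.mul_sum]
      exact Finset.sum_le_sum fun k _ => hratio b b' rfl j k
    have a2 : w' j * ∑ k, w k ≤ Real.exp η * (w j * ∑ k, w' k) := by
      rw [Finset.mul_sum, Finset.mul_sum, Finset.mul_sum]
      exact Finset.sum_le_sum fun k _ => hratio b' b
        (Finset.sum_congr rfl fun j _ => abs_sub_comm _ _) j k
    have a3 : w j / ∑ j, w j ≤ Real.exp η * (w' j / ∑ j, w' j) := by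
      rw [← mul_div_assoc, div_le_div_iff₀ hW hW', mul_assoc]
      exact a1
    have a4 : w' j / ∑ j, w' j ≤ Real.exp η * (w j / ∑ j, w j) := by
      rw [← mul_div_assoc, div_le_div_iff₀ hW' hW, mul_assoc]
      exact a2
    set q := w j / ∑ j, w j
    set q' := w' j / ∑ j, w' j
    have hq' : 0 ≤ q' := div_nonneg (hw0' j) hW'.le
    rw [abs_le]
    constructor
    · have a5 : Real.exp (-η) * q' ≤ q := by
        have := mul_le_mul_of_nonneg_left a4 (Real.exp_pos (-η)).le
        rwa [← mul_assoc, ← Real.exp_add, neg_add_cancel, Real.exp_zero, one_mul] at this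
      have a6 : 2 - Real.exp η ≤ Real.exp (-η) := by
        have := Real.add_one_le_exp (-η)
        have h1 : Real.exp (-η) * Real.exp η = 1 := by rw [← Real.exp_add]; simp
        nlinarith [Real.exp_pos η, Real.exp_pos (-η), sq_nonneg (Real.exp η - 1)]
      nlinarith
    · linarith
  have hexp : Real.exp η - 1 ≤ 2 * η := by
    have := (abs_le.1 (Real.abs_exp_sub_one_sub_id_le (show |η| ≤ 1 by rwa [abs_of_nonneg hη0]))).2
    nlinarith
  have hsum : ∑ j, w' j / ∑ j, w' j = 1 := by
    rw [← Finset.sum_div]; exact div_self hW'.ne'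
  calc |D.Zbar x t b k - D.Zbar x t b' k|
      = |∑ j, D.cov t (x j) k * (w j / ∑ j, w j - w' j / ∑ j, w' j)| := by
        simp only [Zbar, ← Finset.sum_sub_distrib, ← mul_sub]
        rfl
    _ ≤ ∑ j, K * ((Real.exp η - 1) * (w' j / ∑ j, w' j)) := by
        refine (Finset.abs_sum_le_sum_abs _ _).trans (Finset.sum_le_sum fun j _ => ?_)
        rw [abs_mul]
        exact mul_le_mul (hK j k) (hnorm j) (abs_nonneg _) hK0
    _ = K * (Real.exp η - 1) := by
        rw [← Finset.mul_sum, ← Finset.mul_sum, hsum, mul_one]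
    _ ≤ K * (2 * η) := mul_le_mul_of_nonneg_left hexp hK0
    _ = _ := by rw [hη]; ring

theorem abs_mul_sub_mul_le {K z₁ z₂ a₁ a₂ b₁ b₂ δ : ℝ} (hz₁ : |z₁| ≤ K)
    (hz₂ : |z₂| ≤ K) (ha₂ : |a₂| ≤ K) (hb₁ : |b₁| ≤ K)
    (h₁ : |a₁ - b₁| ≤ δ) (h₂ : |a₂ - b₂| ≤ δ) :
    |(z₁ - a₁) * (z₂ - a₂) - (z₁ - b₁) * (z₂ - b₂)| ≤ 4 * K * δ := by
  have e : (z₁ - a₁) * (z₂ - a₂) - (z₁ - b₁) * (z₂ - b₂) =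
      -((a₁ - b₁) * (z₂ - a₂) + (z₁ - b₁) * (a₂ - b₂)) := by ring
  have hK := (abs_nonneg _).trans hz₁
  have hδ := (abs_nonneg _).trans h₁
  rw [e, abs_neg]
  refine (abs_add_le _ _).trans ?_
  rw [abs_mul, abs_mul]
  have g1 : |z₂ - a₂| ≤ 2 * K := (abs_sub _ _).trans (by linarith)
  have g2 : |z₁ - b₁| ≤ 2 * K := (abs_sub _ _).trans (by linarith)
  have g3 := mul_le_mul h₁ g1 (abs_nonneg _) hδ
  have g4 := mul_le_mul g2 h₂ (abs_nonneg _) (by linarith)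
  linarith

theorem abs_Vhat_sub_le {K : ℝ} (hK0 : 0 ≤ K)
    (hK : ∀ i j k, |D.cov (D.obsTime (x i)) (x j) k| ≤ K) (b b' : Fin p → ℝ) (j k : Fin p) :
    |D.Vhat x b j k - D.Vhat x b' j k| ≤ 16 * K ^ 3 * ∑ l, |b l - b' l| := by
  rcases Nat.eq_zero_or_pos n with rfl | hn
  · simp only [Vhat, Matrix.of_apply, Finset.univ_eq_empty, Finset.sum_empty, sub_self, abs_zero]
    positivity
  have hn' : (0 : ℝ) < n := by exact_mod_cast hn
  simp only [Vhat, Matrix.of_apply, ← mul_sub, ← Finset.sum_sub_distrib]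
  rw [abs_mul, abs_of_nonneg (by positivity), one_div, inv_mul_le_iff₀ hn']
  refine (Finset.abs_sum_le_sum_abs _ _).trans ?_
  have : (n : ℝ) * (16 * K ^ 3 * ∑ l, |b l - b' l|) =
      ∑ _i : Fin n, 16 * K ^ 3 * ∑ l, |b l - b' l| := by simp
  rw [this]
  refine Finset.sum_le_sum fun i _ => ?_
  rw [abs_mul, abs_of_nonneg (event_nonneg _)]
  refine (mul_le_of_le_one_left (abs_nonneg _) (event_le_one _)).trans ?_
  refine (abs_mul_sub_mul_le (hK i i j) (hK i i k) (abs_Zbar_le x hK0 (fun l => hK i l k) b)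
    (abs_Zbar_le x hK0 (fun l => hK i l j) b')
    (abs_Zbar_sub_le x hK0 (hK i) ⟨i, le_rfl⟩ b b' j)
    (abs_Zbar_sub_le x hK0 (hK i) ⟨i, le_rfl⟩ b b' k)).trans (le_of_eq ?_)
  ring

end

end CoxData

/-! ### A maximal inequality for sums of independent copies -/

theorem lintegral_exp_le {E : Type*} [MeasurableSpace E] {μ : Measure E} [IsProbabilityMeasure μ]
    {X : E → ℝ} (hX : Measurable X) {C V s : ℝ} (hC : ∀ᵐ e ∂μ, |X e| ≤ C)
    (h0 : ∫ e, X e ∂μ = 0) (hV : ∫ e, X e ^ 2 ∂μ ≤ V) (hs : |s| * C ≤ 1) :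
    ∫⁻ e, ENNReal.ofReal (Real.exp (s * X e)) ∂μ ≤ ENNReal.ofReal (Real.exp (s ^ 2 * V)) := by
  have hi : Integrable X μ := Integrable.of_bound hX.aestronglyMeasurable C hC
  have hi2 : Integrable (fun e => X e ^ 2) μ := by
    refine Integrable.of_bound (hX.pow_const 2).aestronglyMeasurable (C ^ 2) ?_
    filter_upwards [hC] with e he
    rw [norm_pow]
    exact pow_le_pow_left₀ (norm_nonneg _) he 2
  have hle : ∀ᵐ e ∂μ, Real.exp (s * X e) ≤ 1 + s * X e + s ^ 2 * X e ^ 2 := by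
    filter_upwards [hC] with e he
    have h1 : |s * X e| ≤ 1 := by
      rw [abs_mul]
      exact (mul_le_mul_of_nonneg_left he (abs_nonneg s)).trans hs
    have := (abs_le.1 (Real.abs_exp_sub_one_sub_id_le h1)).2
    nlinarith
  have hi1 : Integrable (fun e => 1 + s * X e) μ := (integrable_const 1).add (hi.const_mul s)
  have hint : Integrable (fun e => 1 + s * X e + s ^ 2 * X e ^ 2) μ :=
    hi1.add (hi2.const_mul _)
  calc ∫⁻ e, ENNReal.ofReal (Real.exp (s * X e)) ∂μ
      ≤ ∫⁻ e, ENNReal.ofReal (1 + s * X e + s ^ 2 * X e ^ 2) ∂μ :=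
        lintegral_mono_ae (hle.mono fun e he => ENNReal.ofReal_le_ofReal he)
    _ = ENNReal.ofReal (∫ e, (1 + s * X e + s ^ 2 * X e ^ 2) ∂μ) :=
        (ofReal_integral_eq_lintegral_ofReal hint
          (hle.mono fun e he => (Real.exp_pos _).le.trans he)).symm
    _ ≤ _ := by
        refine ENNReal.ofReal_le_ofReal ?_
        rw [integral_add hi1 (hi2.const_mul _),
          integral_add (integrable_const 1) (hi.const_mul s), integral_const_mul,
          integral_const_mul, h0]
        simp only [integral_const, probReal_univ, smul_eq_mul, mul_one, mul_zero, add_zero]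
        have := mul_le_mul_of_nonneg_left hV (sq_nonneg s)
        linarith [Real.add_one_le_exp (s ^ 2 * V)]

theorem lintegral_exp_sum_le {E : Type*} [MeasurableSpace E] {μ : Measure E}
    [IsProbabilityMeasure μ] {X : E → ℝ} (hX : Measurable X) {C V s : ℝ}
    (hC : ∀ᵐ e ∂μ, |X e| ≤ C) (h0 : ∫ e, X e ∂μ = 0) (hV : ∫ e, X e ^ 2 ∂μ ≤ V)
    (hs : |s| * C ≤ 1) (m : ℕ) :
    ∫⁻ y, ENNReal.ofReal (Real.exp (s * ∑ j, X (y j))) ∂Measure.pi (fun _ : Fin m => μ) ≤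
      ENNReal.ofReal (Real.exp (m * (s ^ 2 * V))) := by
  have hg : Measurable fun e => ENNReal.ofReal (Real.exp (s * X e)) := by fun_prop
  have hind : iIndepFun (fun (j : Fin m) (y : Fin m → E) => ENNReal.ofReal (Real.exp (s * X (y j))))
      (Measure.pi fun _ : Fin m => μ) :=
    iIndepFun_pi (X := fun _ e => ENNReal.ofReal (Real.exp (s * X e))) fun _ => hg.aemeasurable
  calc ∫⁻ y, ENNReal.ofReal (Real.exp (s * ∑ j, X (y j))) ∂Measure.pi (fun _ : Fin m => μ)
      = ∫⁻ y, ∏ j, ENNReal.ofReal (Real.exp (s * X (y j))) ∂Measure.pi (fun _ : Fin m => μ) := by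
        refine lintegral_congr fun y => ?_
        rw [Finset.mul_sum, Real.exp_sum,
          ENNReal.ofReal_prod_of_nonneg fun j _ => (Real.exp_pos _).le]
    _ = ∏ j : Fin m, ∫⁻ y, ENNReal.ofReal (Real.exp (s * X (y j)))
          ∂Measure.pi (fun _ : Fin m => μ) :=
        lintegral_prod_eq_prod_lintegral_of_indepFun _ _ hind fun j =>
          hg.comp (measurable_pi_apply j)
    _ = ∏ _j : Fin m, ∫⁻ e, ENNReal.ofReal (Real.exp (s * X e)) ∂μ :=
        Finset.prod_congr rfl fun j _ =>
          (measurePreserving_eval (fun _ : Fin m => μ) j).lintegral_comp hg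
    _ ≤ ∏ _j : Fin m, ENNReal.ofReal (Real.exp (s ^ 2 * V)) :=
        Finset.prod_le_prod' fun j _ => lintegral_exp_le hX hC h0 hV hs
    _ = _ := by
        rw [Finset.prod_const, Finset.card_univ, Fintype.card_fin,
          ← ENNReal.ofReal_pow (Real.exp_pos _).le, Real.exp_nat_mul]

theorem mul_iSup_abs_le {κ : Type*} [Fintype κ] {s : ℝ} (hs : 0 < s) (S : κ → ℝ) (a : ℝ)
    (ha : 0 ≤ a) :
    ENNReal.ofReal s * ⨆ k, ENNReal.ofReal |S k| ≤ ENNReal.ofReal a +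
      ∑ k, ENNReal.ofReal (Real.exp (-a)) *
        (ENNReal.ofReal (Real.exp (s * S k)) + ENNReal.ofReal (Real.exp (-s * S k))) := by
  rw [ENNReal.mul_iSup]
  refine iSup_le fun k => ?_
  have h1 : s * |S k| ≤ a + Real.exp (-a) * (Real.exp (s * S k) + Real.exp (-s * S k)) := by
    rw [mul_add, ← Real.exp_add, ← Real.exp_add]
    have h2 := Real.exp_pos (-a + s * S k)
    have h3 := Real.exp_pos (-a + -s * S k)
    rcases abs_cases (S k) with ⟨h, _⟩ | ⟨h, _⟩ <;> rw [h]
    · linarith [Real.add_one_le_exp (-a + s * S k)]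
    · linarith [Real.add_one_le_exp (-a + -s * S k)]
  rw [← ENNReal.ofReal_mul hs.le]
  refine (ENNReal.ofReal_le_ofReal h1).trans ?_
  have hp := (Real.exp_pos (-a)).le
  rw [ENNReal.ofReal_add ha (by positivity), ENNReal.ofReal_mul hp,
    ENNReal.ofReal_add (Real.exp_pos _).le (Real.exp_pos _).le]
  gcongr
  exact Finset.single_le_sum (f := fun k => ENNReal.ofReal (Real.exp (-a)) *
    (ENNReal.ofReal (Real.exp (s * S k)) + ENNReal.ofReal (Real.exp (-s * S k))))
    (fun _ _ => zero_le) (Finset.mem_univ k)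

theorem lintegral_iSup_abs_sum_le {E : Type*} [MeasurableSpace E] {μ : Measure E}
    [IsProbabilityMeasure μ] {κ : Type*} [Fintype κ] [Nonempty κ] {X : κ → E → ℝ}
    (hX : ∀ k, Measurable (X k)) {C V s : ℝ} (hC : ∀ k, ∀ᵐ e ∂μ, |X k e| ≤ C)
    (h0 : ∀ k, ∫ e, X k e ∂μ = 0) (hV0 : 0 ≤ V) (hV : ∀ k, ∫ e, X k e ^ 2 ∂μ ≤ V) (hs0 : 0 < s)
    (hs : s * C ≤ 1) (m : ℕ) :
    ∫⁻ y, ⨆ k, ENNReal.ofReal |∑ j, X k (y j)| ∂Measure.pi (fun _ : Fin m => μ) ≤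
      ENNReal.ofReal ((Real.log (2 * Fintype.card κ) + m * (s ^ 2 * V) + 1) / s) := by
  set q : ℝ := (Fintype.card κ : ℝ) with hq
  have hq1 : (1 : ℝ) ≤ q := by
    rw [hq]
    exact_mod_cast Fintype.card_pos
  have hL : 0 ≤ Real.log (2 * q) := Real.log_nonneg (by linarith)
  have hVm : 0 ≤ m * (s ^ 2 * V) := by positivity
  set a : ℝ := Real.log (2 * q) + m * (s ^ 2 * V) with ha
  have ha0 : 0 ≤ a := by positivity
  have hbound : ENNReal.ofReal s *
      ∫⁻ y, ⨆ k, ENNReal.ofReal |∑ j, X k (y j)| ∂Measure.pi (fun _ : Fin m => μ) ≤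
      ENNReal.ofReal (a + 1) := by
    rw [← lintegral_const_mul' _ _ ENNReal.ofReal_ne_top]
    have hpt : ∀ y : Fin m → E, ENNReal.ofReal s * (⨆ k, ENNReal.ofReal |∑ j, X k (y j)|) ≤
        ENNReal.ofReal a + ∑ k, ENNReal.ofReal (Real.exp (-a)) *
          (ENNReal.ofReal (Real.exp (s * ∑ j, X k (y j))) +
            ENNReal.ofReal (Real.exp (-s * ∑ j, X k (y j)))) := fun y =>
      mul_iSup_abs_le hs0 (fun k => ∑ j, X k (y j)) a ha0
    refine le_trans (lintegral_mono hpt) ?_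
    have hm : ∀ (r : ℝ) k, Measurable fun y : Fin m → E =>
        ENNReal.ofReal (Real.exp (r * ∑ j, X k (y j))) := fun r k =>
      (((Finset.measurable_fun_sum _ fun j _ =>
        (hX k).comp (measurable_pi_apply j)).const_mul r).exp).ennreal_ofReal
    have hmk' : ∀ k, Measurable fun y : Fin m → E =>
        ENNReal.ofReal (Real.exp (s * ∑ j, X k (y j))) +
          ENNReal.ofReal (Real.exp (-s * ∑ j, X k (y j))) := fun k => (hm s k).add (hm (-s) k)
    have hmk : ∀ k, Measurable fun y : Fin m → E => ENNReal.ofReal (Real.exp (-a)) *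
        (ENNReal.ofReal (Real.exp (s * ∑ j, X k (y j))) +
          ENNReal.ofReal (Real.exp (-s * ∑ j, X k (y j)))) := fun k => (hmk' k).const_mul _
    have hk : ∀ k, ∫⁻ y, ENNReal.ofReal (Real.exp (-a)) *
        (ENNReal.ofReal (Real.exp (s * ∑ j, X k (y j))) +
          ENNReal.ofReal (Real.exp (-s * ∑ j, X k (y j)))) ∂Measure.pi (fun _ : Fin m => μ) ≤
        ENNReal.ofReal (1 / q) := by
      intro k
      rw [lintegral_const_mul _ (hmk' k), lintegral_add_left (hm s k)]
      have e1 := lintegral_exp_sum_le (hX k) (hC k) (h0 k) (hV k)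
        (s := s) (by rwa [abs_of_pos hs0]) m
      have e2 := lintegral_exp_sum_le (hX k) (hC k) (h0 k) (hV k)
        (s := -s) (by rwa [abs_neg, abs_of_pos hs0]) m
      rw [neg_sq] at e2
      refine (mul_le_mul_right (add_le_add e1 e2) _).trans (le_of_eq ?_)
      rw [← ENNReal.ofReal_add (Real.exp_pos _).le (Real.exp_pos _).le,
        ← ENNReal.ofReal_mul (Real.exp_pos _).le]
      congr 1
      rw [← two_mul, mul_left_comm, ← Real.exp_add, ha]
      have : -(Real.log (2 * q) + m * (s ^ 2 * V)) + m * (s ^ 2 * V) = -Real.log (2 * q) := by ring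
      rw [this, Real.exp_neg, Real.exp_log (by linarith)]
      field_simp
    rw [lintegral_add_left measurable_const, lintegral_const, measure_univ, mul_one,
      ENNReal.ofReal_add ha0 zero_le_one]
    refine add_le_add le_rfl ?_
    rw [lintegral_finsetSum _ fun k _ => hmk k]
    refine (Finset.sum_le_sum fun k _ => hk k).trans (le_of_eq ?_)
    rw [Finset.sum_const, Finset.card_univ, nsmul_eq_mul, ← ENNReal.ofReal_natCast, ← hq,
      ← ENNReal.ofReal_mul (by linarith)]
    congr 1
    field_simp
  have hs' : ENNReal.ofReal s ≠ 0 := by simpa using hs0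
  rw [ENNReal.ofReal_div_of_pos hs0, ENNReal.le_div_iff_mul_le (Or.inl hs')
    (Or.inl ENNReal.ofReal_ne_top), mul_comm]
  exact hbound

theorem lintegral_iSup_abs_sum_le_sqrt {E : Type*} [MeasurableSpace E] {μ : Measure E}
    [IsProbabilityMeasure μ] {κ : Type*} [Fintype κ] [Nonempty κ] {X : κ → E → ℝ}
    (hX : ∀ k, Measurable (X k)) {C v : ℝ} (hC0 : 0 < C) (hC : ∀ k, ∀ᵐ e ∂μ, |X k e| ≤ C)
    (h0 : ∀ k, ∫ e, X k e ∂μ = 0) (hv : 0 < v) (hV : ∀ k, ∫ e, X k e ^ 2 ∂μ ≤ C ^ 2 * v) {m : ℕ}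
    (hm : Real.log (2 * Fintype.card κ) ≤ m * v) :
    ∫⁻ y, ⨆ k, ENNReal.ofReal |∑ j, X k (y j)| ∂Measure.pi (fun _ : Fin m => μ) ≤
      ENNReal.ofReal (4 * C * √(m * v * Real.log (2 * Fintype.card κ))) := by
  set L := Real.log (2 * Fintype.card κ) with hL
  have hq1 : (1 : ℝ) ≤ Fintype.card κ := by exact_mod_cast Fintype.card_pos (α := κ)
  have hL1 : 1 / 2 < L := by
    have := Real.log_le_log two_pos (by linarith : (2 : ℝ) ≤ 2 * Fintype.card κ)
    linarith [Real.log_two_gt_d9]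
  have hL0 : 0 < L := by linarith
  have hmv : 0 < m * v := hL0.trans_le hm
  set w := √(m * v) with hw
  set l := √L with hl
  have hw0 : 0 < w := Real.sqrt_pos.2 hmv
  have hl0 : 0 < l := Real.sqrt_pos.2 hL0
  have hw2 : w ^ 2 = m * v := Real.sq_sqrt hmv.le
  have hl2 : l ^ 2 = L := Real.sq_sqrt hL0.le
  have hlw : l ≤ w := Real.sqrt_le_sqrt hm
  have hs : l / (w * C) * C ≤ 1 := by
    rw [div_mul_eq_mul_div, div_le_one (by positivity)]
    exact mul_le_mul_of_nonneg_right hlw hC0.le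
  refine (lintegral_iSup_abs_sum_le hX hC h0 (by positivity) hV (s := l / (w * C))
    (by positivity) hs m).trans (ENNReal.ofReal_le_ofReal ?_)
  rw [Real.sqrt_mul hmv.le, ← hw, ← hl, ← hL, div_le_iff₀ (by positivity)]
  have e1 : (m : ℝ) * ((l / (w * C)) ^ 2 * (C ^ 2 * v)) = l ^ 2 := by
    have hmv' : (m : ℝ) * v ≠ 0 := hmv.ne'
    rw [div_pow, mul_pow, hw2, div_mul_eq_mul_div, mul_div_assoc', div_eq_iff (by positivity)]
    ring
  have e2 : 4 * C * (w * l) * (l / (w * C)) = 4 * l ^ 2 := by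
    field_simp
  rw [e1, e2, hl2]
  linarith

/-! ### The sample weighted mean against the population weighted mean -/

namespace CoxData

section

variable {E : Type*} {p : ℕ} {D : CoxData E p}

theorem atRisk_nonneg (t : ℝ) (e : E) : 0 ≤ D.atRisk t e := by
  unfold atRisk; split_ifs <;> norm_num

theorem atRisk_le_one (t : ℝ) (e : E) : D.atRisk t e ≤ 1 := by
  unfold atRisk; split_ifs <;> norm_num

theorem atRisk_sq (t : ℝ) (e : E) : D.atRisk t e ^ 2 = D.atRisk t e := by
  unfold atRisk; split_ifs <;> norm_num

theorem abs_dotProduct_coef_le {K B : ℝ} (hK0 : 0 ≤ K) (hB : ∑ j, |D.coef j| ≤ B) {t : ℝ} {e : E}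
    (hK : ∀ j, |D.cov t e j| ≤ K) : |D.coef ⬝ᵥ D.cov t e| ≤ B * K :=
  (abs_dotProduct_le hK).trans (mul_le_mul_of_nonneg_right hB hK0)

theorem weight_le {K B : ℝ} (hK0 : 0 ≤ K) (hB : ∑ j, |D.coef j| ≤ B) {t : ℝ} {e : E}
    (hK : ∀ j, |D.cov t e j| ≤ K) :
    D.weight t D.coef e ≤ Real.exp (B * K) * D.atRisk t e := by
  rw [weight, mul_comm]
  exact mul_le_mul_of_nonneg_right (Real.exp_le_exp.2
    ((le_abs_self _).trans (abs_dotProduct_coef_le hK0 hB hK))) (atRisk_nonneg _ _)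

theorem atRisk_le {K B : ℝ} (hK0 : 0 ≤ K) (hB : ∑ j, |D.coef j| ≤ B) {t : ℝ} {e : E}
    (hK : ∀ j, |D.cov t e j| ≤ K) :
    D.atRisk t e ≤ Real.exp (B * K) * D.weight t D.coef e := by
  rw [weight, mul_left_comm, ← Real.exp_add]
  refine le_mul_of_one_le_right (atRisk_nonneg _ _) (Real.one_le_exp ?_)
  linarith [neg_abs_le (D.coef ⬝ᵥ D.cov t e), abs_dotProduct_coef_le hK0 hB hK]

end

variable {E : Type*} [MeasurableSpace E] {p : ℕ} {D : CoxData E p} {μ : Measure E}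

theorem IsCoxModel.measurable_cov_apply (h : D.IsCoxModel μ) (j : Fin p) :
    Measurable fun a : ℝ × E => D.cov a.1 a.2 j :=
  (measurable_pi_apply j).comp h.measurable_cov

theorem IsCoxModel.measurable_atRisk (h : D.IsCoxModel μ) :
    Measurable fun a : ℝ × E => D.atRisk a.1 a.2 :=
  Measurable.ite (measurableSet_le measurable_fst (h.measurable_obsTime.comp measurable_snd))
    measurable_const measurable_const

theorem IsCoxModel.measurable_weight (h : D.IsCoxModel μ) (b : Fin p → ℝ) :
    Measurable fun a : ℝ × E => D.weight a.1 b a.2 := by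
  refine h.measurable_atRisk.mul (Measurable.exp ?_)
  simp only [dotProduct]
  exact Finset.measurable_fun_sum _ fun j _ => (h.measurable_cov_apply j).const_mul _

theorem IsCoxModel.measurable_popMean [IsProbabilityMeasure μ] (h : D.IsCoxModel μ)
    (b : Fin p → ℝ) (j : Fin p) : Measurable fun t => D.popMean μ t b j := by
  have h1 : Measurable fun a : ℝ × E => D.cov a.1 a.2 j * D.weight a.1 b a.2 :=
    (h.measurable_cov_apply j).mul (h.measurable_weight b)
  exact (h1.stronglyMeasurable.integral_prod_right').measurable.div
    ((h.measurable_weight b).stronglyMeasurable.integral_prod_right').measurable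

/-- The probability of being at risk at time `t`. -/
noncomputable def riskProb (D : CoxData E p) (μ : Measure E) (t : ℝ) : ℝ :=
  μ.real {e | t ≤ D.obsTime e}

theorem integral_atRisk (h : D.IsCoxModel μ) (t : ℝ) :
    ∫ e, D.atRisk t e ∂μ = D.riskProb μ t := by
  have : (fun e => D.atRisk t e) = {e | t ≤ D.obsTime e}.indicator 1 := by
    funext e
    simp [atRisk, Set.indicator_apply]
  rw [this, integral_indicator_one (measurableSet_le measurable_const h.measurable_obsTime)]
  rfl

theorem integrable_atRisk [IsProbabilityMeasure μ] (h : D.IsCoxModel μ) (t : ℝ) :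
    Integrable (D.atRisk t) μ :=
  Integrable.of_bound (h.measurable_atRisk.comp measurable_prodMk_left).aestronglyMeasurable 1
    (Eventually.of_forall fun e => by
      rw [Real.norm_of_nonneg (atRisk_nonneg _ _)]; exact atRisk_le_one _ _)

theorem riskProb_le_one [IsProbabilityMeasure μ] (t : ℝ) : D.riskProb μ t ≤ 1 := measureReal_le_one

theorem antitone_riskProb [IsProbabilityMeasure μ] : Antitone (D.riskProb μ) := fun _ _ hst =>
  measureReal_mono fun _ he => le_trans hst he

theorem riskProb_pos [IsProbabilityMeasure μ] (h : D.IsCoxModel μ) {t : ℝ}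
    (ht : t ∈ timesBelow (D.tPlus μ)) : 0 < D.riskProb μ t := by
  refine lt_of_le_of_ne measureReal_nonneg fun h0 => ?_
  have h1 : μ {e | t ≤ D.obsTime e} = 0 := (measureReal_eq_zero_iff).1 h0.symm
  have h2 : μ {e | D.obsTime e ≤ t} = 1 := by
    rw [← prob_compl_eq_zero_iff (measurableSet_le h.measurable_obsTime measurable_const)]
    refine measure_mono_null (fun e he => ?_) h1
    exact (not_le.1 (show ¬D.obsTime e ≤ t from he)).le
  exact absurd ht.2 (not_lt.2 (sInf_le ⟨t, ⟨ht.1, h2⟩, rfl⟩))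

theorem measure_riskProb_obsTime_le [IsProbabilityMeasure μ] (h : D.IsCoxModel μ)
    (hd : D.HasBoundedDensity μ) (u : ℝ) :
    μ {e | D.riskProb μ (D.obsTime e) ≤ u} ≤ ENNReal.ofReal u := by
  set S : Set ℝ := {t | D.riskProb μ t ≤ u} with hS
  have hSu : ∀ t ∈ S, μ {e | t ≤ D.obsTime e} ≤ ENNReal.ofReal u := fun t ht =>
    (ENNReal.le_ofReal_iff_toReal_le (measure_ne_top _ _) (measureReal_nonneg.trans ht)).2 ht
  rcases S.eq_empty_or_nonempty with he | hne
  · have : {e | D.riskProb μ (D.obsTime e) ≤ u} = ∅ := by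
      refine Set.eq_empty_of_forall_notMem fun e h1 => ?_
      have : D.obsTime e ∈ S := h1
      rw [he] at this
      exact this
    simp [this]
  by_cases hbdd : BddBelow S
  · obtain ⟨s, hs1, hs2, hs3⟩ := exists_seq_tendsto_sInf hne hbdd
    have hsub : {e | D.riskProb μ (D.obsTime e) ≤ u} ⊆
        {e | D.obsTime e = sInf S} ∪ ⋃ k, {e | s k ≤ D.obsTime e} := by
      intro e h1
      rcases (csInf_le hbdd (show D.obsTime e ∈ S from h1)).eq_or_lt with h2 | h2
      · exact Or.inl h2.symm
      · obtain ⟨k, hk⟩ := (hs2.eventually_lt_const h2).exists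
        exact Or.inr (Set.mem_iUnion.2 ⟨k, hk.le⟩)
    refine (measure_mono hsub).trans ((measure_union_le _ _).trans ?_)
    rw [measure_obsTime_eq h hd, zero_add, Monotone.measure_iUnion]
    · exact iSup_le fun k => hSu _ (hs3 k)
    · exact fun k l hkl e he => le_trans (hs1 hkl) he
  · rw [not_bddBelow_iff] at hbdd
    obtain ⟨t, ht, ht0⟩ := hbdd 0
    refine le_trans (measure_mono fun e _ => ?_) (hSu t ht)
    exact ht0.le.trans (h.obsTime_nonneg e)

theorem lintegral_inv_sqrt_riskProb_le [IsProbabilityMeasure μ] (h : D.IsCoxModel μ)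
    (hd : D.HasBoundedDensity μ) :
    ∫⁻ e, ENNReal.ofReal (1 / √(D.riskProb μ (D.obsTime e))) ∂μ ≤ 2 := by
  have hm : Measurable fun e => 1 / √(D.riskProb μ (D.obsTime e)) :=
    ((antitone_riskProb.measurable.comp h.measurable_obsTime).sqrt).const_div 1
  rw [lintegral_eq_lintegral_meas_lt μ (Eventually.of_forall fun e => by positivity)
    hm.aemeasurable,
    ← Set.Ioc_union_Ioi_eq_Ioi zero_le_one]
  refine (lintegral_union_le _ _ _).trans ?_
  have h1 : ∫⁻ s in Set.Ioc (0 : ℝ) 1, μ {e | s < 1 / √(D.riskProb μ (D.obsTime e))} ≤ 1 := by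
    refine (setLIntegral_mono measurable_const fun s _ => prob_le_one).trans ?_
    simp
  have h2 : ∫⁻ s in Set.Ioi (1 : ℝ), μ {e | s < 1 / √(D.riskProb μ (D.obsTime e))} ≤ 1 := by
    have hle : ∀ s ∈ Set.Ioi (1 : ℝ), μ {e | s < 1 / √(D.riskProb μ (D.obsTime e))} ≤
        ENNReal.ofReal (s ^ (-2 : ℝ)) := by
      intro s hs
      have hs0 : (0 : ℝ) < s := zero_lt_one.trans hs
      refine (measure_mono fun e he => ?_).trans (measure_riskProb_obsTime_le h hd _)
      have he' : s < 1 / √(D.riskProb μ (D.obsTime e)) := he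
      have hpos : 0 < √(D.riskProb μ (D.obsTime e)) := by
        by_contra hneg
        rw [le_antisymm (not_lt.1 hneg) (Real.sqrt_nonneg _), div_zero] at he'
        linarith
      have h3 : √(D.riskProb μ (D.obsTime e)) < 1 / s := by
        rwa [lt_div_iff₀ hpos, mul_comm, ← lt_div_iff₀ hs0] at he'
      show D.riskProb μ (D.obsTime e) ≤ s ^ (-2 : ℝ)
      rw [← Real.sq_sqrt (show 0 ≤ D.riskProb μ (D.obsTime e) from measureReal_nonneg),
        Real.rpow_neg hs0.le, Real.rpow_two, ← inv_pow, ← one_div]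
      exact pow_le_pow_left₀ hpos.le h3.le 2
    refine (setLIntegral_mono (by fun_prop) hle).trans ?_
    rw [← ofReal_integral_eq_lintegral_ofReal
      (integrableOn_Ioi_rpow_of_lt (by norm_num) zero_lt_one)]
    · rw [integral_Ioi_rpow_of_lt (by norm_num) zero_lt_one]
      norm_num
    · exact (ae_restrict_mem measurableSet_Ioi).mono fun s hs =>
        Real.rpow_nonneg (zero_le_one.trans (le_of_lt hs)) _
  exact (add_le_add h1 h2).trans (by norm_num)

theorem integrable_weight [IsProbabilityMeasure μ] (h : D.IsCoxModel μ) {K B : ℝ} (hK0 : 0 ≤ K)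
    (hK : D.CovBounded μ K) (hB : ∑ j, |D.coef j| ≤ B) {t : ℝ} (ht : t ∈ D.timeSet μ) :
    Integrable (D.weight t D.coef) μ := by
  refine Integrable.of_bound
    ((h.measurable_weight D.coef).comp measurable_prodMk_left).aestronglyMeasurable
    (Real.exp (B * K)) ?_
  filter_upwards [hK t ht] with e he
  rw [Real.norm_of_nonneg (weight_nonneg _ _ _)]
  exact (weight_le hK0 hB he).trans
    (mul_le_of_le_one_right (Real.exp_pos _).le (atRisk_le_one _ _))

theorem integral_weight_pos [IsProbabilityMeasure μ] (h : D.IsCoxModel μ) {K B : ℝ} (hK0 : 0 ≤ K)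
    (hK : D.CovBounded μ K) (hB : ∑ j, |D.coef j| ≤ B) {t : ℝ}
    (ht : t ∈ timesBelow (D.tPlus μ)) : 0 < ∫ e, D.weight t D.coef e ∂μ := by
  have h1 : D.riskProb μ t ≤ Real.exp (B * K) * ∫ e, D.weight t D.coef e ∂μ := by
    rw [← integral_atRisk h, ← integral_const_mul]
    refine integral_mono_ae (integrable_atRisk h t)
      ((integrable_weight h hK0 hK hB (timesBelow_subset_timeSet ht)).const_mul _) ?_
    filter_upwards [hK t (timesBelow_subset_timeSet ht)] with e he
    exact atRisk_le hK0 hB he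
  exact pos_of_mul_pos_right ((riskProb_pos h ht).trans_le h1) (Real.exp_pos _).le

theorem abs_popMean_le [IsProbabilityMeasure μ] (h : D.IsCoxModel μ) {K B : ℝ} (hK0 : 0 ≤ K)
    (hK : D.CovBounded μ K) (hB : ∑ j, |D.coef j| ≤ B) {t : ℝ}
    (ht : t ∈ D.timeSet μ) (k : Fin p) : |D.popMean μ t D.coef k| ≤ K := by
  have hw0 : 0 ≤ ∫ e, D.weight t D.coef e ∂μ := integral_nonneg fun e => weight_nonneg _ _ _
  rw [popMean, abs_div, abs_of_nonneg hw0]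
  refine div_le_of_le_mul₀ hw0 hK0 ?_
  rw [← integral_const_mul]
  refine (abs_integral_le_integral_abs).trans (integral_mono_of_nonneg
    (Eventually.of_forall fun e => abs_nonneg _)
    ((integrable_weight h hK0 hK hB ht).const_mul _) ?_)
  filter_upwards [hK t ht] with e he
  show |D.cov t e k * D.weight t D.coef e| ≤ _
  rw [abs_mul, abs_of_nonneg (weight_nonneg _ _ _)]
  exact mul_le_mul_of_nonneg_right (he k) (weight_nonneg _ _ _)

/-- The centred variables whose sums control the weighted mean at time `t`. -/
noncomputable def centredTerm (D : CoxData E p) (μ : Measure E) (K t : ℝ) :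
    Option (Fin p) → E → ℝ
  | none => fun e => 2 * K * (D.atRisk t e - D.riskProb μ t)
  | some k => fun e => (D.cov t e k - D.popMean μ t D.coef k) * D.weight t D.coef e

theorem measurable_centredTerm (h : D.IsCoxModel μ) (K t : ℝ) (k : Option (Fin p)) :
    Measurable (D.centredTerm μ K t k) := by
  have h1 := (h.measurable_weight D.coef).comp (measurable_prodMk_left (x := t))
  have h2 := h.measurable_atRisk.comp (measurable_prodMk_left (x := t))
  match k with
  | none => exact (h2.sub_const _).const_mul _
  | some k =>
    exact (((h.measurable_cov_apply k).comp (measurable_prodMk_left (x := t))).sub_const _).mul h1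

theorem abs_centredTerm_le [IsProbabilityMeasure μ] (h : D.IsCoxModel μ) {K B : ℝ} (hK0 : 0 ≤ K)
    (hK : D.CovBounded μ K) (hB : ∑ j, |D.coef j| ≤ B) {t : ℝ} (ht : t ∈ D.timeSet μ) {e : E}
    (he : ∀ j, |D.cov t e j| ≤ K) (k : Fin p) :
    |D.centredTerm μ K t (some k) e| ≤ 2 * K * Real.exp (B * K) * D.atRisk t e := by
  show |(D.cov t e k - D.popMean μ t D.coef k) * D.weight t D.coef e| ≤ _
  rw [abs_mul, abs_of_nonneg (weight_nonneg _ _ _), mul_assoc]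
  refine mul_le_mul ?_ (weight_le hK0 hB he) (weight_nonneg _ _ _) (by positivity)
  refine (abs_sub _ _).trans ?_
  linarith [he k, abs_popMean_le h hK0 hK hB ht k]

theorem integral_centredTerm [IsProbabilityMeasure μ] (h : D.IsCoxModel μ) {K B : ℝ} (hK0 : 0 ≤ K)
    (hK : D.CovBounded μ K) (hB : ∑ j, |D.coef j| ≤ B) {t : ℝ} (ht : t ∈ timesBelow (D.tPlus μ))
    (k : Option (Fin p)) : ∫ e, D.centredTerm μ K t k e ∂μ = 0 := by
  have ht' := timesBelow_subset_timeSet ht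
  match k with
  | none =>
    show ∫ e, 2 * K * (D.atRisk t e - D.riskProb μ t) ∂μ = 0
    rw [integral_const_mul, integral_sub (integrable_atRisk h t) (integrable_const _),
      integral_atRisk h]
    simp
  | some k =>
    have hw := integrable_weight h hK0 hK hB ht'
    have hcw : Integrable (fun e => D.cov t e k * D.weight t D.coef e) μ :=
      hw.bdd_mul (c := K)
        ((h.measurable_cov_apply k).comp (measurable_prodMk_left (x := t))).aestronglyMeasurable
        ((hK t ht').mono fun e he => he k)
    show ∫ e, (D.cov t e k - D.popMean μ t D.coef k) * D.weight t D.coef e ∂μ = 0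
    simp only [sub_mul]
    rw [integral_sub hcw (hw.const_mul _), integral_const_mul, popMean,
      div_mul_cancel₀ _ (integral_weight_pos h hK0 hK hB ht).ne', sub_self]

theorem integral_centredTerm_sq_le [IsProbabilityMeasure μ] (h : D.IsCoxModel μ) {K B : ℝ}
    (hK0 : 0 ≤ K) (hB0 : 0 ≤ B) (hK : D.CovBounded μ K) (hB : ∑ j, |D.coef j| ≤ B) {t : ℝ}
    (ht : t ∈ D.timeSet μ) (k : Option (Fin p)) :
    ∫ e, D.centredTerm μ K t k e ^ 2 ∂μ ≤ (2 * K * Real.exp (B * K)) ^ 2 * D.riskProb μ t := by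
  have hI := integrable_atRisk h t
  rw [← integral_atRisk h, ← integral_const_mul]
  match k with
  | none =>
    have hb1 : 1 ≤ Real.exp (B * K) := Real.one_le_exp (by positivity)
    have e1 : ∀ e, D.centredTerm μ K t none e ^ 2 = (2 * K) ^ 2 * (D.atRisk t e -
        2 * D.riskProb μ t * D.atRisk t e + D.riskProb μ t ^ 2) := fun e => by
      show (2 * K * (D.atRisk t e - D.riskProb μ t)) ^ 2 = _
      rw [mul_pow, sub_sq, atRisk_sq]
      ring
    simp_rw [e1]
    have hI2 : Integrable (fun e => D.atRisk t e - 2 * D.riskProb μ t * D.atRisk t e) μ :=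
      hI.sub (hI.const_mul _)
    rw [integral_const_mul, integral_const_mul, integral_add hI2 (integrable_const _),
      integral_sub hI (hI.const_mul _), integral_const_mul, integral_atRisk h]
    simp only [integral_const, probReal_univ, smul_eq_mul, one_mul]
    have h0 : 0 ≤ D.riskProb μ t := measureReal_nonneg
    have h2 : (2 * K) ^ 2 ≤ (2 * K * Real.exp (B * K)) ^ 2 :=
      pow_le_pow_left₀ (by positivity) (le_mul_of_one_le_right (by positivity) hb1) 2
    refine mul_le_mul h2 (by nlinarith) ?_ (by positivity)
    nlinarith [riskProb_le_one (D := D) (μ := μ) t]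
  | some k =>
    refine integral_mono_of_nonneg (Eventually.of_forall fun e => sq_nonneg _)
      (hI.const_mul _) ?_
    filter_upwards [hK t ht] with e he
    show D.centredTerm μ K t (some k) e ^ 2 ≤ _
    rw [← atRisk_sq, ← mul_pow, ← sq_abs]
    exact pow_le_pow_left₀ (abs_nonneg _) (abs_centredTerm_le h hK0 hK hB ht he k) 2

end CoxData

namespace CoxData

section

variable {E : Type*} {p : ℕ} {D : CoxData E p}

theorem Zbar_cons {m : ℕ} (e : E) (y : Fin m → E) (t : ℝ) (b : Fin p → ℝ) (k : Fin p) :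
    D.Zbar (Fin.cons e y : Fin (m + 1) → E) t b k =
      (D.cov t e k * D.weight t b e + ∑ j, D.cov t (y j) k * D.weight t b (y j)) /
        (D.weight t b e + ∑ j, D.weight t b (y j)) := by
  simp [Zbar_eq_div, Fin.sum_univ_succ]

theorem Zbar_succAbove {m : ℕ} (x : Fin (m + 1) → E) (i : Fin (m + 1)) (t : ℝ) (b : Fin p → ℝ) :
    D.Zbar (Fin.cons (x i) fun j => x (i.succAbove j) : Fin (m + 1) → E) t b = D.Zbar x t b := by
  funext k
  rw [Zbar_cons, Zbar_eq_div, Fin.sum_univ_succAbove _ i, Fin.sum_univ_succAbove _ i]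

end

variable {E : Type*} [MeasurableSpace E] {p : ℕ} {D : CoxData E p} {μ : Measure E}

/-- The largest deviation of the sample weighted mean from the population weighted mean at the
observed time of `e`, for the sample consisting of `e` and `y`. -/
noncomputable def zbarError (D : CoxData E p) (μ : Measure E) {m : ℕ} (e : E) (y : Fin m → E) :
    ℝ≥0∞ :=
  ⨆ k, ENNReal.ofReal |D.Zbar (Fin.cons e y : Fin (m + 1) → E) (D.obsTime e) D.coef k -
    D.popMean μ (D.obsTime e) D.coef k|

theorem measurable_zbarError [IsProbabilityMeasure μ] (h : D.IsCoxModel μ) (m : ℕ) :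
    Measurable fun q : E × (Fin m → E) => D.zbarError μ q.1 q.2 := by
  unfold zbarError
  refine Measurable.iSup fun k => Measurable.ennreal_ofReal ?_
  simp only [Zbar_cons]
  have hT : Measurable fun q : E × (Fin m → E) => D.obsTime q.1 :=
    h.measurable_obsTime.comp measurable_fst
  have hy : ∀ j : Fin m, Measurable fun q : E × (Fin m → E) => q.2 j := fun j =>
    (measurable_pi_apply j).comp measurable_snd
  have hw0 : Measurable fun q : E × (Fin m → E) => D.weight (D.obsTime q.1) D.coef q.1 :=
    (h.measurable_weight D.coef).comp (hT.prodMk measurable_fst)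
  have hw : ∀ j : Fin m, Measurable fun q : E × (Fin m → E) =>
      D.weight (D.obsTime q.1) D.coef (q.2 j) := fun j =>
    (h.measurable_weight D.coef).comp (hT.prodMk (hy j))
  have hc0 : Measurable fun q : E × (Fin m → E) => D.cov (D.obsTime q.1) q.1 k :=
    (h.measurable_cov_apply k).comp (hT.prodMk measurable_fst)
  have hc : ∀ j : Fin m, Measurable fun q : E × (Fin m → E) =>
      D.cov (D.obsTime q.1) (q.2 j) k := fun j =>
    (h.measurable_cov_apply k).comp (hT.prodMk (hy j))
  have hnum := (hc0.mul hw0).add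
    (Finset.measurable_fun_sum Finset.univ fun j _ => (hc j).mul (hw j))
  have hden := hw0.add (Finset.measurable_fun_sum Finset.univ fun j _ => hw j)
  exact ((hnum.div hden).sub ((h.measurable_popMean D.coef k).comp hT)).abs

theorem abs_Zbar_cons_sub_mul_le [IsProbabilityMeasure μ] (h : D.IsCoxModel μ) {K B : ℝ}
    (hK0 : 0 ≤ K) (hK : D.CovBounded μ K) (hB : ∑ j, |D.coef j| ≤ B)
    {e : E} (ht : D.obsTime e ∈ D.timeSet μ) (he : ∀ k, |D.cov (D.obsTime e) e k| ≤ K) {m : ℕ}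
    {y : Fin m → E} (hy : ∀ j k, |D.cov (D.obsTime e) (y j) k| ≤ K) (k : Fin p) :
    |D.Zbar (Fin.cons e y : Fin (m + 1) → E) (D.obsTime e) D.coef k -
      D.popMean μ (D.obsTime e) D.coef k| * (m * D.riskProb μ (D.obsTime e)) ≤
      2 * K * Real.exp (B * K) ^ 2 +
        Real.exp (B * K) * |∑ j, D.centredTerm μ K (D.obsTime e) (some k) (y j)| +
        |∑ j, D.centredTerm μ K (D.obsTime e) none (y j)| := by
  set t := D.obsTime e with htdef
  set c := Real.exp (B * K)
  set ρ := D.Zbar (Fin.cons e y : Fin (m + 1) → E) t D.coef k - D.popMean μ t D.coef k with hρ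
  have hc0 : 0 < c := Real.exp_pos _
  set W := D.weight t D.coef e + ∑ j, D.weight t D.coef (y j) with hW
  have hws : 0 ≤ ∑ j, D.weight t D.coef (y j) := Finset.sum_nonneg fun j _ => weight_nonneg _ _ _
  have hW0 : 0 < W := add_pos_of_pos_of_nonneg (weight_self_pos e D.coef) hws
  have hnum : ρ * W = D.centredTerm μ K t (some k) e +
      ∑ j, D.centredTerm μ K t (some k) (y j) := by
    rw [hρ, Zbar_cons, sub_mul, div_mul_cancel₀ _ hW0.ne', hW]
    simp only [centredTerm, sub_mul, Finset.sum_sub_distrib, ← Finset.mul_sum]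
    ring
  have hrho : |ρ| ≤ 2 * K := by
    refine (abs_sub _ _).trans ?_
    have h1 : |D.Zbar (Fin.cons e y : Fin (m + 1) → E) t D.coef k| ≤ K :=
      abs_Zbar_le _ hK0 (fun j => by
        refine Fin.cases ?_ (fun j => ?_) j
        · exact he k
        · exact hy j k) D.coef
    linarith [abs_popMean_le h hK0 hK hB ht k]
  have hR : ∑ j, D.atRisk t (y j) ≤ c * W := by
    have h1 : ∑ j, D.atRisk t (y j) ≤ c * ∑ j, D.weight t D.coef (y j) := by
      rw [Finset.mul_sum]
      exact Finset.sum_le_sum fun j _ => atRisk_le hK0 hB (hy j)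
    exact h1.trans (mul_le_mul_of_nonneg_left
      (le_add_of_nonneg_left (weight_nonneg _ _ _)) hc0.le)
  have hnone : ∑ j, D.centredTerm μ K t none (y j) =
      2 * K * (∑ j, D.atRisk t (y j) - m * D.riskProb μ t) := by
    simp [centredTerm, ← Finset.mul_sum, Finset.sum_sub_distrib]
  have h0 : |D.centredTerm μ K t (some k) e| ≤ 2 * K * c :=
    (abs_centredTerm_le h hK0 hK hB ht he k).trans
      (mul_le_of_le_one_right (by positivity) (atRisk_le_one _ _))
  have hρW : |ρ| * W ≤ 2 * K * c + |∑ j, D.centredTerm μ K t (some k) (y j)| := by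
    rw [← abs_of_pos hW0, ← abs_mul, hnum]
    exact (abs_add_le _ _).trans (add_le_add h0 le_rfl)
  have h2 : -(|ρ| * (∑ j, D.atRisk t (y j) - m * D.riskProb μ t)) ≤
      |∑ j, D.centredTerm μ K t none (y j)| := by
    rw [hnone, abs_mul, abs_of_nonneg (by positivity : (0 : ℝ) ≤ 2 * K), ← mul_neg]
    exact (mul_le_mul_of_nonneg_left (neg_le_abs _) (abs_nonneg ρ)).trans
      (mul_le_mul_of_nonneg_right hrho (abs_nonneg _))
  have h3 : |ρ| * ∑ j, D.atRisk t (y j) ≤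
      c * (2 * K * c + |∑ j, D.centredTerm μ K t (some k) (y j)|) := by
    refine (mul_le_mul_of_nonneg_left hR (abs_nonneg ρ)).trans ?_
    rw [mul_left_comm]
    exact mul_le_mul_of_nonneg_left hρW hc0.le
  nlinarith

theorem lintegral_zbarError_le [IsProbabilityMeasure μ] (h : D.IsCoxModel μ) {K B : ℝ}
    (hK0 : 0 < K) (hB0 : 0 ≤ B) (hK : D.CovBounded μ K) (hB : ∑ j, |D.coef j| ≤ B) {e : E}
    (ht : D.obsTime e ∈ timesBelow (D.tPlus μ))
    (he : ∀ t ∈ D.timeSet μ, ∀ k, |D.cov t e k| ≤ K) {m : ℕ} (hm : 0 < m) :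
    ∫⁻ y, D.zbarError μ e y ∂Measure.pi (fun _ : Fin m => μ) ≤
      ENNReal.ofReal (20 * K * Real.exp (B * K) ^ 2 * √(Real.log (2 * (p + 1)) / m)) *
        ENNReal.ofReal (1 / √(D.riskProb μ (D.obsTime e))) := by
  set t := D.obsTime e with htdef
  have ht' : t ∈ D.timeSet μ := timesBelow_subset_timeSet ht
  set c := Real.exp (B * K) with hc
  have hc1 : 1 ≤ c := Real.one_le_exp (by positivity)
  set π := D.riskProb μ t with hπ
  have hπ0 : 0 < π := riskProb_pos h ht
  set L := Real.log (2 * (p + 1)) with hLdef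
  have hm0 : (0 : ℝ) < m := by exact_mod_cast hm
  have hL0 : 1 / 2 < L := by
    have h1 : (2 : ℝ) ≤ 2 * (p + 1) := by linarith [Nat.cast_nonneg (α := ℝ) p]
    linarith [Real.log_le_log two_pos h1, Real.log_two_gt_d9]
  have hmπ : 0 < m * π := mul_pos hm0 hπ0
  have hgood : ∀ᵐ y ∂Measure.pi (fun _ : Fin m => μ), ∀ j k, |D.cov t (y j) k| ≤ K :=
    ae_pi_all (ν := fun _ => μ) fun _ => hK t ht'
  have hsq : √(L / m) * (1 / √π) = √L / √(m * π) := by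
    rw [Real.sqrt_div' _ hm0.le, Real.sqrt_mul hm0.le]
    field_simp
  rw [← ENNReal.ofReal_mul (by positivity), mul_assoc (20 * K * c ^ 2), hsq]
  rcases lt_or_ge (m * π) L with hlt | hge
  · have hle : ∀ᵐ y ∂Measure.pi (fun _ : Fin m => μ),
        D.zbarError μ e y ≤ ENNReal.ofReal (2 * K) := by
      filter_upwards [hgood] with y hy
      refine iSup_le fun k => ENNReal.ofReal_le_ofReal ((abs_sub _ _).trans ?_)
      have h1 : |D.Zbar (Fin.cons e y : Fin (m + 1) → E) t D.coef k| ≤ K :=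
        abs_Zbar_le _ hK0.le (fun j => by
          refine Fin.cases ?_ (fun j => ?_) j
          · exact he t ht' k
          · exact hy j k) D.coef
      linarith [abs_popMean_le h hK0.le hK hB ht' k]
    refine (lintegral_mono_ae hle).trans ?_
    rw [lintegral_const, measure_univ, mul_one]
    refine ENNReal.ofReal_le_ofReal ?_
    have h1 : 1 ≤ √L / √(m * π) := by
      rw [one_le_div (Real.sqrt_pos.2 hmπ)]
      exact Real.sqrt_le_sqrt hlt.le
    have h2 : 1 ≤ c ^ 2 := one_le_pow₀ hc1
    nlinarith [mul_le_mul h2 h1 zero_le_one (by positivity)]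
  · have hbound : ∀ᵐ y ∂Measure.pi (fun _ : Fin m => μ),
        ENNReal.ofReal (m * π) * D.zbarError μ e y ≤ ENNReal.ofReal (2 * K * c ^ 2) +
          ENNReal.ofReal (2 * c) * ⨆ k, ENNReal.ofReal |∑ j, D.centredTerm μ K t k (y j)| := by
      filter_upwards [hgood] with y hy
      rw [zbarError, ENNReal.mul_iSup]
      refine iSup_le fun k => ?_
      rw [← ENNReal.ofReal_mul hmπ.le, mul_comm]
      refine (ENNReal.ofReal_le_ofReal
        (abs_Zbar_cons_sub_mul_le h hK0.le hK hB ht' (he t ht') hy k)).trans ?_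
      rw [add_assoc, ENNReal.ofReal_add (by positivity) (by positivity),
        ENNReal.ofReal_add (by positivity) (abs_nonneg _), two_mul c,
          ENNReal.ofReal_add (by positivity) (by positivity), add_mul]
      refine add_le_add le_rfl (add_le_add ?_ ?_)
      · rw [ENNReal.ofReal_mul (Real.exp_pos _).le]
        exact mul_le_mul_right (le_iSup
          (fun k => ENNReal.ofReal |∑ j, D.centredTerm μ K t k (y j)|) (some k)) _
      · refine le_trans (le_iSup
          (fun k => ENNReal.ofReal |∑ j, D.centredTerm μ K t k (y j)|) none) ?_
        exact le_mul_of_one_le_left zero_le (by rw [ENNReal.one_le_ofReal]; exact hc1)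
    have hmax := lintegral_iSup_abs_sum_le_sqrt (μ := μ) (X := D.centredTerm μ K t)
      (measurable_centredTerm h K t) (C := 2 * K * c) (v := π) (by positivity) (fun k => by
        filter_upwards [hK t ht'] with e' he'
        match k with
        | none =>
          have h1 : |D.atRisk t e' - π| ≤ 1 := by
            rw [abs_le]
            constructor <;> linarith [atRisk_nonneg (D := D) t e', atRisk_le_one (D := D) t e',
              riskProb_le_one (D := D) (μ := μ) t]
          show |2 * K * (D.atRisk t e' - π)| ≤ _
          rw [abs_mul, abs_of_nonneg (by positivity : (0 : ℝ) ≤ 2 * K)]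
          exact mul_le_mul_of_nonneg_left (h1.trans hc1) (by positivity)
        | some k =>
          exact (abs_centredTerm_le h hK0.le hK hB ht' he' k).trans
            (mul_le_of_le_one_right (by positivity) (atRisk_le_one _ _)))
      (integral_centredTerm h hK0.le hK hB ht) hπ0
      (integral_centredTerm_sq_le h hK0.le hB0 hK hB ht') (m := m)
      (by simpa [hLdef] using hge)
    have hcard : Real.log (2 * (Fintype.card (Option (Fin p)) : ℝ)) = L := by simp [hLdef]
    rw [hcard] at hmax
    have hint : ENNReal.ofReal (m * π) * ∫⁻ y, D.zbarError μ e y ∂Measure.pi (fun _ : Fin m => μ) ≤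
        ENNReal.ofReal (20 * K * c ^ 2 * √(m * π * L)) := by
      rw [← lintegral_const_mul' _ _ ENNReal.ofReal_ne_top]
      refine (lintegral_mono_ae hbound).trans ?_
      rw [lintegral_add_left measurable_const, lintegral_const, measure_univ, mul_one,
        lintegral_const_mul' _ _ ENNReal.ofReal_ne_top]
      refine (add_le_add le_rfl (mul_le_mul_right hmax _)).trans ?_
      rw [← ENNReal.ofReal_mul (by positivity), ← ENNReal.ofReal_add (by positivity)
        (by positivity)]
      refine ENNReal.ofReal_le_ofReal ?_
      have h1 : 1 / 2 ≤ √(m * π * L) := by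
        apply Real.le_sqrt_of_sq_le
        nlinarith
      have h2 : 0 ≤ K * c ^ 2 := by positivity
      nlinarith [mul_le_mul_of_nonneg_left h1 h2]
    have hne : ENNReal.ofReal (m * π) ≠ 0 := (ENNReal.ofReal_pos.2 hmπ).ne'
    rw [mul_comm, ← ENNReal.le_div_iff_mul_le (Or.inl hne) (Or.inl ENNReal.ofReal_ne_top),
      ← ENNReal.ofReal_div_of_pos hmπ] at hint
    refine hint.trans (ENNReal.ofReal_le_ofReal (le_of_eq ?_))
    rw [Real.sqrt_mul hmπ.le, div_eq_iff hmπ.ne']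
    nth_rewrite 3 [← Real.mul_self_sqrt hmπ.le]
    have := (Real.sqrt_pos.2 hmπ).ne'
    field_simp

theorem lintegral_mean_zbarError_le [IsProbabilityMeasure μ] (h : D.IsCoxModel μ)
    (hd : D.HasBoundedDensity μ) {K B : ℝ}
    (hK0 : 0 < K) (hB0 : 0 ≤ B) (hK : D.CovBounded μ K) (hL : ∃ L, D.CovLipschitz μ L)
    (hB : ∑ j, |D.coef j| ≤ B) {m : ℕ} (hm : 0 < m) :
    ∫⁻ x, ENNReal.ofReal (1 / ((m + 1 : ℕ) : ℝ)) *
        ∑ i, D.zbarError μ (x i) (fun j => x (i.succAbove j))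
        ∂Measure.pi (fun _ : Fin (m + 1) => μ) ≤
      ENNReal.ofReal (40 * K * Real.exp (B * K) ^ 2 * √(Real.log (2 * (p + 1)) / m)) := by
  have hmeas := measurable_zbarError h m
  have hmi : ∀ i : Fin (m + 1), Measurable fun x : Fin (m + 1) → E =>
      D.zbarError μ (x i) (fun j => x (i.succAbove j)) := fun i =>
    hmeas.comp (f := fun x : Fin (m + 1) → E => (x i, fun j => x (i.succAbove j)))
      ((measurable_pi_apply i).prodMk (measurable_pi_lambda _ fun j => measurable_pi_apply _))
  have hterm : ∀ i : Fin (m + 1), ∫⁻ x, D.zbarError μ (x i) (fun j => x (i.succAbove j))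
      ∂Measure.pi (fun _ : Fin (m + 1) => μ) ≤
      ENNReal.ofReal (40 * K * Real.exp (B * K) ^ 2 * √(Real.log (2 * (p + 1)) / m)) := by
    intro i
    rw [lintegral_succAbove (fun _ : Fin (m + 1) => μ) i
      (f := fun q : E × (Fin m → E) => D.zbarError μ q.1 q.2) hmeas]
    have hae : ∀ᵐ e ∂μ, ∫⁻ y, D.zbarError μ e y ∂Measure.pi (fun _ : Fin m => μ) ≤
        ENNReal.ofReal (20 * K * Real.exp (B * K) ^ 2 * √(Real.log (2 * (p + 1)) / m)) *
          ENNReal.ofReal (1 / √(D.riskProb μ (D.obsTime e))) := by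
      filter_upwards [ae_obsTime_mem h hd, ae_cov_le hK hL] with e h1 h2
      exact lintegral_zbarError_le h hK0 hB0 hK hB h1 h2 hm
    refine (lintegral_mono_ae hae).trans ?_
    rw [lintegral_const_mul' _ _ ENNReal.ofReal_ne_top]
    refine (mul_le_mul_right (lintegral_inv_sqrt_riskProb_le h hd) _).trans (le_of_eq ?_)
    rw [show (2 : ℝ≥0∞) = ENNReal.ofReal 2 by simp, ← ENNReal.ofReal_mul (by positivity)]
    congr 1
    ring
  rw [lintegral_const_mul' _ _ ENNReal.ofReal_ne_top, lintegral_finsetSum _ fun i _ => hmi i]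
  refine (mul_le_mul_right (Finset.sum_le_sum fun i _ => hterm i) _).trans (le_of_eq ?_)
  rw [Finset.sum_const, Finset.card_univ, Fintype.card_fin, nsmul_eq_mul, ← mul_assoc,
    ← ENNReal.ofReal_natCast, ← ENNReal.ofReal_mul (by positivity), one_div,
    inv_mul_cancel₀ (by positivity), ENNReal.ofReal_one, one_mul]

end CoxData

namespace CoxData

section

variable {E : Type*} {p : ℕ} {D : CoxData E p}

theorem abs_event_mul_mul_le {K : ℝ} (hK0 : 0 ≤ K) (e : E) {z₁ z₂ a₁ a₂ : ℝ} (hz₁ : |z₁| ≤ K)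
    (hz₂ : |z₂| ≤ K) (ha₁ : |a₁| ≤ K) (ha₂ : |a₂| ≤ K) :
    |D.event e * ((z₁ - a₁) * (z₂ - a₂))| ≤ 4 * K ^ 2 := by
  rw [abs_mul, abs_of_nonneg (event_nonneg e), abs_mul]
  have h1 : |z₁ - a₁| ≤ 2 * K := (abs_sub _ _).trans (by linarith)
  have h2 : |z₂ - a₂| ≤ 2 * K := (abs_sub _ _).trans (by linarith)
  calc D.event e * (|z₁ - a₁| * |z₂ - a₂|) ≤ 1 * (2 * K * (2 * K)) := by
        refine mul_le_mul (event_le_one e) ?_ (by positivity) zero_le_one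
        exact mul_le_mul h1 h2 (abs_nonneg _) (by positivity)
    _ = 4 * K ^ 2 := by ring

theorem abs_Vhat_le {n : ℕ} {x : Fin n → E} {K : ℝ} (hK0 : 0 ≤ K)
    (hK : ∀ i j k, |D.cov (D.obsTime (x i)) (x j) k| ≤ K) (b : Fin p → ℝ) (j k : Fin p) :
    |D.Vhat x b j k| ≤ 4 * K ^ 2 := by
  rcases Nat.eq_zero_or_pos n with rfl | hn
  · simp only [Vhat, Matrix.of_apply, Finset.univ_eq_empty, Finset.sum_empty, mul_zero, abs_zero]
    positivity
  have hn' : (0 : ℝ) < n := by exact_mod_cast hn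
  simp only [Vhat, Matrix.of_apply]
  rw [abs_mul, abs_of_nonneg (by positivity : (0 : ℝ) ≤ 1 / n), one_div, inv_mul_le_iff₀ hn']
  refine (Finset.abs_sum_le_sum_abs _ _).trans ?_
  refine (Finset.sum_le_card_nsmul _ _ (4 * K ^ 2) fun i _ => ?_).trans_eq (by simp)
  exact abs_event_mul_mul_le hK0 _ (hK _ _ _) (hK _ _ _) (abs_Zbar_le x hK0 (fun j => hK i j _) b)
    (abs_Zbar_le x hK0 (fun j => hK i j _) b)

end

variable {E : Type*} [MeasurableSpace E] {p : ℕ} {D : CoxData E p} {μ : Measure E}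

/-- The integrand of `popSigma`. -/
noncomputable def sigmaTerm (D : CoxData E p) (μ : Measure E) (jk : Fin p × Fin p) (e : E) : ℝ :=
  D.event e * ((D.cov (D.obsTime e) e jk.1 - D.popMean μ (D.obsTime e) D.coef jk.1) *
    (D.cov (D.obsTime e) e jk.2 - D.popMean μ (D.obsTime e) D.coef jk.2))

theorem measurable_sigmaTerm [IsProbabilityMeasure μ] (h : D.IsCoxModel μ)
    (jk : Fin p × Fin p) : Measurable (D.sigmaTerm μ jk) := by
  have h1 : ∀ k, Measurable fun e => D.cov (D.obsTime e) e k := fun k =>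
    (h.measurable_cov_apply k).comp (h.measurable_obsTime.prodMk measurable_id)
  have h2 : ∀ k, Measurable fun e => D.popMean μ (D.obsTime e) D.coef k := fun k =>
    (h.measurable_popMean D.coef k).comp h.measurable_obsTime
  exact h.measurable_event.mul (((h1 _).sub (h2 _)).mul ((h1 _).sub (h2 _)))

theorem ae_abs_sigmaTerm_le [IsProbabilityMeasure μ] (h : D.IsCoxModel μ)
    (hd : D.HasBoundedDensity μ) {K B : ℝ} (hK0 : 0 ≤ K) (hK : D.CovBounded μ K)
    (hL : ∃ L, D.CovLipschitz μ L) (hB : ∑ j, |D.coef j| ≤ B) :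
    ∀ᵐ e ∂μ, ∀ jk, |D.sigmaTerm μ jk e| ≤ 4 * K ^ 2 := by
  filter_upwards [ae_obsTime_mem h hd, ae_cov_le hK hL] with e h1 h2 jk
  have ht := timesBelow_subset_timeSet h1
  exact abs_event_mul_mul_le hK0 e (h2 _ ht _) (h2 _ ht _) (abs_popMean_le h hK0 hK hB ht _)
    (abs_popMean_le h hK0 hK hB ht _)

theorem abs_popSigma_le [IsProbabilityMeasure μ] (h : D.IsCoxModel μ)
    (hd : D.HasBoundedDensity μ) {K B : ℝ} (hK0 : 0 ≤ K) (hK : D.CovBounded μ K)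
    (hL : ∃ L, D.CovLipschitz μ L) (hB : ∑ j, |D.coef j| ≤ B) (j k : Fin p) :
    |D.popSigma μ j k| ≤ 4 * K ^ 2 := by
  have := norm_integral_le_of_norm_le_const (μ := μ) (f := D.sigmaTerm μ (j, k)) (C := 4 * K ^ 2)
    ((ae_abs_sigmaTerm_le h hd hK0 hK hL hB).mono fun e he => he (j, k))
  rwa [probReal_univ, mul_one] at this

/-- The average of the errors of the weighted means over the sample. -/
noncomputable def meanZbarError (D : CoxData E p) (μ : Measure E) {m : ℕ} (x : Fin (m + 1) → E) :
    ℝ≥0∞ :=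
  ENNReal.ofReal (1 / ((m + 1 : ℕ) : ℝ)) * ∑ i, D.zbarError μ (x i) (fun j => x (i.succAbove j))

/-- The largest entry of the deviation of the average of `sigmaTerm` from its mean. -/
noncomputable def sigmaError (D : CoxData E p) (μ : Measure E) {n : ℕ} (x : Fin n → E) : ℝ≥0∞ :=
  ENNReal.ofReal (1 / (n : ℝ)) *
    ⨆ jk, ENNReal.ofReal |∑ i, (D.sigmaTerm μ jk (x i) - D.popSigma μ jk.1 jk.2)|

theorem abs_Vhat_coef_sub_le [IsProbabilityMeasure μ] (h : D.IsCoxModel μ) {K B : ℝ}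
    (hK0 : 0 ≤ K) (hK : D.CovBounded μ K) (hB : ∑ j, |D.coef j| ≤ B) {m : ℕ}
    {x : Fin (m + 1) → E} (hx : D.IsGoodSample μ K x) (j k : Fin p) :
    ENNReal.ofReal |D.Vhat x D.coef j k - D.popSigma μ j k| ≤
      ENNReal.ofReal (4 * K) * D.meanZbarError μ x + D.sigmaError μ x := by
  have hx2 : ∀ i j k, |D.cov (D.obsTime (x i)) (x j) k| ≤ K := fun i j k => hx.2 j _ (hx.1 i) k
  set N : ℝ := ((m + 1 : ℕ) : ℝ) with hN
  have hN0 : 0 < N := by positivity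
  set δ : Fin (m + 1) → ℝ := fun i =>
    max |D.Zbar x (D.obsTime (x i)) D.coef j - D.popMean μ (D.obsTime (x i)) D.coef j|
      |D.Zbar x (D.obsTime (x i)) D.coef k - D.popMean μ (D.obsTime (x i)) D.coef k| with hδ
  have hδ0 : ∀ i, 0 ≤ δ i := fun i => le_max_of_le_left (abs_nonneg _)
  have hδe : ∀ i, ENNReal.ofReal (δ i) ≤ D.zbarError μ (x i) fun j => x (i.succAbove j) := by
    intro i
    unfold zbarError
    rw [Zbar_succAbove]
    refine (ENNReal.ofReal_max _ _).trans_le (max_le ?_ ?_)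
    · exact le_iSup (fun k => ENNReal.ofReal |D.Zbar x (D.obsTime (x i)) D.coef k -
        D.popMean μ (D.obsTime (x i)) D.coef k|) j
    · exact le_iSup (fun k => ENNReal.ofReal |D.Zbar x (D.obsTime (x i)) D.coef k -
        D.popMean μ (D.obsTime (x i)) D.coef k|) k
  have hterm : ∀ i, |D.event (x i) *
      ((D.cov (D.obsTime (x i)) (x i) j - D.Zbar x (D.obsTime (x i)) D.coef j) *
       (D.cov (D.obsTime (x i)) (x i) k - D.Zbar x (D.obsTime (x i)) D.coef k)) -
      D.sigmaTerm μ (j, k) (x i)| ≤ 4 * K * δ i := by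
    intro i
    rw [sigmaTerm, ← mul_sub, abs_mul, abs_of_nonneg (event_nonneg _)]
    refine (mul_le_of_le_one_left (abs_nonneg _) (event_le_one _)).trans ?_
    exact abs_mul_sub_mul_le (hx2 _ _ _) (hx2 _ _ _)
      (abs_Zbar_le x hK0 (fun j => hx2 i j _) _) (abs_popMean_le h hK0 hK hB (hx.1 i) _)
      (le_max_left _ _) (le_max_right _ _)
  have hreal : |D.Vhat x D.coef j k - D.popSigma μ j k| ≤ 4 * K * (1 / N * ∑ i, δ i) +
      1 / N * |∑ i, (D.sigmaTerm μ (j, k) (x i) - D.popSigma μ j k)| := by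
    have e1 : D.Vhat x D.coef j k - D.popSigma μ j k = 1 / N * (∑ i, (D.event (x i) *
        ((D.cov (D.obsTime (x i)) (x i) j - D.Zbar x (D.obsTime (x i)) D.coef j) *
         (D.cov (D.obsTime (x i)) (x i) k - D.Zbar x (D.obsTime (x i)) D.coef k)) -
        D.sigmaTerm μ (j, k) (x i))) +
        1 / N * ∑ i, (D.sigmaTerm μ (j, k) (x i) - D.popSigma μ j k) := by
      rw [← mul_add, ← Finset.sum_add_distrib]
      simp only [sub_add_sub_cancel, Vhat, Matrix.of_apply]
      rw [Finset.sum_sub_distrib, mul_sub]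
      simp only [Finset.sum_const, Finset.card_univ, Fintype.card_fin, nsmul_eq_mul]
      rw [← hN, one_div, inv_mul_cancel_left₀ hN0.ne']
    rw [e1]
    refine (abs_add_le _ _).trans (add_le_add ?_ ?_)
    · rw [abs_mul, abs_of_nonneg (by positivity : 0 ≤ 1 / N), mul_left_comm]
      refine mul_le_mul_of_nonneg_left ?_ (by positivity)
      rw [Finset.mul_sum]
      exact (Finset.abs_sum_le_sum_abs _ _).trans (Finset.sum_le_sum fun i _ => hterm i)
    · rw [abs_mul, abs_of_nonneg (by positivity : 0 ≤ 1 / N)]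
  have hs0 : 0 ≤ ∑ i, δ i := Finset.sum_nonneg fun i _ => hδ0 i
  refine (ENNReal.ofReal_le_ofReal hreal).trans ?_
  rw [ENNReal.ofReal_add (by positivity) (by positivity), ENNReal.ofReal_mul (by positivity),
    ENNReal.ofReal_mul (q := ∑ i, δ i) (by positivity),
    ENNReal.ofReal_mul (p := 1 / N) (q := |_|) (by positivity),
    ENNReal.ofReal_sum_of_nonneg fun i _ => hδ0 i]
  unfold meanZbarError sigmaError
  refine add_le_add ?_ ?_
  · gcongr with i
    exact hδe i
  · exact mul_le_mul_right (le_iSup (fun jk : Fin p × Fin p =>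
      ENNReal.ofReal |∑ i, (D.sigmaTerm μ jk (x i) - D.popSigma μ jk.1 jk.2)|) (j, k)) _

theorem lintegral_sigmaError_le [IsProbabilityMeasure μ] (h : D.IsCoxModel μ)
    (hd : D.HasBoundedDensity μ) {K B : ℝ} (hK0 : 0 < K) (hK : D.CovBounded μ K)
    (hL : ∃ L, D.CovLipschitz μ L) (hB : ∑ j, |D.coef j| ≤ B) (hp : 0 < p) {n : ℕ} (hn0 : 0 < n)
    (hn : Real.log (2 * (p * p)) ≤ n) :
    ∫⁻ x, D.sigmaError μ x ∂Measure.pi (fun _ : Fin n => μ) ≤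
      ENNReal.ofReal (32 * K ^ 2 * √(Real.log (2 * (p * p)) / n)) := by
  have : Nonempty (Fin p) := ⟨⟨0, hp⟩⟩
  have hn' : (0 : ℝ) < n := by exact_mod_cast hn0
  have hcard : Real.log (2 * (Fintype.card (Fin p × Fin p) : ℝ)) = Real.log (2 * (p * p)) := by
    simp
  have hae := ae_abs_sigmaTerm_le h hd hK0.le hK hL hB
  have hint : ∀ jk, Integrable (D.sigmaTerm μ jk) μ := fun jk =>
    Integrable.of_bound (measurable_sigmaTerm h jk).aestronglyMeasurable _
      (hae.mono fun e he => he jk)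
  have hbd : ∀ jk : Fin p × Fin p, ∀ᵐ e ∂μ,
      |D.sigmaTerm μ jk e - D.popSigma μ jk.1 jk.2| ≤ 8 * K ^ 2 := fun jk => by
    filter_upwards [hae] with e he
    refine (abs_sub _ _).trans ?_
    linarith [he jk, abs_popSigma_le h hd hK0.le hK hL hB jk.1 jk.2]
  have hmax := lintegral_iSup_abs_sum_le_sqrt (μ := μ)
    (X := fun jk e => D.sigmaTerm μ jk e - D.popSigma μ jk.1 jk.2)
    (fun jk => (measurable_sigmaTerm h jk).sub_const _) (C := 8 * K ^ 2) (v := 1) (by positivity)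
    hbd (fun jk => by
      rw [integral_sub (hint jk) (integrable_const _)]
      simp only [integral_const, probReal_univ, one_smul]
      exact sub_self _) one_pos (fun jk => by
      have h1 := norm_integral_le_of_norm_le_const (μ := μ)
        (f := fun e => (D.sigmaTerm μ jk e - D.popSigma μ jk.1 jk.2) ^ 2) (C := (8 * K ^ 2) ^ 2)
        ((hbd jk).mono fun e he => by
          rw [norm_pow]
          exact pow_le_pow_left₀ (norm_nonneg _) he 2)
      rw [probReal_univ] at h1
      exact (Real.le_norm_self _).trans h1) (m := n) (by rwa [hcard, mul_one])
  unfold sigmaError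
  rw [lintegral_const_mul' _ _ ENNReal.ofReal_ne_top]
  refine (mul_le_mul_right hmax _).trans (le_of_eq ?_)
  rw [← ENNReal.ofReal_mul (by positivity), hcard, mul_one, Real.sqrt_mul hn'.le,
    Real.sqrt_div' _ hn'.le]
  congr 1
  nth_rewrite 1 [← Real.mul_self_sqrt hn'.le]
  have := (Real.sqrt_pos.2 hn').ne'
  field_simp
  ring

theorem measure_exists_abs_Vhat_coef_sub_gt_le [IsProbabilityMeasure μ] (h : D.IsCoxModel μ)
    (hd : D.HasBoundedDensity μ) {K B : ℝ} (hK0 : 0 < K) (hB0 : 0 ≤ B) (hK : D.CovBounded μ K)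
    (hL : ∃ L, D.CovLipschitz μ L) (hB : ∑ j, |D.coef j| ≤ B) (hp : 0 < p) {n : ℕ} (hn2 : 2 ≤ n)
    (hn : 2 * Real.log (n * p) ≤ n) {M : ℝ} (hM : 0 < M) :
    Measure.pi (fun _ : Fin n => μ) {x | ∃ j k,
        M * (√(Real.log (n * p)) / √n) < |D.Vhat x D.coef j k - D.popSigma μ j k|} ≤
      ENNReal.ofReal ((320 * K ^ 2 * Real.exp (B * K) ^ 2 + 64 * K ^ 2) / M) := by
  obtain ⟨m, rfl⟩ : ∃ m, n = m + 1 := ⟨n - 1, by omega⟩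
  have hm : 0 < m := by omega
  set N : ℝ := ((m + 1 : ℕ) : ℝ) with hN
  have hN2 : 2 ≤ N := by rw [hN]; exact_mod_cast hn2
  have hp1 : (1 : ℝ) ≤ p := by exact_mod_cast hp
  have hm0 : (0 : ℝ) < m := by exact_mod_cast hm
  have hNm : N ≤ 2 * m := by
    rw [hN]; exact_mod_cast (by omega : m + 1 ≤ 2 * m)
  set L := Real.log (N * p) with hL'
  have hL0 : 0 < L := Real.log_pos (by nlinarith)
  set r := √L / √N with hr
  have hr0 : 0 < r := div_pos (Real.sqrt_pos.2 hL0) (Real.sqrt_pos.2 (by linarith))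
  have hlog : ∀ a : ℝ, 0 < a → a ≤ (N * p) ^ 2 → Real.log a ≤ 2 * L := fun a h0 ha =>
    (Real.log_le_log h0 ha).trans_eq (by rw [Real.log_pow, Nat.cast_ofNat])
  have hNp : 4 * (p : ℝ) ^ 2 ≤ (N * p) ^ 2 := by
    have h1 : 2 * (p : ℝ) ≤ N * p := by gcongr
    have h2 := pow_le_pow_left₀ (by positivity) h1 2
    linarith
  have hl1 : Real.log (2 * (p + 1)) ≤ 2 * L := hlog _ (by positivity) (by nlinarith)
  have hl2 : Real.log (2 * (p * p)) ≤ 2 * L := hlog _ (by positivity) (by nlinarith)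
  have hs1 : √(Real.log (2 * (p + 1)) / m) ≤ 2 * r := by
    rw [hr, ← Real.sqrt_div hL0.le]
    apply Real.sqrt_le_iff.2 ⟨by positivity, ?_⟩
    rw [mul_pow, Real.sq_sqrt (by positivity), div_le_iff₀ hm0]
    calc Real.log (2 * (p + 1)) ≤ 2 * L := hl1
      _ = 2 * L * (N / N) := by rw [div_self (by linarith), mul_one]
      _ ≤ 2 * L * (2 * m / N) := by gcongr
      _ = 2 ^ 2 * (L / N) * m := by ring
  have hs2 : √(Real.log (2 * (p * p)) / N) ≤ 2 * r := by
    rw [hr, ← Real.sqrt_div hL0.le]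
    apply Real.sqrt_le_iff.2 ⟨by positivity, ?_⟩
    rw [mul_pow, Real.sq_sqrt (by positivity), div_le_iff₀ (by linarith), mul_assoc,
      div_mul_cancel₀ _ (by linarith)]
    linarith
  have hI1 := lintegral_mean_zbarError_le h hd hK0 hB0 hK hL hB hm
  have hI2 := lintegral_sigmaError_le h hd hK0 hK hL hB hp (Nat.succ_pos m) (hl2.trans hn)
  set c := Real.exp (B * K)
  have hmeas : Measurable fun x : Fin (m + 1) → E =>
      ENNReal.ofReal (4 * K) * D.meanZbarError μ x := by
    refine Measurable.const_mul (Measurable.const_mul (Finset.measurable_fun_sum _ fun i _ => ?_)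
      _) _
    exact (measurable_zbarError h m).comp
      (f := fun x : Fin (m + 1) → E => (x i, fun j => x (i.succAbove j)))
      ((measurable_pi_apply i).prodMk (measurable_pi_lambda _ fun j => measurable_pi_apply _))
  have hmeas2 : Measurable fun x : Fin (m + 1) → E => D.sigmaError μ x := by
    refine Measurable.const_mul (Measurable.iSup fun jk => Measurable.ennreal_ofReal ?_) _
    exact (Finset.measurable_fun_sum _ fun i _ =>
      ((measurable_sigmaTerm h jk).comp (measurable_pi_apply i)).sub_const _).abs
  have htot : ∫⁻ x, (ENNReal.ofReal (4 * K) * D.meanZbarError μ x + D.sigmaError μ x)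
      ∂Measure.pi (fun _ : Fin (m + 1) => μ) ≤
      ENNReal.ofReal ((320 * K ^ 2 * c ^ 2 + 64 * K ^ 2) * r) := by
    rw [lintegral_add_left hmeas, lintegral_const_mul' _ _ ENNReal.ofReal_ne_top]
    refine (add_le_add (mul_le_mul_right hI1 _) hI2).trans ?_
    rw [← ENNReal.ofReal_mul (by positivity), ← ENNReal.ofReal_add (by positivity) (by positivity)]
    refine ENNReal.ofReal_le_ofReal ?_
    have a1 := mul_le_mul_of_nonneg_left hs1 (by positivity : 0 ≤ 160 * K ^ 2 * c ^ 2)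
    have a2 := mul_le_mul_of_nonneg_left hs2 (by positivity : 0 ≤ 32 * K ^ 2)
    linarith
  have hMr : 0 < M * r := mul_pos hM hr0
  have hsub : ∀ᵐ x ∂Measure.pi (fun _ : Fin (m + 1) => μ),
      x ∈ {x | ∃ j k, M * r < |D.Vhat x D.coef j k - D.popSigma μ j k|} →
      x ∈ {x | ENNReal.ofReal (M * r) ≤
        ENNReal.ofReal (4 * K) * D.meanZbarError μ x + D.sigmaError μ x} := by
    filter_upwards [ae_isGoodSample h hd hK hL (m + 1)] with x hx
    rintro ⟨j, k, hjk⟩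
    exact (ENNReal.ofReal_le_ofReal hjk.le).trans (abs_Vhat_coef_sub_le h hK0.le hK hB hx j k)
  refine (measure_mono_ae hsub).trans ?_
  refine (meas_ge_le_lintegral_div (hmeas.add hmeas2).aemeasurable (ENNReal.ofReal_pos.2 hMr).ne'
    ENNReal.ofReal_ne_top).trans ?_
  refine (ENNReal.div_le_div_right htot _).trans ?_
  rw [← ENNReal.ofReal_div_of_pos hMr, mul_div_mul_right _ _ hr0.ne']

end CoxData

/-! ### Matrix norms -/

theorem abs_le_matMax {p : ℕ} (A : Matrix (Fin p) (Fin p) ℝ) (j k : Fin p) : |A j k| ≤ matMax A :=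
  le_ciSup (f := fun jk : Fin p × Fin p => |A jk.1 jk.2|) (Set.finite_range _).bddAbove (j, k)

theorem matMax_le {p : ℕ} {A : Matrix (Fin p) (Fin p) ℝ} {C : ℝ} (hC : 0 ≤ C)
    (h : ∀ j k, |A j k| ≤ C) : matMax A ≤ C :=
  Real.iSup_le (fun jk => h jk.1 jk.2) hC

theorem matMax_nonneg {p : ℕ} (A : Matrix (Fin p) (Fin p) ℝ) : 0 ≤ matMax A :=
  Real.iSup_nonneg fun _ => abs_nonneg _

theorem matOpOne_nonneg {p : ℕ} (A : Matrix (Fin p) (Fin p) ℝ) : 0 ≤ matOpOne A :=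
  Real.iSup_nonneg fun _ => by positivity

theorem sum_abs_col_le_matOpOne {p : ℕ} (A : Matrix (Fin p) (Fin p) ℝ) (k : Fin p) :
    ∑ i, |A i k| ≤ matOpOne A := by
  have hbdd : BddAbove (Set.range fun v : {v : Fin p → ℝ // v ≠ 0} =>
      (∑ i, |(A *ᵥ v.1) i|) / ∑ j, |v.1 j|) := by
    refine ⟨∑ i, ∑ j, |A i j|, ?_⟩
    rintro _ ⟨v, rfl⟩
    refine div_le_of_le_mul₀ (by positivity) (by positivity) ?_
    rw [Finset.sum_mul]
    refine Finset.sum_le_sum fun i _ => ?_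
    rw [Matrix.mulVec, dotProduct, Finset.sum_mul]
    refine (Finset.abs_sum_le_sum_abs _ _).trans (Finset.sum_le_sum fun j _ => ?_)
    rw [abs_mul]
    exact mul_le_mul_of_nonneg_left
      (Finset.single_le_sum (f := fun j => |v.1 j|) (fun _ _ => abs_nonneg _) (Finset.mem_univ j))
      (abs_nonneg _)
  have h0 : (Pi.single k 1 : Fin p → ℝ) ≠ 0 := fun h => by simpa using congrFun h k
  refine le_trans (le_of_eq ?_) (le_ciSup hbdd ⟨Pi.single k 1, h0⟩)
  have h1 : ∑ j, |(Pi.single k 1 : Fin p → ℝ) j| = 1 := by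
    rw [Finset.sum_eq_single k (fun j _ hj => by simp [hj]) (by simp)]
    simp
  simp [h1]

theorem matMax_mul_le {p : ℕ} (A B : Matrix (Fin p) (Fin p) ℝ) :
    matMax (A * B) ≤ matMax A * matOpOne B := by
  refine matMax_le (mul_nonneg (matMax_nonneg A) (matOpOne_nonneg B)) fun j k => ?_
  rw [Matrix.mul_apply]
  refine le_trans ?_ (mul_le_mul_of_nonneg_left (sum_abs_col_le_matOpOne B k) (matMax_nonneg A))
  rw [Finset.mul_sum]
  refine (Finset.abs_sum_le_sum_abs _ _).trans (Finset.sum_le_sum fun i _ => ?_)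
  rw [abs_mul]
  exact mul_le_mul_of_nonneg_right (abs_le_matMax A j i) (abs_nonneg _)

theorem matMax_mul_inv_sub_one_le {p : ℕ} {V S : Matrix (Fin p) (Fin p) ℝ} (hS : IsUnit S) {C : ℝ}
    (hC : 0 ≤ C) (h : ∀ j k, |V j k - S j k| ≤ C) :
    matMax (V * S⁻¹ - 1) ≤ C * matOpOne S⁻¹ := by
  have e : V * S⁻¹ - 1 = (V - S) * S⁻¹ := by
    rw [Matrix.sub_mul, Matrix.mul_nonsing_inv _ ((Matrix.isUnit_iff_isUnit_det S).1 hS)]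
  rw [e]
  exact (matMax_mul_le _ _).trans
    (mul_le_mul_of_nonneg_right (matMax_le hC h) (matOpOne_nonneg _))

/-! ### The estimation error of the penalised estimator -/

namespace CoxData

variable {E : Type*} [MeasurableSpace E] {p : ℕ} {D : CoxData E p} {μ : Measure E}

theorem measure_exists_abs_score_ge_le_two_div [IsProbabilityMeasure μ] (h : D.IsCoxModel μ)
    (hd : D.HasBoundedDensity μ) {K : ℝ} (hK0 : 0 < K) (hK : D.CovBounded μ K)
    (hL : ∃ L, D.CovLipschitz μ L) (hp : 0 < p) {n : ℕ} (hn : 0 < n) {u : ℝ}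
    (hu : 6 * K * (√(Real.log (n * p)) / √n) ≤ u) :
    Measure.pi (fun _ : Fin n => μ) {x | ∃ k, u ≤ |D.score x k|} ≤ ENNReal.ofReal (2 / n) := by
  have hn1 : (1 : ℝ) ≤ n := by exact_mod_cast hn
  have hp1 : (1 : ℝ) ≤ p := by exact_mod_cast hp
  have hn0 : (0 : ℝ) < n := by linarith
  have hnp : 1 ≤ (n : ℝ) * p := one_le_mul_of_one_le_of_one_le hn1 hp1
  set L := Real.log (n * p) with hLdef
  have hL0 : 0 ≤ L := Real.log_nonneg hnp
  have hu0 : 0 ≤ 6 * K * (√L / √n) := by positivity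
  refine (measure_exists_abs_score_ge_le h hd hK0 hK hL n (hu0.trans hu)).trans
    (ENNReal.ofReal_le_ofReal ?_)
  have hsq := pow_le_pow_left₀ hu0 hu 2
  rw [mul_pow, div_pow, Real.sq_sqrt hL0, Real.sq_sqrt hn0.le] at hsq
  have hexp : 2 * L ≤ n * u ^ 2 / (16 * K ^ 2) := by
    rw [le_div_iff₀ (by positivity)]
    have h1 := mul_le_mul_of_nonneg_left hsq hn0.le
    have h2 : (n : ℝ) * ((6 * K) ^ 2 * (L / n)) = 36 * K ^ 2 * L := by
      field_simp
      ring
    rw [h2] at h1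
    nlinarith [mul_nonneg (sq_nonneg K) hL0]
  have hle : Real.exp (-(n * u ^ 2 / (16 * K ^ 2))) ≤ ((n : ℝ) * p)⁻¹ ^ 2 := by
    refine (Real.exp_le_exp.2 (neg_le_neg hexp)).trans_eq ?_
    rw [neg_mul_eq_mul_neg, two_mul, Real.exp_add, Real.exp_neg, hLdef, Real.exp_log (by linarith)]
    ring
  calc 2 * (p : ℝ) * Real.exp (-(n * u ^ 2 / (16 * K ^ 2)))
      ≤ 2 * p * ((n : ℝ) * p)⁻¹ ^ 2 := by gcongr
    _ = 2 / n * ((n : ℝ) * p)⁻¹ := by field_simp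
    _ ≤ 2 / n := mul_le_of_le_one_right (by positivity) (inv_le_one_of_one_le₀ hnp)

theorem measure_matMax_Vhat_gt_le [IsProbabilityMeasure μ] (h : D.IsCoxModel μ)
    (hd : D.HasBoundedDensity μ) {K B : ℝ} (hK0 : 0 < K) (hB0 : 0 ≤ B) (hK : D.CovBounded μ K)
    (hL : ∃ L, D.CovLipschitz μ L) (hB : ∑ j, |D.coef j| ≤ B) (hp : 0 < p)
    (hS : IsUnit (D.popSigma μ)) {n : ℕ} (hn : 2 ≤ n)
    {Ω : Type*} [MeasurableSpace Ω] {P : Measure Ω} [IsProbabilityMeasure P] {ξ : Fin n → Ω → E}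
    (hξ : ∀ i, Measurable (ξ i)) (hind : iIndepFun ξ P) (hlaw : ∀ i, P.map (ξ i) = μ)
    {lam M₁ M₂ C : ℝ} (hM₁ : 0 < M₁) (hM₂ : 0 < M₂) (hC : 0 < C)
    (hlam0 : 0 < lam) (hlam1 : 18 * K * (√(Real.log (n * p)) / √n) ≤ lam)
    (hlam2 : lam ≤ C * (√(Real.log (n * p)) / √n))
    (hsmall : (D.sparsity : ℝ) * (√(Real.log (n * p)) / √n) ≤ 1 / (48 * K * C * M₁ ^ 2))
    {b : Ω → Fin p → ℝ} (hb : ∀ᵐ ω ∂P, D.IsLasso (fun i => ξ i ω) lam (b ω)) :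
    P {ω | (16 * K ^ 2 + 192 * K ^ 3 * M₁ ^ 2 * C + M₂) * (matOpOne (D.popSigma μ)⁻¹ *
        (max (D.sparsity : ℝ) 1 * (√(Real.log (n * p)) / √n))) <
        matMax (D.Vhat (fun i => ξ i ω) (b ω) * (D.popSigma μ)⁻¹ - 1)} ≤
      P {ω | ENNReal.ofReal M₁ < (D.kappa fun i => ξ i ω)⁻¹} + ENNReal.ofReal (2 / n) +
        ENNReal.ofReal ((320 * K ^ 2 * Real.exp (B * K) ^ 2 + 64 * K ^ 2) / M₂) := by
  set r := √(Real.log (n * p)) / √n with hr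
  have hr0 : 0 ≤ r := by positivity
  set s : ℝ := (D.sparsity : ℝ)
  have hmax1 : 1 ≤ max s 1 := le_max_right _ _
  have hX : Measurable fun ω i => ξ i ω := measurable_pi_lambda _ hξ
  have hmap : P.map (fun ω i => ξ i ω) = Measure.pi fun _ : Fin n => μ := by
    rw [(iIndepFun_iff_map_fun_eq_pi_map fun i => (hξ i).aemeasurable).1 hind]
    simp_rw [hlaw]
  have hgood : ∀ᵐ ω ∂P, D.IsGoodSample μ K fun i => ξ i ω := by
    refine ae_of_ae_map hX.aemeasurable ?_
    rw [hmap]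
    exact ae_isGoodSample h hd hK hL n
  have htransfer : ∀ A : Set (Fin n → E), P {ω | (fun i => ξ i ω) ∈ A} ≤
      Measure.pi (fun _ : Fin n => μ) A := fun A => by
    rw [← hmap]
    exact Measure.le_map_apply hX.aemeasurable A
  have hentry : ∀ ω, (∀ j k, |D.Vhat (fun i => ξ i ω) (b ω) j k - D.popSigma μ j k| ≤
      (16 * K ^ 2 + 192 * K ^ 3 * M₁ ^ 2 * C + M₂) * (max s 1 * r)) →
      ¬ (16 * K ^ 2 + 192 * K ^ 3 * M₁ ^ 2 * C + M₂) * (matOpOne (D.popSigma μ)⁻¹ *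
        (max s 1 * r)) < matMax (D.Vhat (fun i => ξ i ω) (b ω) * (D.popSigma μ)⁻¹ - 1) := by
    intro ω hω
    rw [not_lt]
    refine (matMax_mul_inv_sub_one_le hS (by positivity) hω).trans_eq ?_
    ring
  rcases le_or_gt (1 / 2) r with hbig | hlt
  · refine le_trans (le_of_eq ?_) (zero_le (a := _))
    rw [← nonpos_iff_eq_zero]
    refine le_of_eq (measure_eq_zero_iff_ae_notMem.2 ?_)
    filter_upwards [hgood] with ω hω
    refine hentry ω fun j k => ?_
    have hx2 := fun i j k => hω.2 j _ (hω.1 i) k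
    refine (abs_sub _ _).trans ((add_le_add (abs_Vhat_le hK0.le hx2 _ j k)
      (abs_popSigma_le h hd hK0.le hK hL hB j k)).trans ?_)
    have h1 : 1 / 2 ≤ max s 1 * r := by nlinarith
    have h2 : 0 ≤ 192 * K ^ 3 * M₁ ^ 2 * C + M₂ := by positivity
    nlinarith [mul_nonneg h2 (by linarith : 0 ≤ max s 1 * r),
      mul_le_mul_of_nonneg_left h1 (sq_nonneg K)]
  · have hn0 : (0 : ℝ) < n := by exact_mod_cast (by omega : 0 < n)
    have hnp : 1 ≤ (n : ℝ) * p := one_le_mul_of_one_le_of_one_le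
      (by exact_mod_cast (by omega : 1 ≤ n)) (by exact_mod_cast hp)
    have hlog : 2 * Real.log (n * p) ≤ n := by
      have h1 := pow_le_pow_left₀ hr0 hlt.le 2
      rw [hr, div_pow, Real.sq_sqrt (Real.log_nonneg hnp), Real.sq_sqrt hn0.le,
        div_le_iff₀ hn0] at h1
      linarith
    have hscore := (htransfer {x | ∃ k, lam / 3 ≤ |D.score x k|}).trans
      (measure_exists_abs_score_ge_le_two_div h hd hK0 hK hL hp (by omega) (by linarith))
    have hV := (htransfer {x | ∃ j k, M₂ * r < |D.Vhat x D.coef j k - D.popSigma μ j k|}).trans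
      (measure_exists_abs_Vhat_coef_sub_gt_le h hd hK0 hB0 hK hL hB hp hn hlog hM₂)
    refine le_trans (measure_mono_ae (?_ : _ ≤ᵐ[P] ({ω | ENNReal.ofReal M₁ <
        (D.kappa fun i => ξ i ω)⁻¹} ∪ {ω | (fun i => ξ i ω) ∈ {x | ∃ k, lam / 3 ≤ |D.score x k|}} ∪
        {ω | (fun i => ξ i ω) ∈ {x | ∃ j k, M₂ * r < |D.Vhat x D.coef j k - D.popSigma μ j k|}} :
        Set Ω))) ((measure_union_le _ _).trans
          (add_le_add ((measure_union_le _ _).trans (add_le_add le_rfl hscore)) hV))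
    filter_upwards [hgood, hb] with ω hω hbω hbad
    by_contra hnot
    have hnot' : ¬ ((ENNReal.ofReal M₁ < (D.kappa fun i => ξ i ω)⁻¹ ∨
        ∃ k, lam / 3 ≤ |D.score (fun i => ξ i ω) k|) ∨
        ∃ j k, M₂ * r < |D.Vhat (fun i => ξ i ω) D.coef j k - D.popSigma μ j k|) := hnot
    push Not at hnot'
    obtain ⟨⟨hk, hsc⟩, hv⟩ := hnot'
    refine hentry ω (fun j k => ?_) hbad
    have hx2 := fun i j k => hω.2 j _ (hω.1 i) k
    have hsl : 4 * lam * D.sparsity * M₁ ^ 2 < 1 / (6 * K) := by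
      calc 4 * lam * D.sparsity * M₁ ^ 2 ≤ 4 * (C * r) * D.sparsity * M₁ ^ 2 := by gcongr
        _ = 4 * C * M₁ ^ 2 * (s * r) := by ring
        _ ≤ 4 * C * M₁ ^ 2 * (1 / (48 * K * C * M₁ ^ 2)) := by gcongr
        _ = 1 / (12 * K) := by field_simp; norm_num
        _ < 1 / (6 * K) := one_div_lt_one_div_of_lt (by positivity) (by linarith)
    have hest := sum_abs_lasso_sub_coef_le (fun i => ξ i ω) hK0 hx2 hlam0 hM₁ hbω
      (fun k => (hsc k).le) hk hsl
    have hVd := abs_Vhat_sub_le (fun i => ξ i ω) hK0.le hx2 (b ω) D.coef j k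
    have h1 : |D.Vhat (fun i => ξ i ω) (b ω) j k - D.popSigma μ j k| ≤
        16 * K ^ 3 * (12 * M₁ ^ 2 * (s * (C * r))) + M₂ * r := by
      refine (abs_sub_le _ (D.Vhat (fun i => ξ i ω) D.coef j k) _).trans
        (add_le_add (hVd.trans ?_) (hv j k))
      refine mul_le_mul_of_nonneg_left (hest.trans ?_) (by positivity)
      gcongr
    refine h1.trans ?_
    have h2 : s * r ≤ max s 1 * r := mul_le_mul_of_nonneg_right (le_max_left _ _) hr0
    have h3 : r ≤ max s 1 * r := le_mul_of_one_le_left hr0 hmax1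
    have h4 := mul_le_mul_of_nonneg_left h2 (by positivity : 0 ≤ 192 * K ^ 3 * M₁ ^ 2 * C)
    have h5 := mul_le_mul_of_nonneg_left h3 hM₂.le
    have h6 : 0 ≤ 16 * K ^ 2 * (max s 1 * r) := by positivity
    linarith

end CoxData

theorem eventually_mul_baseRate_le {p : ℕ → ℕ} {s : ℕ → ℝ} (hs0 : ∀ n, 0 ≤ s n)
    (hs : s =o[atTop] fun n : ℕ => √(n : ℝ) / √(Real.log ((n : ℝ) * (p n : ℝ)))) {c : ℝ}
    (hc : 0 < c) : ∀ᶠ n in atTop, s n * baseRate p n ≤ c := by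
  filter_upwards [hs.bound hc] with n hn
  rw [Real.norm_of_nonneg (hs0 n), Real.norm_of_nonneg (by positivity)] at hn
  have h0 : 0 ≤ baseRate p n := by unfold baseRate; positivity
  refine (mul_le_mul_of_nonneg_right hn h0).trans ?_
  rw [mul_assoc]
  refine mul_le_of_le_one_right hc.le ?_
  rw [baseRate, div_mul_div_comm, mul_comm]
  exact div_self_le_one _

theorem mainTheorem6 (K : ℝ) (hK : 0 < K) :
    ∃ A₀ : ℝ, 0 < A₀ ∧
    ∀ (p : ℕ → ℕ) (_ : ∀ n, 0 < p n)
      -- the population of individuals, for each sample size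
      (E : ℕ → Type*) [∀ n, MeasurableSpace (E n)]
      (μ : ∀ n, Measure (E n)) [∀ n, IsProbabilityMeasure (μ n)]
      (D : ∀ n, CoxData (E n) (p n)) (_ : ∀ n, (D n).IsCoxModel (μ n))
      -- `n` independent copies of the generic individual
      (Ω : ℕ → Type*) [∀ n, MeasurableSpace (Ω n)]
      (P : ∀ n, Measure (Ω n)) [∀ n, IsProbabilityMeasure (P n)]
      (ξ : ∀ n, Fin n → Ω n → E n) (_ : ∀ n i, Measurable (ξ n i))
      (_ : ∀ n, iIndepFun (ξ n) (P n)) (_ : ∀ n i, (P n).map (ξ n i) = μ n)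
      -- covariates bounded by `K` and Lipschitz
      (_ : ∀ n, (D n).CovBounded (μ n) K)
      (_ : ∀ n, ∃ L : ℝ, (D n).CovLipschitz (μ n) L)
      -- bounded density of the observed time
      (_ : ∀ n, (D n).HasBoundedDensity (μ n))
      -- sparsity
      (_ : (fun n => ((D n).sparsity : ℝ)) =o[atTop]
        fun n : ℕ => √(n : ℝ) / √(Real.log ((n : ℝ) * (p n : ℝ))))
      -- compatibility factor bounded away from zero in probability
      (_ : IsBigOp P (fun n ω => ((D n).kappa (fun i => ξ n i ω))⁻¹) (fun _ => 1))
      -- `‖β°‖₁ = O(1)`, and `Σ` is invertible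
      (B : ℝ) (_ : ∀ n, ∑ j, |(D n).coef j| ≤ B)
      (_ : ∀ n, IsUnit ((D n).popSigma (μ n)))
      -- the tuning parameter, with a large enough constant in the lower bound
      (lam : ℕ → ℝ) (_ : ∀ n, 0 < lam n) (_ : lam =Θ[atTop] baseRate p)
      (_ : ∀ᶠ n in atTop, A₀ * baseRate p n ≤ lam n)
      -- the penalised partial likelihood estimator
      (betaHat : ∀ n, Ω n → Fin (p n) → ℝ)
      (_ : ∀ n, ∀ᵐ ω ∂(P n), (D n).IsLasso (fun i => ξ n i ω) (lam n) (betaHat n ω)),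
    ∀ η ∈ Set.Ioo (0 : ℝ) (1 / 3),
      IsBigOp P
        (fun n ω => ENNReal.ofReal (matMax
          ((D n).Vhat (fun i => ξ n i ω) (betaHat n ω) * ((D n).popSigma (μ n))⁻¹ - 1)))
        (fun n => max
          (matOpOne ((D n).popSigma (μ n))⁻¹ * (max ((D n).sparsity : ℝ) 1 * baseRate p n))
          (matOpOne ((D n).popSigma (μ n))⁻¹ * (n : ℝ) ^ (-(1 / 3 - η)))) := by
  refine ⟨18 * K, by positivity, ?_⟩
  intro p hp E _ μ _ D hD Ω _ P _ ξ hξ hind hlaw hK' hL hd hsp hkappa B hB hS lam hlam0 hTheta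
    hlam betaHat hbeta η _ ε hε
  obtain ⟨M₁, hM₁, hkap⟩ := hkappa (ε / 4) (by positivity)
  obtain ⟨C, hC, hlamC⟩ := hTheta.1.exists_pos
  have hB0 : 0 ≤ B := (Finset.sum_nonneg fun j _ => abs_nonneg _).trans (hB 0)
  set c := 320 * K ^ 2 * Real.exp (B * K) ^ 2 + 64 * K ^ 2 with hc
  have hc0 : 0 < c := by positivity
  have hM₂ : 0 < c / (ε / 4) := by positivity
  refine ⟨16 * K ^ 2 + 192 * K ^ 3 * M₁ ^ 2 * C + c / (ε / 4), by positivity, ?_⟩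
  filter_upwards [hkap, hlamC.bound, hlam, eventually_ge_atTop 2,
    eventually_mul_baseRate_le (fun n => Nat.cast_nonneg _) hsp
      (by positivity : 0 < 1 / (48 * K * C * M₁ ^ 2)),
    eventually_ge_atTop ⌈8 / ε⌉₊] with n h1 h2 h3 h4 h5 h6
  have hn0 : (0 : ℝ) < n := by exact_mod_cast (by omega : 0 < n)
  have hr0 : 0 ≤ baseRate p n := by unfold baseRate; positivity
  rw [Real.norm_of_nonneg (hlam0 n).le, Real.norm_of_nonneg hr0] at h2
  simp only [mul_one] at h1
  have hmain := CoxData.measure_matMax_Vhat_gt_le (hD n) (hd n) hK hB0 (hK' n) (hL n) (hB n) (hp n)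
    (hS n) h4 (hξ n) (hind n) (hlaw n) hM₁ hM₂ hC (hlam0 n) h3 h2 h5 (hbeta n)
  refine (measure_mono fun ω hω => ?_).trans (hmain.trans ?_)
  · have hω' := (ENNReal.ofReal_lt_ofReal_iff_of_nonneg
      (mul_nonneg (by positivity) (le_max_of_le_left (mul_nonneg (matOpOne_nonneg _)
        (by positivity))))).1 hω
    exact lt_of_le_of_lt (mul_le_mul_of_nonneg_left (le_max_left _ _) (by positivity)) hω'
  · have h7 : 2 / (n : ℝ) ≤ ε / 4 := by
      have := (Nat.ceil_le.1 h6)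
      rw [div_le_iff₀ hε] at this
      rw [div_le_iff₀ hn0]
      linarith
    rw [← hc, div_div_cancel₀ hc0.ne']
    refine (add_le_add (add_le_add h1 (ENNReal.ofReal_le_ofReal h7)) le_rfl).trans ?_
    rw [← ENNReal.ofReal_add (by positivity) (by positivity),
      ← ENNReal.ofReal_add (by positivity) (by positivity)]
    exact ENNReal.ofReal_le_ofReal (by linarith)
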